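/- A machine alternates between free ($0$) and busy ($1$) as a continuous-time Markov chain $X(t)$ with rates $\alpha$ ($0\to1$) and $\beta$ ($1\to0$). A resource allocator samples its state at the points of a Poisson process of rate $\mu$, and keeps the last known state $\hat X(t)$ as estimate, of age $\Delta(t)$ (the time since the state was last known exactly). Jobs arrive at the allocator as a Poisson process of rate $\lambda$; the arrivals, the sampling and the dynamics of the machine are independent and $\alpha,\beta,\lambda,\mu>0$. A job that finds the unit-sized buffer empty is accepted and held; jobs that arrive while a job is held are lost. When a job is submitted it earns $r_s$ if the machine is free and costs $c_d$ if it is busy; right after it $X=\hat X=1$, $\Delta=0$, and the buffer is empty. A stationary policy is a measurable family $\tau_{i,u}\in[0,\infty]$: a job accepted when $\hat X=i$, $\Delta=u$ is submitted after a time $\tau_{i,u}$, unless a new sample $j$ arrives before, in which case the waiting starts afresh with $\tau_{j,0}$, and so on. Let $S(t)$, $D(t)$, $N(t)$ be the numbers of jobs submitted to a free machine, submitted to a busy machine, and arrived, by time $t$. Let $R(i,u,\tau_{i,u})\in\mathbb R$ be the expected revenue (zero if there is no submission) of a job accepted when $\hat X=i$, $\Delta=u$, and $L(i,u,\tau_{i,u})\in[0,\infty]$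 the expected number of jobs lost while it is held. Let $p_i$ be the probability that the first job accepted after a submission is accepted when the estimate is $i$. **Theorem.** For every stationary policy, started with an empty buffer from any values of $X(0)$, $\hat X(0)$, $\Delta(0)\ge0$, the limit $\lim_{t\to\infty}\frac{r_sS(t)-c_dD(t)}{N(t)}$ exists almost surely and is almost surely equal to its expectation $R$, and $$R=\frac{\sum_{i=0}^1p_i\,\mathbb E[R(i,U,\tau_{i,U})]}{1+\sum_{i=0}^1p_i\,\mathbb E[L(i,U,\tau_{i,U})]},\qquad U\sim\mathrm{Exp}(\lambda+\mu),$$ where the quotient is $0$ if the denominator is infinite. Here $p_0+p_1=1$ and, given that the first job accepted after a submission is accepted when the estimate is $i$, the age of the estimate at that time has the law of $U$. -/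

import Mathlib

open MeasureTheory ProbabilityTheory Filter Topology
open scoped ENNReal

namespace MarkovMachine

/-- Parameters: `α` is the rate of internal job arrivals at the machine, `β` its service rate,
`lam` the rate of external job arrivals at the resource allocator, `μ` the rate of sampling
queries, `rs` the revenue of a successful submission, `cd` the penalty of a discarded one. -/
structure Params where
  α : ℝ
  β : ℝ
  lam : ℝ
  μ : ℝ
  rs : ℝ
  cd : ℝ
  α_pos : 0 < α
  β_pos : 0 < β
  lam_pos : 0 < lam
  μ_pos : 0 < μ

/-- The four independent Poisson streams that drive the system: internal job arrivals at the
machine, (potential) service completions at the machine, external job arrivals at the resource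
allocator, and sampling queries. -/
inductive Source
  | internal
  | service
  | job
  | query

/-- The rate of each Poisson stream. -/
def Params.rate (p : Params) : Source → ℝ
  | .internal => p.α
  | .service => p.β
  | .job => p.lam
  | .query => p.μ

/-- A realisation of the inter-arrival times: `ω (k, 0)` is the time until the next point of
stream `k`, and `ω (k, n)` with `n ≥ 1` are the gaps between its subsequent points. -/
abbrev Noise : Type := Source × ℕ → ℝ

/-- The law of the inter-arrival times: all independent, those of stream `k` exponential with the
rate of `k`. That is, the four streams are independent Poisson processes. -/
noncomputable def Params.law (p : Params) : Measure Noise :=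
  Measure.infinitePi fun k : Source × ℕ => expMeasure (p.rate k.1)

/-- A stationary policy: `τ i u` is the time to wait before submitting the job when the current
estimate is `i` and its age is `u`. The value `⊤` means to wait for the next sample. -/
abbrev Policy : Type := Fin 2 → ℝ → ℝ≥0∞

/-- State of the system. States of the machine are `0` (free) and `1` (busy). -/
structure SysState where
  /-- actual state of the machine -/
  x : Fin 2
  /-- estimate held by the resource allocator -/
  est : Fin 2
  /-- age of the estimate -/
  age : ℝ
  /-- whether the unit-sized buffer is occupied -/
  holding : Bool
  /-- remaining time until the submission of the held job (irrelevant if the buffer is empty) -/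
  wait : ℝ≥0∞

/-- The events that change the state: a point of one of the streams, or the submission of the
held job. -/
inductive Event
  | point (k : Source)
  | submit

/-- Time until the next point of any of the streams. -/
noncomputable def nextTime (ω : Noise) : ℝ :=
  min (min (ω (.internal, 0)) (ω (.service, 0))) (min (ω (.job, 0)) (ω (.query, 0)))

open Classical in
/-- The stream that has the next point (ties have probability zero). -/
noncomputable def nextSource (ω : Noise) : Source :=
  if ω (.internal, 0) = nextTime ω then .internal
  else if ω (.service, 0) = nextTime ω then .service
  else if ω (.job, 0) = nextTime ω then .job
  else .query

open Classical in
/-- The next event: the held job, if any, is submitted if its waiting time runs out before the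
next point of the streams. -/
noncomputable def nextEvent (s : SysState) (ω : Noise) : Event :=
  if s.holding = true ∧ s.wait ≤ ENNReal.ofReal (nextTime ω) then .submit
  else .point (nextSource ω)

/-- The time until the next event. -/
noncomputable def nextDelay (s : SysState) (ω : Noise) : ℝ :=
  match nextEvent s ω with
  | .submit => s.wait.toReal
  | .point _ => nextTime ω

/-- Between events only the clocks of the resource allocator move. -/
noncomputable def SysState.advance (s : SysState) (d : ℝ) : SysState :=
  { s with age := s.age + d, wait := s.wait - ENNReal.ofReal d }

/-- The effect of an event on the state just before it. An internal arrival makes the machine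
busy, a service completion makes it free (with no effect on a busy, respectively free, machine).
A job that finds the buffer empty is accepted, and is otherwise lost. A query refreshes the
estimate, and the waiting time of a held job is decided anew. A submission empties the buffer,
after which the machine is busy and known to be busy. -/
noncomputable def SysState.apply (τ : Policy) (s : SysState) : Event → SysState
  | .point .internal => { s with x := 1 }
  | .point .service => { s with x := 0 }
  | .point .job => if s.holding = true then s
      else { s with holding := true, wait := τ s.est s.age }
  | .point .query => { s with est := s.x, age := 0, wait := τ s.x 0 }
  | .submit => { x := 1, est := 1, age := 0, holding := false, wait := ⊤ }

open Classical in
/-- The inter-arrival times as seen after the time `d` at which the event `e` occurs. -/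
noncomputable def shiftNoise (e : Event) (d : ℝ) (ω : Noise) : Noise := fun kn =>
  if e = .point kn.1 then ω (kn.1, kn.2 + 1)
  else if kn.2 = 0 then ω kn - d
  else ω kn

/-- One event of the system. -/
noncomputable def step (τ : Policy) (c : SysState × Noise) : SysState × Noise :=
  ((c.1.advance (nextDelay c.1 c.2)).apply τ (nextEvent c.1 c.2),
    shiftNoise (nextEvent c.1 c.2) (nextDelay c.1 c.2) c.2)

/-- State and remaining inter-arrival times right after the first `n` events, started from
the state `s`. -/
noncomputable def config (τ : Policy) (s : SysState) (ω : Noise) (n : ℕ) : SysState × Noise :=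
  (step τ)^[n] (s, ω)

/-- The `n`-th event (counted from `0`). -/
noncomputable def event (τ : Policy) (s : SysState) (ω : Noise) (n : ℕ) : Event :=
  nextEvent (config τ s ω n).1 (config τ s ω n).2

/-- The time between the `n`-th event and the one before it (or the start). -/
noncomputable def delay (τ : Policy) (s : SysState) (ω : Noise) (n : ℕ) : ℝ :=
  nextDelay (config τ s ω n).1 (config τ s ω n).2

/-- The state just before the `n`-th event. -/
noncomputable def stateBefore (τ : Policy) (s : SysState) (ω : Noise) (n : ℕ) : SysState :=
  (config τ s ω n).1.advance (delay τ s ω n)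

/-- The time of the `n`-th event. -/
noncomputable def eventTime (τ : Policy) (s : SysState) (ω : Noise) (n : ℕ) : ℝ :=
  ∑ m ∈ Finset.range (n + 1), delay τ s ω m

/-- `S(t)`: number of jobs submitted by time `t` to a machine that was free. -/
noncomputable def numSuccess (τ : Policy) (s : SysState) (ω : Noise) (t : ℝ) : ℕ :=
  {n : ℕ | eventTime τ s ω n ≤ t ∧ event τ s ω n = .submit ∧ (stateBefore τ s ω n).x = 0}.ncard

/-- `D(t)`: number of jobs submitted by time `t` to a machine that was busy. -/
noncomputable def numDiscard (τ : Policy) (s : SysState) (ω : Noise) (t : ℝ) : ℕ :=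
  {n : ℕ | eventTime τ s ω n ≤ t ∧ event τ s ω n = .submit ∧ (stateBefore τ s ω n).x = 1}.ncard

/-- `N(t)`: number of jobs that arrived at the resource allocator by time `t`, whether accepted
or lost. -/
noncomputable def numJobs (τ : Policy) (s : SysState) (ω : Noise) (t : ℝ) : ℕ :=
  {n : ℕ | eventTime τ s ω n ≤ t ∧ event τ s ω n = .point .job}.ncard

/-- Revenue per arrived job up to time `t`, `(rs S(t) - cd D(t)) / N(t)`. -/
noncomputable def revenueRate (p : Params) (τ : Policy) (s : SysState) (ω : Noise) (t : ℝ) : ℝ :=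
  (p.rs * numSuccess τ s ω t - p.cd * numDiscard τ s ω t) / numJobs τ s ω t

/-- The average revenue per arriving job, `R = E[lim_{t → ∞} (rs S(t) - cd D(t)) / N(t)]`. -/
noncomputable def averageRevenue (p : Params) (τ : Policy) (s : SysState) : ℝ :=
  ∫ ω, limUnder atTop (fun t : ℝ => revenueRate p τ s ω t) ∂p.law

/-- State with an empty buffer, machine in state `x`, and estimate `i` of age `u`. -/
noncomputable def emptyState (x i : Fin 2) (u : ℝ) : SysState :=
  { x := x, est := i, age := u, holding := false, wait := ⊤ }

/-- State right after a job has been accepted while the machine is in state `x` and the estimate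
is `i`, of age `u`. -/
noncomputable def acceptState (τ : Policy) (x i : Fin 2) (u : ℝ) : SysState :=
  { x := x, est := i, age := u, holding := true, wait := τ i u }

/-- Started from an empty buffer in `s`, the first job arrives (and so is accepted) when the
estimate is `i`, of age `u`. -/
def FirstAccepted (τ : Policy) (s : SysState) (ω : Noise) (i : Fin 2) (u : ℝ) : Prop :=
  ∃ n : ℕ, event τ s ω n = .point .job ∧ (∀ m < n, event τ s ω m ≠ .point .job) ∧
    (stateBefore τ s ω n).est = i ∧ (stateBefore τ s ω n).age = u

/-- `p_i`: the probability that the next job to be accepted after a submission is accepted when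
the estimate is `i`. After a submission the machine and the estimate are in state `1`. -/
noncomputable def acceptProb (p : Params) (τ : Policy) (i : Fin 2) : ℝ≥0∞ :=
  p.law {ω | ∃ u : ℝ, FirstAccepted τ (emptyState 1 1 0) ω i u}

/-- Generator of the free/busy chain of the machine. -/
def Params.generator (p : Params) : Matrix (Fin 2) (Fin 2) ℝ :=
  !![-p.α, p.α; p.β, -p.β]

/-- Transition matrix of the free/busy chain of the machine over a time `u`. -/
noncomputable def Params.transition (p : Params) (u : ℝ) : Matrix (Fin 2) (Fin 2) ℝ :=
  NormedSpace.exp (u • p.generator)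

open Classical in
/-- The revenue or penalty of the first submission (zero if there is none). -/
noncomputable def reward (p : Params) (τ : Policy) (s : SysState) (ω : Noise) : ℝ :=
  if h : ∃ n, event τ s ω n = .submit then
    if (stateBefore τ s ω (Nat.find h)).x = 0 then p.rs else -p.cd
  else 0

/-- The number of jobs that arrive, and are lost, before the first submission, started from an
occupied buffer. It may be infinite if there is no submission. -/
noncomputable def lost (τ : Policy) (s : SysState) (ω : Noise) : ℕ∞ :=
  {n : ℕ | event τ s ω n = .point .job ∧ ∀ m ≤ n, event τ s ω m ≠ .submit}.encard

/-- `R(i, u, τ_{i,u})`: expected revenue of a job accepted when the estimate is `i`, of age `u`.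
The machine is then in state `x` with probability `P_{ix}^u`. -/
noncomputable def expectedReward (p : Params) (τ : Policy) (i : Fin 2) (u : ℝ) : ℝ :=
  ∑ x, p.transition u i x * ∫ ω, reward p τ (acceptState τ x i u) ω ∂p.law

/-- `L(i, u, τ_{i,u})`: expected number of jobs lost while holding a job that was accepted when
the estimate is `i`, of age `u`. -/
noncomputable def expectedLost (p : Params) (τ : Policy) (i : Fin 2) (u : ℝ) : ℝ≥0∞ :=
  ∑ x, ENNReal.ofReal (p.transition u i x) *
    ∫⁻ ω, (lost τ (acceptState τ x i u) ω : ℝ≥0∞) ∂p.law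

/-- The law of `U`, exponential with rate `lam + μ`. -/
noncomputable def Params.ageLaw (p : Params) : Measure ℝ := expMeasure (p.lam + p.μ)

/-- `∑ i, p_i E[R(i, U, τ_{i,U})]`. -/
noncomputable def meanReward (p : Params) (τ : Policy) : ℝ :=
  ∑ i, (acceptProb p τ i).toReal * ∫ u, expectedReward p τ i u ∂p.ageLaw

/-- `∑ i, p_i E[L(i, U, τ_{i,U})]`, possibly infinite. -/
noncomputable def meanLost (p : Params) (τ : Policy) : ℝ≥0∞ :=
  ∑ i, acceptProb p τ i * ∫⁻ u, expectedLost p τ i u ∂p.ageLaw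

end MarkovMachine

/-! The theorem is a renewal-reward theorem. Right after every submission the system is in the
single state `emptyState 1 1 0`, and by the strong Markov property the noise still to come has its
original law and is independent of the past. As long as submissions occur, the path splits into
independent, identically distributed cycles, each ending with a submission. A cycle earns only at
its end, so the revenue among the first `n` events is a sum over completed cycles, while the number
of arrivals lies between the sums over the completed cycles and over one cycle more. The strong law
gives the limit as mean revenue per cycle over mean number of arrivals per cycle
(`tendsto_ratio_of_ae_submit`). These arrivals are the accepted job and those lost while it is held
(`lost_of_job`), whence the denominator.

The Markov property is derived from the product law of the gaps. Competing exponentials and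
memorylessness make the next event and its delay independent of the shifted gaps (`law_step`);
induction gives `fresh_history`, and slicing by the index of the first occurrence of an event gives
`lintegral_noiseAfter`. If submissions are almost sure, the shift `nextCycle` by a whole cycle
preserves the law and is independent of the data of that cycle, which suffices for a strong law
along its iterates (`strong_law_iterate`).

The means are identified through the joint law of machine, estimate and age at the first arrival
(`acceptMean_emptyState`). Between jobs and queries the machine is a free/busy chain killed at rate
`lam + μ`, so mean values are resolvents of that chain (`acceptMean_eq_resolvent`). The values right
after a query then solve a linear contraction system, and its solution shows that, given the
estimate `i` at acceptance, the age is exponential with rate `lam + μ` and, given the age `u`, the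
machine has the law `p.transition u i`.

Two degenerate cases give the limit `0`. If a cycle fails to end with positive probability,
infinitely many jobs are lost on that event, so the denominator is infinite; almost surely some
cycle does not end and the revenue stays bounded while arrivals do not. If cycles end almost surely
but the mean number of arrivals is infinite, truncation makes the averages diverge. Another start
changes only finitely many terms, once a submission is known to occur (`ae_exists_submit`). Events
do not accumulate, since each submission uses up an accepted job (`Regular.tendsto_elapsed`), so
limits along events are limits in time. -/

namespace MarkovMachine

/-! ### Multiples of infinite product measures -/

section Product

variable {ι : Type*} {X : ι → Type*} {mX : ∀ i, MeasurableSpace (X i)}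

/-- A measure whose mass on boxes is a fixed multiple of the product of the masses of the sides is
that multiple of the product measure. -/
theorem eq_smul_infinitePi (μ : ∀ i, Measure (X i)) [∀ i, IsProbabilityMeasure (μ i)]
    (ν : Measure (∀ i, X i)) (c : ℝ≥0∞) (hc : c ≠ ⊤)
    (h : ∀ (s : Finset ι) (t : ∀ i, Set (X i)), (∀ i, MeasurableSet (t i)) →
      ν (Set.pi s t) = c * ∏ i ∈ s, μ i (t i)) :
    ν = c • Measure.infinitePi μ := by
  have huniv : ν Set.univ = c := by simpa using h ∅ (fun _ => Set.univ) (fun _ => .univ)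
  by_cases h0 : c = 0
  · subst h0
    rw [zero_smul]
    exact Measure.measure_univ_eq_zero.1 huniv
  · rw [← Measure.eq_infinitePi μ (ν := c⁻¹ • ν), smul_smul, ENNReal.mul_inv_cancel h0 hc, one_smul]
    intro s t ht
    rw [Measure.smul_apply, h s t ht, smul_eq_mul, ← mul_assoc, ENNReal.inv_mul_cancel h0 hc,
      one_mul]

end Product

/-! ### The exponential law and memorylessness -/

section Exponential

variable {r : ℝ}

theorem lintegral_expMeasure (r : ℝ) {f : ℝ → ℝ≥0∞} (hf : Measurable f) :
    ∫⁻ t, f t ∂expMeasure r =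
      ∫⁻ t in Set.Ici 0, ENNReal.ofReal (r * Real.exp (-(r * t))) * f t := by
  have hm : Measurable (exponentialPDF r) := (measurable_exponentialPDFReal r).ennreal_ofReal
  have : expMeasure r = volume.withDensity (exponentialPDF r) := rfl
  rw [this, lintegral_withDensity_eq_lintegral_mul _ hm hf, ← lintegral_indicator measurableSet_Ici]
  refine lintegral_congr fun t => ?_
  by_cases ht : t ∈ Set.Ici (0 : ℝ)
  · rw [Set.indicator_of_mem ht, Pi.mul_apply, exponentialPDF_of_nonneg ht]
  · rw [Set.indicator_of_notMem ht, Pi.mul_apply, exponentialPDF_of_neg (by simpa using ht),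
      zero_mul]

theorem expMeasure_absolutelyContinuous (r : ℝ) : expMeasure r ≪ volume :=
  withDensity_absolutelyContinuous _ _

instance (r : ℝ) : NullSingletonClass (expMeasure r) :=
  ⟨fun x => expMeasure_absolutelyContinuous r (measure_singleton x)⟩

theorem ae_expMeasure_pos (r : ℝ) : ∀ᵐ t ∂expMeasure r, 0 < t := by
  have h : expMeasure r (Set.Iio 0) = 0 := by
    rw [← lintegral_indicator_one measurableSet_Iio,
      lintegral_expMeasure r (measurable_one.indicator measurableSet_Iio)]
    refine (setLIntegral_congr_fun measurableSet_Ici fun t ht => ?_).trans lintegral_zero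
    simp only [Set.mem_Ici] at ht
    simp [ht]
  have h' : expMeasure r (Set.Iio 0 ∪ {0}) = 0 := measure_union_null h (measure_singleton 0)
  refine measure_mono_null (fun t ht => ?_) h'
  simp only [Set.mem_compl_iff, Set.mem_ofPred_eq, not_lt] at ht
  rcases ht.lt_or_eq with h | h
  · exact Or.inl h
  · exact Or.inr h

/-- Memorylessness of the exponential distribution. -/
theorem expMeasure_memoryless (r : ℝ) {t : ℝ} (ht : 0 ≤ t) {G s : Set ℝ}
    (hs : MeasurableSet s) (hG₁ : Set.Ioi t ⊆ G) (hG₂ : G ⊆ Set.Ici t) :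
    expMeasure r (G ∩ (fun a => a - t) ⁻¹' s) =
      ENNReal.ofReal (Real.exp (-(r * t))) * expMeasure r s := by
  -- The admissible choices of `G` differ only in the null point `t`, so `G` may be replaced by the
  -- closed half-line.
  have hG : expMeasure r (G ∩ (fun a => a - t) ⁻¹' s) =
      expMeasure r (Set.Ici t ∩ (fun a => a - t) ⁻¹' s) := by
    refine le_antisymm (measure_mono (Set.inter_subset_inter_left _ hG₂)) ?_
    calc _ ≤ expMeasure r (G ∩ (fun a => a - t) ⁻¹' s ∪ {t}) := measure_mono fun a ha => by
          rcases (Set.mem_Ici.1 ha.1).lt_or_eq with h | h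
          · exact Or.inl ⟨hG₁ h, ha.2⟩
          · exact Or.inr h.symm
      _ ≤ _ := (measure_union_le _ _).trans (by simp)
  have hm : MeasurableSet (Set.Ici t ∩ (fun a => a - t) ⁻¹' s) :=
    measurableSet_Ici.inter ((measurable_id.sub_const t) hs)
  rw [hG, ← lintegral_indicator_one hm, lintegral_expMeasure r (measurable_one.indicator hm),
    ← lintegral_indicator_one hs, lintegral_expMeasure r (measurable_one.indicator hs),
    ← lintegral_const_mul' _ _ ENNReal.ofReal_ne_top, ← lintegral_indicator measurableSet_Ici,
    ← lintegral_indicator measurableSet_Ici, eq_comm, ← lintegral_sub_right_eq_self _ t]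
  refine lintegral_congr fun a => ?_
  by_cases ha : t ≤ a
  · have h0 : 0 ≤ a := ht.trans ha
    by_cases hb : a - t ∈ s
    · simp only [Set.indicator, Set.mem_Ici, h0, Set.mem_inter_iff, ha, Set.mem_preimage, hb,
        sub_nonneg, and_self, if_true, Pi.one_apply, mul_one]
      rw [← ENNReal.ofReal_mul (Real.exp_nonneg _), mul_left_comm, ← Real.exp_add]
      ring_nf
    · simp [Set.indicator, hb]
  · simp [Set.indicator, ha]

end Exponential

/-! ### The product law of the gaps: memorylessness and removal of one gap -/

noncomputable instance : DecidableEq Source := Classical.decEq _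

noncomputable instance : Fintype Source :=
  ⟨{.internal, .service, .job, .query}, fun x => by cases x <;> simp⟩

theorem sum_source {M : Type*} [AddCommMonoid M] (f : Source → M) :
    ∑ k, f k = f .internal + f .service + f .job + f .query := by
  change ∑ k ∈ {.internal, .service, .job, .query}, f k = _
  rw [Finset.sum_insert (by simp), Finset.sum_insert (by simp), Finset.sum_insert (by simp),
    Finset.sum_singleton]
  simp only [add_assoc]

theorem Params.rate_pos (p : Params) (k : Source) : 0 < p.rate k := by
  cases k
  exacts [p.α_pos, p.β_pos, p.lam_pos, p.μ_pos]

instance (p : Params) (k : Source) : IsProbabilityMeasure (expMeasure (p.rate k)) :=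
  isProbabilityMeasure_expMeasure (p.rate_pos k)

instance (p : Params) : IsProbabilityMeasure p.law := by
  unfold Params.law; infer_instance

theorem Params.law_pi (p : Params) (s : Finset (Source × ℕ)) {t : Source × ℕ → Set ℝ}
    (ht : ∀ i, MeasurableSet (t i)) :
    p.law (Set.pi s t) = ∏ i ∈ s, expMeasure (p.rate i.1) (t i) :=
  Measure.infinitePi_pi _ fun i _ => ht i

theorem Params.ae_pos (p : Params) : ∀ᵐ ω ∂p.law, ∀ i, 0 < ω i := by
  rw [ae_all_iff]
  intro i
  have := (measurePreserving_eval_infinitePi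
    (fun k : Source × ℕ => expMeasure (p.rate k.1)) i).quasiMeasurePreserving.ae
    (ae_expMeasure_pos (p.rate i.1))
  exact this

/-- On boxes the measure factors, and each coordinate in `J` contributes one exponential factor by
memorylessness. The set `G` is only pinned down up to its endpoint so that weak and strict
inequalities between clocks are covered at once. -/
theorem Params.law_memoryless (p : Params) (J : Finset (Source × ℕ)) {t : ℝ} (ht : 0 ≤ t)
    {G : Set ℝ} (hGm : MeasurableSet G) (hG₁ : Set.Ioi t ⊆ G) (hG₂ : G ⊆ Set.Ici t)
    {E : Set Noise} (hE : MeasurableSet E) :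
    p.law {ω | (∀ i ∈ J, ω i ∈ G) ∧ (fun i => if i ∈ J then ω i - t else ω i) ∈ E} =
      ENNReal.ofReal (Real.exp (-((∑ i ∈ J, p.rate i.1) * t))) * p.law E := by
  have hS : Measurable fun (ω : Noise) (i : Source × ℕ) => if i ∈ J then ω i - t else ω i := by
    refine measurable_pi_lambda _ fun i => ?_
    split_ifs <;> fun_prop
  have hA : MeasurableSet {ω : Noise | ∀ i ∈ J, ω i ∈ G} := by
    have : {ω : Noise | ∀ i ∈ J, ω i ∈ G} = Set.pi J fun _ => G := rfl
    rw [this]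
    exact .pi J.countable_toSet fun _ _ => hGm
  have key := eq_smul_infinitePi (fun k : Source × ℕ => expMeasure (p.rate k.1))
    ((p.law.restrict {ω : Noise | ∀ i ∈ J, ω i ∈ G}).map
      fun ω i => if i ∈ J then ω i - t else ω i)
    (ENNReal.ofReal (Real.exp (-((∑ i ∈ J, p.rate i.1) * t)))) ENNReal.ofReal_ne_top ?_
  · have := congrArg (fun m => m E) key
    simp only [Measure.map_apply hS hE, Measure.restrict_apply (hS hE), Measure.smul_apply] at this
    rw [Set.inter_comm] at this
    exact this
  · intro s T hT
    rw [Measure.map_apply hS (.pi s.countable_toSet fun i _ => hT i),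
      Measure.restrict_apply (hS (.pi s.countable_toSet fun i _ => hT i))]
    -- The preimage of a box, cut by the condition on `J`, is again a box, now over `s ∪ J`.
    have : (fun (ω : Noise) i => if i ∈ J then ω i - t else ω i) ⁻¹' (Set.pi s T) ∩
        {ω : Noise | ∀ i ∈ J, ω i ∈ G} =
        Set.pi ↑(s ∪ J) fun i => if i ∈ J then G ∩ (fun a => a - t) ⁻¹'
          (if i ∈ s then T i else Set.univ) else T i := by
      ext ω
      simp only [Set.mem_inter_iff, Set.mem_preimage, Set.mem_pi, Finset.mem_coe, Set.mem_ofPred_eq,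
        Finset.mem_union]
      constructor
      · rintro ⟨h1, h2⟩ i hi
        by_cases hJ : i ∈ J
        · rw [if_pos hJ]
          refine ⟨h2 i hJ, ?_⟩
          by_cases his : i ∈ s
          · simpa [his, hJ] using h1 i his
          · simp [his]
        · rw [if_neg hJ]
          simpa [hJ] using h1 i (by tauto)
      · intro h
        constructor
        · intro i hi
          have := h i (Or.inl hi)
          split_ifs at this ⊢ with hJ
          · exact this.2
          · exact this
        · intro i hi
          have := h i (Or.inr hi)
          rw [if_pos hi] at this
          exact this.1
    rw [this, p.law_pi]
    · have h2 : ∀ i ∈ s ∪ J, expMeasure (p.rate i.1) (if i ∈ J then G ∩ (fun a => a - t) ⁻¹'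
          (if i ∈ s then T i else Set.univ) else T i) =
          (if i ∈ J then ENNReal.ofReal (Real.exp (-(p.rate i.1 * t))) else 1) *
            (if i ∈ s then expMeasure (p.rate i.1) (T i) else 1) := by
        intro i hi
        rw [Finset.mem_union] at hi
        by_cases hJ : i ∈ J
        · rw [if_pos hJ, if_pos hJ, expMeasure_memoryless _ ht _ hG₁ hG₂]
          · by_cases his : i ∈ s <;> simp [his]
          · by_cases his : i ∈ s <;> simp [his, hT]
        · have his : i ∈ s := by tauto
          simp [hJ, his]
      rw [Finset.prod_congr rfl h2, Finset.prod_mul_distrib, Finset.prod_ite_mem,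
        Finset.prod_ite_mem, Finset.union_inter_cancel_left, Finset.union_inter_cancel_right,
        ← ENNReal.ofReal_prod_of_nonneg (fun _ _ => Real.exp_nonneg _), ← Real.exp_sum,
        Finset.sum_neg_distrib, Finset.sum_mul]
    · intro i
      split_ifs
      · exact hGm.inter ((measurable_id.sub_const t) (hT i))
      · exact hGm.inter ((measurable_id.sub_const t) .univ)
      · exact hT i

/-- Relabelling of the inter-arrival times once the next point of stream `k` is removed. -/
noncomputable def later (k : Source) (i : Source × ℕ) : Source × ℕ :=
  if i.1 = k then (k, i.2 + 1) else i

/-- The relabelling `later k` is injective, preserves the stream and misses `(k, 0)`, so the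
relabelled gaps are independent of that coordinate and again have the law `p.law`. -/
theorem Params.law_split (p : Params) (k : Source) :
    p.law.map (fun ω => (ω (k, 0), fun i => ω (later k i))) =
      (expMeasure (p.rate k)).prod p.law := by
  have hS : Measurable fun (ω : Noise) (i : Source × ℕ) => ω (later k i) := by fun_prop
  symm
  refine Measure.prod_eq fun C E hC hE => ?_
  rw [Measure.map_apply (by fun_prop) (hC.prod hE)]
  have hA : MeasurableSet {ω : Noise | ω (k, 0) ∈ C} := measurable_pi_apply _ hC
  have key := eq_smul_infinitePi (fun k : Source × ℕ => expMeasure (p.rate k.1))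
    ((p.law.restrict {ω : Noise | ω (k, 0) ∈ C}).map fun ω i => ω (later k i))
    (expMeasure (p.rate k) C) (measure_ne_top _ _) ?_
  · have := congrArg (fun m => m E) key
    simp only [Measure.map_apply hS hE, Measure.restrict_apply (hS hE), Measure.smul_apply] at this
    rw [Set.inter_comm] at this
    exact this
  · intro s T hT
    rw [Measure.map_apply hS (.pi s.countable_toSet fun i _ => hT i),
      Measure.restrict_apply (hS (.pi s.countable_toSet fun i _ => hT i))]
    have hinj : Function.Injective (later k) := by
      rintro ⟨a, m⟩ ⟨b, n⟩ h
      by_cases ha : a = k <;> by_cases hb : b = k <;> simp_all [later]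
    have hnot : (k, 0) ∉ s.image (later k) := by
      simp only [Finset.mem_image, later, not_exists, not_and]
      rintro ⟨a, m⟩ _ h
      by_cases ha : a = k <;> simp_all
    -- The truncated subtraction `i.2 - 1` inverts `later k` on its range; the point `(k, 0)`, where
    -- it would not, is the separate case carrying `C`.
    have hset : (fun (ω : Noise) i => ω (later k i)) ⁻¹' (Set.pi s T) ∩
        {ω : Noise | ω (k, 0) ∈ C} =
        Set.pi ↑(insert (k, 0) (s.image (later k)))
          fun i => if i = (k, 0) then C else T (if i.1 = k then (k, i.2 - 1) else i) := by
      ext ω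
      have hl : ∀ i, later k i ≠ (k, 0) := by
        rintro ⟨a, m⟩ h
        by_cases ha : a = k <;> simp_all [later]
      have hl' : ∀ i : Source × ℕ,
          (if (later k i).1 = k then (k, (later k i).2 - 1) else later k i) = i := by
        rintro ⟨a, m⟩
        by_cases ha : a = k <;> simp_all [later]
      simp only [Set.mem_inter_iff, Set.mem_preimage, Set.mem_pi, Finset.mem_coe, Set.mem_ofPred_eq,
        Finset.mem_insert, Finset.mem_image, forall_eq_or_imp, forall_exists_index, and_imp,
        forall_apply_eq_imp_iff₂, if_true, hl, if_false, hl']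
      exact and_comm
    rw [hset, p.law_pi, Finset.prod_insert hnot, Finset.prod_image fun _ _ _ _ h => hinj h]
    · refine congrArg₂ (· * ·) (by simp) (Finset.prod_congr rfl ?_)
      rintro ⟨a, m⟩ _
      by_cases ha : a = k <;> simp_all [later]
    · intro i
      split_ifs
      exacts [hC, hT _, hT _]

/-! ### Measurability of the dynamics -/

instance : MeasurableSpace Source := ⊤
instance : MeasurableSpace Event := ⊤
instance : DiscreteMeasurableSpace Event := ⟨fun _ => trivial⟩

noncomputable instance : Fintype Event :=
  ⟨Finset.cons .submit (Finset.univ.map ⟨Event.point, fun _ _ h => by injection h⟩) (by simp),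
    fun e => by
    cases e with
    | submit => simp
    | point k => exact Finset.mem_cons_of_mem (Finset.mem_map.2 ⟨k, Finset.mem_univ k, rfl⟩)⟩

instance : MeasurableSpace SysState :=
  MeasurableSpace.comap (fun s => (s.x, s.est, s.age, s.holding, s.wait)) inferInstance

section Measurability

variable {A : Type*} [MeasurableSpace A]

theorem measurable_sysState {f : A → SysState} (h₁ : Measurable fun a => (f a).x)
    (h₂ : Measurable fun a => (f a).est) (h₃ : Measurable fun a => (f a).age)
    (h₄ : Measurable fun a => (f a).holding) (h₅ : Measurable fun a => (f a).wait) :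
    Measurable f :=
  measurable_comap_iff.2 (h₁.prodMk (h₂.prodMk (h₃.prodMk (h₄.prodMk h₅))))

theorem measurable_fields :
    Measurable fun s : SysState => (s.x, s.est, s.age, s.holding, s.wait) :=
  comap_measurable _

@[fun_prop]
theorem measurable_x : Measurable SysState.x := measurable_fields.fst

@[fun_prop]
theorem measurable_est : Measurable SysState.est := measurable_fields.snd.fst

@[fun_prop]
theorem measurable_age : Measurable SysState.age := measurable_fields.snd.snd.fst

@[fun_prop]
theorem measurable_holding : Measurable SysState.holding := measurable_fields.snd.snd.snd.fst

@[fun_prop]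
theorem measurable_wait : Measurable SysState.wait := measurable_fields.snd.snd.snd.snd

@[fun_prop]
theorem measurable_nextTime : Measurable nextTime := by
  unfold nextTime; fun_prop

@[fun_prop]
theorem measurable_nextSource : Measurable nextSource := by
  unfold nextSource
  refine Measurable.ite (measurableSet_eq_fun (by fun_prop) (by fun_prop)) measurable_const ?_
  refine Measurable.ite (measurableSet_eq_fun (by fun_prop) (by fun_prop)) measurable_const ?_
  exact Measurable.ite (measurableSet_eq_fun (by fun_prop) (by fun_prop)) measurable_const
    measurable_const

theorem measurableSet_submits : MeasurableSet
    {c : SysState × Noise | c.1.holding = true ∧ c.1.wait ≤ ENNReal.ofReal (nextTime c.2)} := by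
  refine MeasurableSet.inter (s₁ := {c : SysState × Noise | c.1.holding = true}) ?_ ?_
  · exact measurableSet_eq_fun (by fun_prop) measurable_const
  · exact measurableSet_le (measurable_wait.comp measurable_fst)
      (measurable_nextTime.comp measurable_snd).ennreal_ofReal

theorem measurable_nextEvent : Measurable fun c : SysState × Noise => nextEvent c.1 c.2 := by
  unfold nextEvent
  exact Measurable.ite measurableSet_submits measurable_const
    ((measurable_from_top (f := Event.point)).comp (by fun_prop))

open Classical in
theorem nextDelay_eq (s : SysState) (ω : Noise) : nextDelay s ω =
    if s.holding = true ∧ s.wait ≤ ENNReal.ofReal (nextTime ω) then s.wait.toReal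
      else nextTime ω := by
  unfold nextDelay nextEvent
  split_ifs <;> rfl

theorem measurable_nextDelay : Measurable fun c : SysState × Noise => nextDelay c.1 c.2 := by
  simp only [nextDelay_eq]
  exact Measurable.ite measurableSet_submits (by fun_prop) (by fun_prop)

theorem measurable_advance : Measurable fun c : SysState × ℝ => c.1.advance c.2 := by
  refine measurable_sysState ?_ ?_ ?_ ?_ ?_ <;> simp only [SysState.advance] <;> fun_prop

theorem Policy.measurable {τ : Policy} (hτ : ∀ i, Measurable (τ i)) :
    Measurable fun c : Fin 2 × ℝ => τ c.1 c.2 :=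
  measurable_from_prod_countable_right hτ

theorem measurable_apply {τ : Policy} (hτ : ∀ i, Measurable (τ i)) :
    Measurable fun c : Event × SysState => c.2.apply τ c.1 := by
  have h := Policy.measurable hτ
  refine measurable_from_prod_countable_right fun e => ?_
  match e with
  | .submit => exact measurable_const
  | .point .internal =>
    refine measurable_sysState ?_ ?_ ?_ ?_ ?_ <;> simp only [SysState.apply] <;> fun_prop
  | .point .service =>
    refine measurable_sysState ?_ ?_ ?_ ?_ ?_ <;> simp only [SysState.apply] <;> fun_prop
  | .point .job =>
    refine Measurable.ite (measurableSet_eq_fun (by fun_prop) measurable_const) measurable_id ?_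
    exact measurable_sysState (by fun_prop) (by fun_prop) (by fun_prop) (by fun_prop)
      (h.comp (measurable_est.prodMk measurable_age))
  | .point .query =>
    exact measurable_sysState (by fun_prop) (by fun_prop) (by fun_prop) (by fun_prop)
      (h.comp (measurable_x.prodMk measurable_const))

theorem measurable_shiftNoise :
    Measurable fun c : Event × ℝ × Noise => shiftNoise c.1 c.2.1 c.2.2 := by
  refine measurable_pi_lambda _ fun i => ?_
  unfold shiftNoise
  refine Measurable.ite (measurable_fst (measurableSet_singleton (Event.point i.1)))
    (by fun_prop) ?_
  split_ifs <;> fun_prop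

theorem measurable_step {τ : Policy} (hτ : ∀ i, Measurable (τ i)) : Measurable (step τ) := by
  have h1 := measurable_nextEvent
  have h2 := measurable_nextDelay
  exact ((measurable_apply hτ).comp (h1.prodMk (measurable_advance.comp
    (measurable_fst.prodMk h2)))).prodMk
    (measurable_shiftNoise.comp (h1.prodMk (h2.prodMk measurable_snd)))

theorem measurable_config {τ : Policy} (hτ : ∀ i, Measurable (τ i)) (n : ℕ) :
    Measurable fun c : SysState × Noise => config τ c.1 c.2 n :=
  (measurable_step hτ).iterate n

theorem measurable_event {τ : Policy} (hτ : ∀ i, Measurable (τ i)) (n : ℕ) :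
    Measurable fun c : SysState × Noise => event τ c.1 c.2 n :=
  measurable_nextEvent.comp (measurable_config hτ n)

theorem measurable_delay {τ : Policy} (hτ : ∀ i, Measurable (τ i)) (n : ℕ) :
    Measurable fun c : SysState × Noise => delay τ c.1 c.2 n :=
  measurable_nextDelay.comp (measurable_config hτ n)

theorem measurable_stateBefore {τ : Policy} (hτ : ∀ i, Measurable (τ i)) (n : ℕ) :
    Measurable fun c : SysState × Noise => stateBefore τ c.1 c.2 n :=
  measurable_advance.comp ((measurable_config hτ n).fst.prodMk (measurable_delay hτ n))

end Measurability

/-! ### The Markov property at one event -/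

section OneStep

/-- The first points of all streams but `k`. -/
noncomputable def others (k : Source) : Finset (Source × ℕ) :=
  (Finset.univ.erase k).image fun j => (j, 0)

theorem mem_others {k : Source} {i : Source × ℕ} : i ∈ others k ↔ i.1 ≠ k ∧ i.2 = 0 := by
  rcases i with ⟨a, m⟩
  simp only [others, Finset.mem_image, Finset.mem_erase, Finset.mem_univ, and_true, Prod.mk.injEq]
  constructor
  · rintro ⟨j, h, rfl, rfl⟩; exact ⟨h, rfl⟩
  · rintro ⟨h, rfl⟩; exact ⟨a, h, rfl, rfl⟩

theorem sum_others (p : Params) (k : Source) :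
    ∑ i ∈ others k, p.rate i.1 = ∑ j, p.rate j - p.rate k := by
  rw [others, Finset.sum_image (fun _ _ _ _ h => by simpa using h),
    ← Finset.add_sum_erase _ _ (Finset.mem_univ k)]
  ring

theorem shiftNoise_point (k : Source) (t : ℝ) (ω : Noise) :
    shiftNoise (.point k) t ω =
      fun i => if i ∈ others k then ω (later k i) - t else ω (later k i) := by
  funext ⟨a, m⟩
  by_cases ha : a = k
  · subst ha; simp [shiftNoise, mem_others, later]
  · have : ¬ k = a := fun h => ha h.symm
    by_cases hm : m = 0 <;> simp [shiftNoise, mem_others, later, ha, hm, this]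

theorem nextTime_le (ω : Noise) (k : Source) : nextTime ω ≤ ω (k, 0) := by
  unfold nextTime
  cases k <;> simp

theorem nextSource_spec (ω : Noise) : ω (nextSource ω, 0) = nextTime ω := by
  unfold nextSource
  split_ifs with h1 h2 h3
  · exact h1
  · exact h2
  · exact h3
  · unfold nextTime at *
    rcases min_choice (min (ω (.internal, 0)) (ω (.service, 0)))
      (min (ω (.job, 0)) (ω (.query, 0))) with h | h <;> rw [h] at h1 h2 h3 ⊢
    · rcases min_choice (ω (.internal, 0)) (ω (.service, 0)) with h' | h' <;>
        rw [h'] at h1 h2 <;> simp at h1 h2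
    · rcases min_choice (ω (.job, 0)) (ω (.query, 0)) with h' | h'
      · rw [h'] at h3; simp at h3
      · exact h'.symm

theorem nextSource_eq {ω : Noise} {k : Source} (h : ∀ j ≠ k, ω (k, 0) < ω (j, 0)) :
    nextSource ω = k := by
  by_contra hne
  have := h _ hne
  rw [nextSource_spec ω] at this
  exact absurd (nextTime_le ω k) (not_le.2 this)

/-- The law of stream and time of the next event, if it is a point of a stream. -/
noncomputable def Params.pointMass (p : Params) (s : SysState) (k : Source) (C : Set ℝ) : ℝ≥0∞ :=
  ∫⁻ t in C ∩ {t | ¬ (s.holding = true ∧ s.wait ≤ ENNReal.ofReal t)},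
    ENNReal.ofReal (Real.exp (-((∑ j, p.rate j - p.rate k) * t))) ∂expMeasure (p.rate k)

/-- Given the first point `t` of stream `k`, the other first points must survive up to `t`, which
costs the exponential of their total rate, and memorylessness restores the law of what remains. The
relation `r` stands for either `<` or `≤`. -/
theorem law_competing (p : Params) (k : Source) {C : Set ℝ} (hC : MeasurableSet C)
    {E : Set Noise} (hE : MeasurableSet E) {r : ℝ → ℝ → Prop}
    (hr : MeasurableSet {c : ℝ × ℝ | r c.1 c.2}) (hr₁ : ∀ t a, t < a → r t a)
    (hr₂ : ∀ t a, r t a → t ≤ a) :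
    p.law {ω | ω (k, 0) ∈ C ∧ (∀ j ≠ k, r (ω (k, 0)) (ω (j, 0))) ∧
      shiftNoise (.point k) (ω (k, 0)) ω ∈ E} =
    (∫⁻ t in C, ENNReal.ofReal (Real.exp (-((∑ j, p.rate j - p.rate k) * t)))
      ∂expMeasure (p.rate k)) * p.law E := by
  set D : Set (ℝ × Noise) := {c | c.1 ∈ C ∧ (∀ i ∈ others k, r c.1 (c.2 i)) ∧
    (fun i => if i ∈ others k then c.2 i - c.1 else c.2 i) ∈ E} with hD
  have hDm : MeasurableSet D := by
    refine (measurable_fst hC).inter (MeasurableSet.inter ?_ ?_)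
    · have : {c : ℝ × Noise | ∀ i ∈ others k, r c.1 (c.2 i)} =
          ⋂ i ∈ others k, (fun c : ℝ × Noise => (c.1, c.2 i)) ⁻¹' {c : ℝ × ℝ | r c.1 c.2} := by
        ext c; simp
      change MeasurableSet {c : ℝ × Noise | ∀ i ∈ others k, r c.1 (c.2 i)}
      rw [this]
      refine Finset.measurableSet_biInter _ fun i _ => ?_
      have : Measurable fun c : ℝ × Noise => (c.1, c.2 i) := by fun_prop
      exact this hr
    · have : Measurable fun (c : ℝ × Noise) i => if i ∈ others k then c.2 i - c.1 else c.2 i := by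
        refine measurable_pi_lambda _ fun i => ?_
        split_ifs <;> fun_prop
      exact this hE
  have h1 : {ω : Noise | ω (k, 0) ∈ C ∧ (∀ j ≠ k, r (ω (k, 0)) (ω (j, 0))) ∧
      shiftNoise (.point k) (ω (k, 0)) ω ∈ E} =
      (fun ω : Noise => (ω (k, 0), fun i => ω (later k i))) ⁻¹' D := by
    ext ω
    simp only [Set.mem_ofPred_eq, shiftNoise_point, hD, Set.mem_preimage]
    refine and_congr_right fun _ => and_congr_left fun _ => ?_
    constructor
    · rintro h ⟨a, m⟩ hi
      obtain ⟨ha, rfl⟩ := mem_others.1 hi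
      simpa [later, show a ≠ k from ha] using h a ha
    · intro h j hj
      simpa [later, hj] using h (j, 0) (mem_others.2 ⟨hj, rfl⟩)
  -- Splitting off the first gap of stream `k` turns its random value into a fixed level `t`, to
  -- which `law_memoryless` applies section by section.
  rw [h1, ← Measure.map_apply (by fun_prop) hDm, p.law_split k, Measure.prod_apply hDm,
    ← lintegral_mul_const'' _ (by fun_prop), ← lintegral_indicator hC]
  refine lintegral_congr_ae ?_
  filter_upwards [ae_expMeasure_pos (p.rate k)] with t ht
  by_cases htC : t ∈ C
  · rw [Set.indicator_of_mem htC, ← sum_others,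
      ← p.law_memoryless (others k) ht.le (G := {a | r t a}) (measurable_prodMk_left hr)
        (fun a ha => hr₁ t a ha) (fun a ha => hr₂ t a ha) hE]
    congr 1
    ext ω
    simp [hD, htC]
  · rw [Set.indicator_of_notMem htC]
    have : Prod.mk t ⁻¹' D = ∅ := by ext ω; simp [hD, htC]
    rw [this, measure_empty]

/-- The tie-breaking rule in `nextSource` places the event between strict and weak competition of
the clocks. Both bounds have the same mass by `law_competing`, so ties need no separate treatment.
-/
theorem law_nextEvent_point (p : Params) (s : SysState) (k : Source) {C : Set ℝ}
    (hC : MeasurableSet C) {E : Set Noise} (hE : MeasurableSet E) :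
    p.law {ω | nextEvent s ω = .point k ∧ nextDelay s ω ∈ C ∧
      shiftNoise (nextEvent s ω) (nextDelay s ω) ω ∈ E} = p.pointMass s k C * p.law E := by
  have hC' : MeasurableSet (C ∩ {t | ¬ (s.holding = true ∧ s.wait ≤ ENNReal.ofReal t)}) := by
    refine hC.inter (MeasurableSet.compl (MeasurableSet.inter (s₁ := {_t | s.holding = true}) ?_ ?_))
    · exact MeasurableSet.const _
    · exact measurableSet_le measurable_const measurable_id.ennreal_ofReal
  have key : ∀ ω, (nextEvent s ω = .point k ∧ nextDelay s ω ∈ C ∧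
      shiftNoise (nextEvent s ω) (nextDelay s ω) ω ∈ E) ↔
      nextSource ω = k ∧ ω (k, 0) ∈ C ∩ {t | ¬ (s.holding = true ∧ s.wait ≤ ENNReal.ofReal t)} ∧
        shiftNoise (.point k) (ω (k, 0)) ω ∈ E := by
    intro ω
    rw [nextDelay_eq]
    unfold nextEvent
    have h0 := nextSource_spec ω
    split_ifs with h
    · constructor
      · rintro ⟨h', -⟩; cases h'
      · rintro ⟨rfl, ⟨-, h'⟩, -⟩
        rw [h0] at h'
        exact absurd h h'
    · constructor
      · rintro ⟨h1, h2, h3⟩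
        have : nextSource ω = k := by injection h1
        subst this
        rw [h0]
        exact ⟨rfl, ⟨h2, h⟩, h3⟩
      · rintro ⟨rfl, ⟨h2, -⟩, h3⟩
        rw [h0] at h2 h3
        exact ⟨rfl, h2, h3⟩
  simp only [key, Params.pointMass]
  apply le_antisymm
  · rw [← law_competing p k hC' hE (r := fun t a => t ≤ a)
      (measurableSet_le measurable_fst measurable_snd) (fun _ _ h => h.le) (fun _ _ h => h)]
    refine measure_mono ?_
    rintro ω ⟨rfl, h2, h3⟩
    exact ⟨h2, fun j _ => (nextSource_spec ω).trans_le (nextTime_le ω j), h3⟩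
  · rw [← law_competing p k hC' hE (r := fun t a => t < a)
      (measurableSet_lt measurable_fst measurable_snd) (fun _ _ h => h) (fun _ _ h => h.le)]
    refine measure_mono ?_
    rintro ω ⟨h1, h2, h3⟩
    exact ⟨nextSource_eq h2, h1, h3⟩

/-- The first points of all streams. -/
noncomputable def firsts : Finset (Source × ℕ) := Finset.univ.image fun j => (j, 0)

theorem mem_firsts {i : Source × ℕ} : i ∈ firsts ↔ i.2 = 0 := by
  rcases i with ⟨a, m⟩
  simp [firsts, eq_comm]

theorem le_nextTime {ω : Noise} {t : ℝ} : t ≤ nextTime ω ↔ ∀ i ∈ firsts, t ≤ ω i := by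
  constructor
  · rintro h ⟨a, m⟩ hi
    obtain rfl := mem_firsts.1 hi
    exact h.trans (nextTime_le ω a)
  · intro h
    rw [← nextSource_spec ω]
    exact h _ (mem_firsts.2 rfl)

/-- A submission happens after the deterministic time `s.wait`, provided that all streams survive
it, so memorylessness at a fixed time applies. The factor does not depend on `E`, which is all that
independence requires. -/
theorem law_nextEvent_submit (p : Params) (s : SysState) {C : Set ℝ} :
    ∃ c : ℝ≥0∞, ∀ E : Set Noise, MeasurableSet E →
      p.law {ω | nextEvent s ω = .submit ∧ nextDelay s ω ∈ C ∧
        shiftNoise (nextEvent s ω) (nextDelay s ω) ω ∈ E} = c * p.law E := by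
  by_cases h : s.holding = true ∧ s.wait ≠ ⊤ ∧ s.wait.toReal ∈ C
  · obtain ⟨h1, h2, h3⟩ := h
    refine ⟨ENNReal.ofReal (Real.exp (-((∑ i ∈ firsts, p.rate i.1) * s.wait.toReal))),
      fun E hE => ?_⟩
    rw [← p.law_memoryless firsts (t := s.wait.toReal) ENNReal.toReal_nonneg measurableSet_Ici
      Set.Ioi_subset_Ici_self subset_rfl hE]
    refine measure_congr ?_
    filter_upwards [p.ae_pos] with ω hω
    have h0 : 0 ≤ nextTime ω := le_nextTime.2 fun i _ => (hω i).le
    refine propext ?_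
    change (_ ∧ _ ∧ _) ↔ (_ ∧ _)
    simp only [Set.mem_Ici]
    rw [← le_nextTime, nextDelay_eq]
    unfold nextEvent
    have h4 : s.wait ≤ ENNReal.ofReal (nextTime ω) ↔ s.wait.toReal ≤ nextTime ω := by
      rw [← ENNReal.ofReal_toReal h2, ENNReal.ofReal_le_ofReal_iff h0,
        ENNReal.toReal_ofReal ENNReal.toReal_nonneg]
    simp only [h1, true_and, h4]
    split_ifs with h5
    · simp only [h3, true_and, h5]
      have : shiftNoise .submit s.wait.toReal ω =
          fun i => if i ∈ firsts then ω i - s.wait.toReal else ω i := by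
        funext i; simp [shiftNoise, mem_firsts]
      rw [this]
    · simp [h5]
  · refine ⟨0, fun E _ => ?_⟩
    rw [zero_mul]
    refine measure_mono_null (t := ∅) ?_ measure_empty
    rintro ω ⟨h1, h2, -⟩
    rw [nextDelay_eq] at h2
    unfold nextEvent at h1
    split_ifs at h1 h2 with h3
    exact h ⟨h3.1, ne_top_of_le_ne_top ENNReal.ofReal_ne_top h3.2, h2⟩

/-- The Markov property at the first event: the remaining inter-arrival times are independent of
the event and of its time, and have the original law. -/
theorem law_step (p : Params) (s : SysState) :
    p.law.map (fun ω => ((nextEvent s ω, nextDelay s ω),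
      shiftNoise (nextEvent s ω) (nextDelay s ω) ω)) =
    (p.law.map fun ω => (nextEvent s ω, nextDelay s ω)).prod p.law := by
  have h1 : Measurable fun ω => nextEvent s ω := measurable_nextEvent.comp measurable_prodMk_left
  have h2 : Measurable fun ω => nextDelay s ω := measurable_nextDelay.comp measurable_prodMk_left
  have h3 : Measurable fun ω => shiftNoise (nextEvent s ω) (nextDelay s ω) ω :=
    measurable_shiftNoise.comp (h1.prodMk (h2.prodMk measurable_id))
  symm
  have : IsProbabilityMeasure (p.law.map fun ω => (nextEvent s ω, nextDelay s ω)) :=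
    Measure.isProbabilityMeasure_map (h1.prodMk h2).aemeasurable
  refine Measure.prod_eq fun K E hK hE => ?_
  have hKe : ∀ e, MeasurableSet {d | (e, d) ∈ K} := fun e => measurable_prodMk_left hK
  have hcard : ∀ E : Set Noise, MeasurableSet E →
      p.law {ω | (nextEvent s ω, nextDelay s ω) ∈ K ∧
        shiftNoise (nextEvent s ω) (nextDelay s ω) ω ∈ E} =
      ∑ e, p.law {ω | nextEvent s ω = e ∧ nextDelay s ω ∈ {d | (e, d) ∈ K} ∧
        shiftNoise (nextEvent s ω) (nextDelay s ω) ω ∈ E} := by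
    intro E hE
    rw [← tsum_fintype (L := .unconditional _), ← measure_iUnion]
    · congr 1
      ext ω
      simp
    · intro e e' hee
      refine Set.disjoint_left.2 fun ω hω hω' => hee (hω.1.symm.trans hω'.1)
    · intro e
      exact (h1 (measurableSet_singleton e)).inter ((h2 (hKe e)).inter (h3 hE))
  -- On each event the mass factors with a constant free of `E`; summing over the events and then
  -- taking `E = Set.univ` identifies the total constant.
  have hfac : ∀ e, ∃ c : ℝ≥0∞, ∀ E : Set Noise, MeasurableSet E →
      p.law {ω | nextEvent s ω = e ∧ nextDelay s ω ∈ {d | (e, d) ∈ K} ∧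
        shiftNoise (nextEvent s ω) (nextDelay s ω) ω ∈ E} = c * p.law E := by
    intro e
    match e with
    | .submit => exact law_nextEvent_submit p s
    | .point k => exact ⟨_, fun E hE => law_nextEvent_point p s k (hKe _) hE⟩
  choose c hc using hfac
  rw [Measure.map_apply ((h1.prodMk h2).prodMk h3) (hK.prod hE),
    Measure.map_apply (h1.prodMk h2) hK]
  have e1 := hcard E hE
  have e2 := hcard Set.univ .univ
  simp only [hc _ E hE, ← Finset.sum_mul] at e1
  rw [Finset.sum_congr rfl fun e _ => hc e Set.univ .univ] at e2
  simp only [measure_univ, mul_one, Set.mem_univ, and_true] at e2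
  refine Eq.trans e1 ?_
  rw [← e2]
  rfl

/-- Law of the next event and its time while the buffer is empty. -/
theorem law_nextEvent_of_not_holding (p : Params) {s : SysState} (hs : s.holding = false)
    (k : Source) {f : ℝ → ℝ≥0∞} (hf : Measurable f) :
    ∫⁻ ω in {ω | nextEvent s ω = .point k}, f (nextDelay s ω) ∂p.law =
      ∫⁻ t in Set.Ici 0, ENNReal.ofReal (p.rate k * Real.exp (-((∑ j, p.rate j) * t))) * f t := by
  have h1 : Measurable fun ω => nextEvent s ω := measurable_nextEvent.comp measurable_prodMk_left
  have h2 : Measurable fun ω => nextDelay s ω := measurable_nextDelay.comp measurable_prodMk_left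
  have hd : Measurable fun t : ℝ =>
      ENNReal.ofReal (Real.exp (-((∑ j, p.rate j - p.rate k) * t))) := by fun_prop
  have hmap : (p.law.restrict {ω | nextEvent s ω = .point k}).map (nextDelay s) =
      (expMeasure (p.rate k)).withDensity
        fun t => ENNReal.ofReal (Real.exp (-((∑ j, p.rate j - p.rate k) * t))) := by
    ext C hC
    rw [Measure.map_apply h2 hC, Measure.restrict_apply (h2 hC), withDensity_apply _ hC]
    have := law_nextEvent_point p s k hC MeasurableSet.univ
    simp only [Params.pointMass, hs, Bool.false_eq_true, false_and, not_false_eq_true,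
      Set.mem_univ, and_true, measure_univ, mul_one] at this
    rw [Set.inter_comm]
    refine Eq.trans this ?_
    congr 2
    ext t
    simp
  rw [← lintegral_map hf h2, hmap, lintegral_withDensity_eq_lintegral_mul _ hd hf,
    lintegral_expMeasure _ (hd.mul hf)]
  refine setLIntegral_congr_fun measurableSet_Ici fun t _ => ?_
  rw [Pi.mul_apply, ← mul_assoc, ← ENNReal.ofReal_mul
    (mul_nonneg (p.rate_pos k).le (Real.exp_nonneg _)), mul_assoc, ← Real.exp_add]
  ring_nf

theorem nextEvent_of_not_holding {s : SysState} (hs : s.holding = false) (ω : Noise) :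
    nextEvent s ω = .point (nextSource ω) := by
  simp [nextEvent, hs]

/-- First-step analysis while the buffer is empty. -/
theorem lintegral_step_of_not_holding (p : Params) {s : SysState} (hs : s.holding = false)
    {g : Event × ℝ → Noise → ℝ≥0∞} (hg : Measurable (Function.uncurry g)) :
    ∫⁻ ω, g (nextEvent s ω, nextDelay s ω)
      (shiftNoise (nextEvent s ω) (nextDelay s ω) ω) ∂p.law =
    ∑ k, ∫⁻ t in Set.Ici 0, ENNReal.ofReal (p.rate k * Real.exp (-((∑ j, p.rate j) * t))) *
      ∫⁻ ω, g (.point k, t) ω ∂p.law := by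
  have h1 : Measurable fun ω => nextEvent s ω := measurable_nextEvent.comp measurable_prodMk_left
  have h2 : Measurable fun ω => nextDelay s ω := measurable_nextDelay.comp measurable_prodMk_left
  have h3 : Measurable fun ω => shiftNoise (nextEvent s ω) (nextDelay s ω) ω :=
    measurable_shiftNoise.comp (h1.prodMk (h2.prodMk measurable_id))
  have hG : Measurable fun c => ∫⁻ ω, g c ω ∂p.law := hg.lintegral_prod_right
  have e1 : ∫⁻ ω, g (nextEvent s ω, nextDelay s ω)
      (shiftNoise (nextEvent s ω) (nextDelay s ω) ω) ∂p.law =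
      ∫⁻ ω', ∫⁻ ω, g (nextEvent s ω', nextDelay s ω') ω ∂p.law ∂p.law := by
    rw [← lintegral_map (g := fun ω => (nextEvent s ω, nextDelay s ω)) hG (h1.prodMk h2)]
    refine Eq.trans ?_ (lintegral_prod (Function.uncurry g) hg.aemeasurable)
    rw [← law_step p s, lintegral_map hg ((h1.prodMk h2).prodMk h3)]
    rfl
  have hU : (⋃ k, {ω | nextEvent s ω = .point k}) = Set.univ := by
    ext ω; simp [nextEvent_of_not_holding hs]
  rw [e1, ← setLIntegral_univ, ← hU, lintegral_iUnion, tsum_fintype]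
  · refine Finset.sum_congr rfl fun k _ => ?_
    rw [← law_nextEvent_of_not_holding p hs k (f := fun t => ∫⁻ ω, g (.point k, t) ω ∂p.law)
      (hG.comp measurable_prodMk_left)]
    refine setLIntegral_congr_fun (h1 (measurableSet_singleton _)) fun ω hω => ?_
    have : nextEvent s ω = .point k := hω
    simp only [this]
  · exact fun k => h1 (measurableSet_singleton _)
  · intro k k' hk
    refine Set.disjoint_left.2 fun ω hω hω' => hk ?_
    have := hω.symm.trans hω'
    injection this

end OneStep

/-! ### Noise that is independent of the past -/

/-- The noise `θ` has the original law and is independent of `Y`. -/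
structure Fresh (p : Params) {B : Type*} [MeasurableSpace B] (Y : Noise → B)
    (θ : Noise → Noise) : Prop where
  measurable_left : Measurable Y
  measurable_right : Measurable θ
  map_eq : p.law.map (fun ω => (Y ω, θ ω)) = (p.law.map Y).prod p.law

section Fresh

variable {p : Params} {B : Type*} [MeasurableSpace B] {Y : Noise → B} {θ : Noise → Noise}

theorem fresh_const (p : Params) (b : B) : Fresh p (fun _ => b) id where
  measurable_left := measurable_const
  measurable_right := measurable_id
  map_eq := by
    rw [Measure.map_const, measure_univ, one_smul, Measure.dirac_prod]
    rfl

theorem Fresh.measure_inter (h : Fresh p Y θ) {C : Set B} (hC : MeasurableSet C) {E : Set Noise}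
    (hE : MeasurableSet E) : p.law {ω | Y ω ∈ C ∧ θ ω ∈ E} = p.law {ω | Y ω ∈ C} * p.law E := by
  have := congrArg (fun m => m (C ×ˢ E)) h.map_eq
  simp only [Measure.prod_prod, Measure.map_apply (h.measurable_left.prodMk h.measurable_right)
    (hC.prod hE), Measure.map_apply h.measurable_left hC] at this
  exact this

theorem Fresh.lintegral (h : Fresh p Y θ) {F : B × Noise → ℝ≥0∞} (hF : Measurable F) :
    ∫⁻ ω, F (Y ω, θ ω) ∂p.law = ∫⁻ ω, ∫⁻ ω', F (Y ω, ω') ∂p.law ∂p.law := by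
  rw [← lintegral_map hF (h.measurable_left.prodMk h.measurable_right), h.map_eq,
    lintegral_prod _ hF.aemeasurable, lintegral_map hF.lintegral_prod_right' h.measurable_left]

theorem Fresh.of_measure_inter (hY : Measurable Y) (hθ : Measurable θ)
    (h : ∀ C E, MeasurableSet C → MeasurableSet E →
      p.law {ω | Y ω ∈ C ∧ θ ω ∈ E} = p.law {ω | Y ω ∈ C} * p.law E) : Fresh p Y θ where
  measurable_left := hY
  measurable_right := hθ
  map_eq := by
    have : IsProbabilityMeasure (p.law.map Y) := Measure.isProbabilityMeasure_map hY.aemeasurable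
    symm
    refine Measure.prod_eq fun C E hC hE => ?_
    rw [Measure.map_apply (hY.prodMk hθ) (hC.prod hE), Measure.map_apply hY hC]
    exact h C E hC hE

theorem Fresh.comp {A : Type*} [MeasurableSpace A] (h : Fresh p Y θ) {g : B → A}
    (hg : Measurable g) : Fresh p (fun ω => g (Y ω)) θ :=
  .of_measure_inter (hg.comp h.measurable_left) h.measurable_right fun _ _ hC hE =>
    h.measure_inter (hg hC) hE

/-- Conditionally on `Y = b` the claim is `law_step` for the state `st b`, and the factor `p.law E`
does not depend on `b`, so it comes out of the integral over `b`. -/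
theorem Fresh.step (h : Fresh p Y θ) {st : B → SysState} (hst : Measurable st) :
    Fresh p (fun ω => (Y ω, nextEvent (st (Y ω)) (θ ω), nextDelay (st (Y ω)) (θ ω)))
      (fun ω => shiftNoise (nextEvent (st (Y ω)) (θ ω)) (nextDelay (st (Y ω)) (θ ω)) (θ ω)) := by
  have hY := h.measurable_left
  have hθ := h.measurable_right
  have hc : Measurable fun c : B × Noise => (st c.1, c.2) :=
    (hst.comp measurable_fst).prodMk measurable_snd
  have h1 : Measurable fun c : B × Noise => nextEvent (st c.1) c.2 := measurable_nextEvent.comp hc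
  have h2 : Measurable fun c : B × Noise => nextDelay (st c.1) c.2 := measurable_nextDelay.comp hc
  have h3 : Measurable fun c : B × Noise =>
      shiftNoise (nextEvent (st c.1) c.2) (nextDelay (st c.1) c.2) c.2 :=
    measurable_shiftNoise.comp (h1.prodMk (h2.prodMk measurable_snd))
  have hYθ : Measurable fun ω => (Y ω, θ ω) := hY.prodMk hθ
  refine .of_measure_inter (hY.prodMk ((h1.comp hYθ).prodMk (h2.comp hYθ))) (h3.comp hYθ)
    fun C E hC hE => ?_
  have hm : Measurable fun c : B × Noise => (c.1, nextEvent (st c.1) c.2, nextDelay (st c.1) c.2) :=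
    measurable_fst.prodMk (h1.prodMk h2)
  have key : ∀ E : Set Noise, MeasurableSet E →
      p.law {ω | (Y ω, nextEvent (st (Y ω)) (θ ω), nextDelay (st (Y ω)) (θ ω)) ∈ C ∧
        shiftNoise (nextEvent (st (Y ω)) (θ ω)) (nextDelay (st (Y ω)) (θ ω)) (θ ω) ∈ E} =
      (∫⁻ b, p.law.map (fun ω => (nextEvent (st b) ω, nextDelay (st b) ω)) {x | (b, x) ∈ C}
        ∂p.law.map Y) * p.law E := by
    intro E hE
    have hD : MeasurableSet {c : B × Noise |
        (c.1, nextEvent (st c.1) c.2, nextDelay (st c.1) c.2) ∈ C ∧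
          shiftNoise (nextEvent (st c.1) c.2) (nextDelay (st c.1) c.2) c.2 ∈ E} :=
      (hm hC).inter (h3 hE)
    have e1 := Measure.map_apply (μ := p.law) hYθ hD
    rw [h.map_eq, Measure.prod_apply hD] at e1
    refine e1.symm.trans ?_
    have e2 : ∀ b, p.law (Prod.mk b ⁻¹' {c : B × Noise |
        (c.1, nextEvent (st c.1) c.2, nextDelay (st c.1) c.2) ∈ C ∧
          shiftNoise (nextEvent (st c.1) c.2) (nextDelay (st c.1) c.2) c.2 ∈ E}) =
        p.law.map (fun ω => (nextEvent (st b) ω, nextDelay (st b) ω)) {x | (b, x) ∈ C} *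
          p.law E := by
      intro b
      have hb : Measurable fun ω : Noise => (b, ω) := measurable_prodMk_left
      have hCb : MeasurableSet {x : Event × ℝ | (b, x) ∈ C} := measurable_prodMk_left hC
      have := congrArg (fun m => m ({x : Event × ℝ | (b, x) ∈ C} ×ˢ E)) (law_step p (st b))
      simp only [Measure.prod_prod] at this
      rw [← this, Measure.map_apply _ (hCb.prod hE)]
      · rfl
      · exact ((h1.comp hb).prodMk (h2.comp hb)).prodMk (h3.comp hb)
    simp only [e2]
    exact lintegral_mul_const' _ _ (measure_ne_top _ _)
  rw [key E hE]
  have := key Set.univ .univ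
  simp only [Set.mem_univ, and_true, measure_univ, mul_one] at this
  rw [this]

end Fresh

/-! ### The Markov property along the sequence of events -/

section History

variable (τ : Policy) (s : SysState)

theorem config_succ (ω : Noise) (n : ℕ) : config τ s ω (n + 1) = step τ (config τ s ω n) :=
  Function.iterate_succ_apply' _ _ _

theorem config_succ_fst (ω : Noise) (n : ℕ) :
    (config τ s ω (n + 1)).1 = (stateBefore τ s ω n).apply τ (event τ s ω n) := by
  rw [config_succ]; rfl

theorem config_succ_snd (ω : Noise) (n : ℕ) : (config τ s ω (n + 1)).2 =
    shiftNoise (event τ s ω n) (delay τ s ω n) (config τ s ω n).2 := by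
  rw [config_succ]; rfl

/-- States and events of the first `n` events. -/
noncomputable def history (ω : Noise) (n : ℕ) : ℕ → SysState × Event := fun m =>
  -- The constant filling beyond `n` lets histories of all lengths share one measurable space.
  if m < n then (stateBefore τ s ω m, event τ s ω m) else (s, .submit)

/-- The state after `n` events in terms of the history. -/
noncomputable def current : ℕ → (ℕ → SysState × Event) → SysState
  | 0, _ => s
  | n + 1, h => (h n).1.apply τ (h n).2

variable {τ}

theorem measurable_current (hτ : ∀ i, Measurable (τ i)) (n : ℕ) : Measurable (current τ s n) := by
  cases n with
  | zero => exact measurable_const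
  | succ n =>
    exact (measurable_apply hτ).comp ((measurable_pi_apply n).snd.prodMk (measurable_pi_apply n).fst)

theorem current_history (ω : Noise) (n : ℕ) :
    current τ s n (history τ s ω n) = (config τ s ω n).1 := by
  cases n with
  | zero => rfl
  | succ n => simp [current, history, config_succ_fst]

/-- The Markov property of the sequence of events. -/
theorem fresh_history (p : Params) (hτ : ∀ i, Measurable (τ i)) (n : ℕ) :
    Fresh p (fun ω => history τ s ω n) (fun ω => (config τ s ω n).2) := by
  induction n with
  | zero =>
    have : (fun ω => history τ s ω 0) = fun _ _ => (s, .submit) := by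
      funext ω m; simp [history]
    rw [this]
    exact fresh_const p _
  | succ n ih =>
    have h := ih.step (measurable_current s hτ n)
    simp only [current_history] at h
    have h' := h.comp (g := fun c m => if m < n then c.1 m else
      if m = n then ((current τ s n c.1).advance c.2.2, c.2.1) else (s, .submit)) ?_
    · have e1 : (fun ω => history τ s ω (n + 1)) = fun ω m =>
          if m < n then history τ s ω n m else if m = n then
            ((current τ s n (history τ s ω n)).advance
              (nextDelay (config τ s ω n).1 (config τ s ω n).2),
              nextEvent (config τ s ω n).1 (config τ s ω n).2) else (s, .submit) := by
        funext ω m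
        rw [current_history]
        rcases lt_trichotomy m n with hm | rfl | hm
        · simp [history, hm, hm.trans (Nat.lt_succ_self n)]
        · simp [history]; exact ⟨rfl, rfl⟩
        · simp [history, hm.not_gt, hm.ne', show ¬ m < n + 1 by omega]
      have e2 : (fun ω => (config τ s ω (n + 1)).2) = fun ω =>
          shiftNoise (nextEvent (config τ s ω n).1 (config τ s ω n).2)
            (nextDelay (config τ s ω n).1 (config τ s ω n).2) (config τ s ω n).2 := by
        funext ω; rw [config_succ_snd]; rfl
      rw [e1, e2]
      exact h'
    · refine measurable_pi_lambda _ fun m => ?_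
      split_ifs
      · fun_prop
      · have := measurable_current s hτ n
        exact (measurable_advance.comp ((this.comp measurable_fst).prodMk measurable_snd.snd)).prodMk
          measurable_snd.fst
      · exact measurable_const

end History

/-! ### The strong Markov property at the first event of a given kind -/

section FirstEvent

variable (τ : Policy) (K : Event) (s : SysState)

/-- The index of the first event `K`. -/
noncomputable def firstIndex (ω : Noise) : ℕ := sInf {n | event τ s ω n = K}

/-- The remaining inter-arrival times after the first event `K`. -/
noncomputable def noiseAfter (ω : Noise) : Noise := (config τ s ω (firstIndex τ K s ω + 1)).2

variable {τ K s}

theorem firstIndex_eq {ω : Noise} {n : ℕ} (h : event τ s ω n = K)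
    (h' : ∀ m < n, event τ s ω m ≠ K) : firstIndex τ K s ω = n :=
  le_antisymm (Nat.sInf_le h) (le_csInf ⟨n, h⟩ fun m hm => not_lt.1 fun hmn => h' m hmn hm)

theorem event_firstIndex {ω : Noise} (h : ∃ n, event τ s ω n = K) :
    event τ s ω (firstIndex τ K s ω) = K :=
  Nat.sInf_mem (s := {n | event τ s ω n = K}) h

theorem event_ne_of_lt_firstIndex {ω : Noise} {m : ℕ} (h : m < firstIndex τ K s ω) :
    event τ s ω m ≠ K :=
  Nat.notMem_of_lt_sInf h

variable (τ K)

theorem measurableSet_event (hτ : ∀ i, Measurable (τ i)) (n : ℕ) :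
    MeasurableSet {c : SysState × Noise | event τ c.1 c.2 n = K} :=
  measurable_event hτ n (measurableSet_singleton K)

theorem measurableSet_occurs (hτ : ∀ i, Measurable (τ i)) :
    MeasurableSet {c : SysState × Noise | ∃ n, event τ c.1 c.2 n = K} := by
  rw [Set.ofPred_exists]
  exact .iUnion fun n => measurableSet_event τ K hτ n

theorem measurableSet_first (hτ : ∀ i, Measurable (τ i)) (n : ℕ) :
    MeasurableSet {c : SysState × Noise |
      event τ c.1 c.2 n = K ∧ ∀ m < n, event τ c.1 c.2 m ≠ K} := by
  have : {c : SysState × Noise | event τ c.1 c.2 n = K ∧ ∀ m < n, event τ c.1 c.2 m ≠ K} =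
      {c : SysState × Noise | event τ c.1 c.2 n = K} ∩
        ⋂ m, ⋂ _ : m < n, {c : SysState × Noise | event τ c.1 c.2 m = K}ᶜ := by
    ext c; simp
  rw [this]
  exact (measurableSet_event τ K hτ n).inter
    (.iInter fun m => .iInter fun _ => (measurableSet_event τ K hτ m).compl)

theorem measurable_firstIndex (hτ : ∀ i, Measurable (τ i)) :
    Measurable fun c : SysState × Noise => firstIndex τ K c.1 c.2 := by
  refine measurable_to_countable' fun n => ?_
  have : (fun c : SysState × Noise => firstIndex τ K c.1 c.2) ⁻¹' {n} =
      {c : SysState × Noise | event τ c.1 c.2 n = K ∧ ∀ m < n, event τ c.1 c.2 m ≠ K} ∪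
        -- If `K` never occurs, the infimum of the empty set makes the index `0`.
        ({c : SysState × Noise | ∃ n, event τ c.1 c.2 n = K}ᶜ ∩ {_c | n = 0}) := by
    ext c
    simp only [Set.mem_preimage, Set.mem_singleton_iff, Set.mem_union, Set.mem_inter_iff,
      Set.mem_compl_iff, Set.mem_ofPred_eq]
    constructor
    · rintro rfl
      by_cases h : ∃ n, event τ c.1 c.2 n = K
      · exact Or.inl ⟨event_firstIndex h, fun m hm => event_ne_of_lt_firstIndex hm⟩
      · refine Or.inr ⟨h, ?_⟩
        have : {n | event τ c.1 c.2 n = K} = ∅ := by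
          ext n; simpa using fun hn => h ⟨n, hn⟩
        simp [firstIndex, this]
    · rintro (⟨h, h'⟩ | ⟨h, rfl⟩)
      · exact firstIndex_eq h h'
      · have : {n | event τ c.1 c.2 n = K} = ∅ := by
          ext n; simpa using fun hn => h ⟨n, hn⟩
        simp [firstIndex, this]
  rw [this]
  exact (measurableSet_first τ K hτ n).union ((measurableSet_occurs τ K hτ).compl.inter (.const _))

theorem measurable_noiseAfter (hτ : ∀ i, Measurable (τ i)) :
    Measurable fun c : SysState × Noise => noiseAfter τ K c.1 c.2 := by
  have h : Measurable fun c : ℕ × (SysState × Noise) => config τ c.2.1 c.2.2 (c.1 + 1) :=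
    measurable_from_prod_countable_right fun n => measurable_config hτ (n + 1)
  exact (h.comp ((measurable_firstIndex τ K hτ).prodMk measurable_id)).snd

theorem measurable_stateBefore_first (hτ : ∀ i, Measurable (τ i)) :
    Measurable fun c : SysState × Noise => stateBefore τ c.1 c.2 (firstIndex τ K c.1 c.2) := by
  have h : Measurable fun c : ℕ × (SysState × Noise) => stateBefore τ c.2.1 c.2.2 c.1 :=
    measurable_from_prod_countable_right fun n => measurable_stateBefore hτ n
  exact h.comp ((measurable_firstIndex τ K hτ).prodMk measurable_id)

/-- The strong Markov property at the first event `K`. -/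
theorem lintegral_noiseAfter (p : Params) (hτ : ∀ i, Measurable (τ i)) (s : SysState)
    {A : Type*} [MeasurableSpace A] {Z : Noise → A} {z : ℕ → (ℕ → SysState × Event) → A}
    (hz : ∀ n, Measurable (z n))
    (hZ : ∀ ω n, event τ s ω n = K → (∀ m < n, event τ s ω m ≠ K) →
      Z ω = z n (history τ s ω (n + 1)))
    {F : A × Noise → ℝ≥0∞} (hF : Measurable F) :
    ∫⁻ ω in {ω | ∃ n, event τ s ω n = K}, F (Z ω, noiseAfter τ K s ω) ∂p.law =
      ∫⁻ ω in {ω | ∃ n, event τ s ω n = K}, ∫⁻ ω', F (Z ω, ω') ∂p.law ∂p.law := by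
  have hU : {ω | ∃ n, event τ s ω n = K} =
      ⋃ n, {ω | event τ s ω n = K ∧ ∀ m < n, event τ s ω m ≠ K} := by
    ext ω
    simp only [Set.mem_ofPred_eq, Set.mem_iUnion]
    exact ⟨fun h => ⟨_, event_firstIndex h, fun m hm => event_ne_of_lt_firstIndex hm⟩,
      fun ⟨n, h, _⟩ => ⟨n, h⟩⟩
  have hmeas : ∀ n, MeasurableSet {ω | event τ s ω n = K ∧ ∀ m < n, event τ s ω m ≠ K} :=
    fun n => measurable_prodMk_left (measurableSet_first τ K hτ n)
  have hdisj : Pairwise (Function.onFun Disjoint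
      fun n => {ω | event τ s ω n = K ∧ ∀ m < n, event τ s ω m ≠ K}) := by
    intro n n' hn
    refine Set.disjoint_left.2 fun ω hω hω' => hn ?_
    rw [← firstIndex_eq hω.1 hω.2, firstIndex_eq hω'.1 hω'.2]
  rw [hU, lintegral_iUnion hmeas hdisj, lintegral_iUnion hmeas hdisj]
  refine tsum_congr fun n => ?_
  -- The slice on which `K` first occurs at `n` is read off from the history of `n + 1` events, of
  -- which the noise after it is independent.
  set C : Set (ℕ → SysState × Event) := {h | (h n).2 = K ∧ ∀ m < n, (h m).2 ≠ K} with hC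
  have hCm : MeasurableSet C := by
    have : C = (fun h : ℕ → SysState × Event => (h n).2) ⁻¹' {K} ∩
        ⋂ m, ⋂ _ : m < n, ((fun h : ℕ → SysState × Event => (h m).2) ⁻¹' {K})ᶜ := by
      ext h; simp [hC]
    rw [this]
    exact ((measurable_pi_apply n).snd (measurableSet_singleton _)).inter
      (.iInter fun m => .iInter fun _ =>
        ((measurable_pi_apply m).snd (measurableSet_singleton _)).compl)
  have hset : ∀ ω, ω ∈ {ω | event τ s ω n = K ∧ ∀ m < n, event τ s ω m ≠ K} ↔
      history τ s ω (n + 1) ∈ C := by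
    intro ω
    simp only [hC, Set.mem_ofPred_eq, history, Nat.lt_succ_self, if_true]
    refine and_congr_right fun _ => forall_congr' fun m => forall_congr' fun hm => ?_
    simp [hm.trans (Nat.lt_succ_self n)]
  have key := (fresh_history s p hτ (n + 1)).lintegral
    (F := fun c => C.indicator 1 c.1 * F (z n c.1, c.2))
    (((measurable_one.indicator hCm).comp measurable_fst).mul
      (hF.comp (((hz n).comp measurable_fst).prodMk measurable_snd)))
  rw [← lintegral_indicator (hmeas n), ← lintegral_indicator (hmeas n)]
  refine Eq.trans (lintegral_congr fun ω => ?_) (key.trans (lintegral_congr fun ω => ?_))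
  · by_cases h : ω ∈ {ω | event τ s ω n = K ∧ ∀ m < n, event τ s ω m ≠ K}
    · rw [Set.indicator_of_mem h, Set.indicator_of_mem ((hset ω).1 h), hZ ω n h.1 h.2, noiseAfter,
        firstIndex_eq h.1 h.2, Pi.one_apply, one_mul]
    · rw [Set.indicator_of_notMem h, Set.indicator_of_notMem fun h' => h ((hset ω).2 h'), zero_mul]
  · by_cases h : ω ∈ {ω | event τ s ω n = K ∧ ∀ m < n, event τ s ω m ≠ K}
    · simp only [Set.indicator_of_mem h, Set.indicator_of_mem ((hset ω).1 h), hZ ω n h.1 h.2,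
        Pi.one_apply, one_mul]
    · simp only [Set.indicator_of_notMem h, Set.indicator_of_notMem fun h' => h ((hset ω).2 h'),
        zero_mul, lintegral_zero]

end FirstEvent

/-- Iterating the step bounds the excess by `ρ ^ n * C`, which tends to `0`. Used in both directions
it yields uniqueness of the solution of a contractive equation, without subtraction in `ℝ≥0∞`. -/
theorem le_of_contraction {S : Type*} {V V' : S → ℝ≥0∞} {ρ C : ℝ≥0∞} (hρ : ρ < 1) (hC : C ≠ ⊤)
    (h0 : ∀ s, V s ≤ V' s + C)
    (hstep : ∀ c, c ≠ ⊤ → (∀ s, V s ≤ V' s + c) → ∀ s, V s ≤ V' s + ρ * c) (s : S) :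
    V s ≤ V' s := by
  have h : ∀ n : ℕ, ∀ s, V s ≤ V' s + ρ ^ n * C := by
    intro n
    induction n with
    | zero => simpa using h0
    | succ n ih =>
      intro s
      rw [pow_succ', mul_assoc]
      exact hstep _ (ENNReal.mul_ne_top (ENNReal.pow_ne_top (hρ.trans ENNReal.one_lt_top).ne) hC) ih s
  have ht : Tendsto (fun n : ℕ => V' s + ρ ^ n * C) atTop (𝓝 (V' s + 0 * C)) :=
    tendsto_const_nhds.add (ENNReal.Tendsto.mul_const
      (ENNReal.tendsto_pow_atTop_nhds_zero_of_lt_one hρ) (Or.inr hC))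
  have := ge_of_tendsto' ht fun n => h n s
  simpa using this

/-! ### Transition probabilities of the free/busy chain -/

section Transition

variable (p : Params)

/-- The stationary distribution of the machine. -/
noncomputable def Params.stat (p : Params) (y : Fin 2) : ℝ :=
  (if y = 0 then p.β else p.α) / (p.α + p.β)

theorem Params.stat_pos (y : Fin 2) : 0 < p.stat y := by
  have := p.α_pos; have := p.β_pos
  unfold Params.stat
  split_ifs <;> positivity

theorem Params.stat_sum : p.stat 0 + p.stat 1 = 1 := by
  have := p.α_pos; have := p.β_pos
  simp only [Params.stat]
  simp
  field_simp
  ring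

/-- The generator has eigenvalues `0` and `-(α + β)`, so every entry relaxes to the stationary value
at rate `α + β`. -/
theorem Params.transition_apply (u : ℝ) (x y : Fin 2) : p.transition u x y =
    p.stat y + Real.exp (-((p.α + p.β) * u)) * ((if x = y then 1 else 0) - p.stat y) := by
  have hγ := add_pos p.α_pos p.β_pos
  -- The columns of `S` are the eigenvectors; the first row of its inverse `T` is the stationary
  -- distribution.
  set S : Matrix (Fin 2) (Fin 2) ℝ := !![1, p.α; 1, -p.β] with hS
  set T : Matrix (Fin 2) (Fin 2) ℝ :=
    !![p.β / (p.α + p.β), p.α / (p.α + p.β); 1 / (p.α + p.β), -1 / (p.α + p.β)] with hT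
  have hST : S * T = 1 := by
    ext i j
    fin_cases i <;> fin_cases j <;> simp [hS, hT, Matrix.mul_apply, Fin.sum_univ_two] <;>
      field_simp <;> ring
  have hinv : S⁻¹ = T := Matrix.inv_eq_right_inv hST
  have hdiag : u • p.generator =
      S * Matrix.diagonal ![0, -((p.α + p.β) * u)] * S⁻¹ := by
    rw [hinv]
    ext i j
    fin_cases i <;> fin_cases j <;>
      simp [Params.generator, hS, hT, Matrix.mul_apply, Fin.sum_univ_two,
      Matrix.vecMul_diagonal] <;> field_simp
  rw [Params.transition, hdiag, Matrix.exp_conj _ _ (.of_mul_eq_one _ hST),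
    Matrix.exp_diagonal, hinv]
  have e : (NormedSpace.exp ![0, -((p.α + p.β) * u)] : Fin 2 → ℝ) =
      ![1, Real.exp (-((p.α + p.β) * u))] := by
    ext i
    rw [Pi.coe_exp, ← Real.exp_eq_exp_ℝ]
    fin_cases i <;> simp
  rw [e]
  fin_cases x <;> fin_cases y <;>
    simp [hS, hT, Matrix.mul_apply, Fin.sum_univ_two, Params.stat,
      Matrix.vecMul_diagonal] <;> field_simp <;> ring

theorem Params.transition_nonneg {u : ℝ} (hu : 0 ≤ u) (x y : Fin 2) : 0 ≤ p.transition u x y := by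
  rw [p.transition_apply]
  have h1 : Real.exp (-((p.α + p.β) * u)) ≤ 1 := Real.exp_le_one_iff.2
    (neg_nonpos.2 (mul_nonneg (add_pos p.α_pos p.β_pos).le hu))
  have h2 := p.stat_pos y
  have h3 := Real.exp_nonneg (-((p.α + p.β) * u))
  split_ifs <;> nlinarith

theorem Params.transition_pos {u : ℝ} (hu : 0 < u) (x y : Fin 2) : 0 < p.transition u x y := by
  rw [p.transition_apply]
  have h1 : Real.exp (-((p.α + p.β) * u)) < 1 := Real.exp_lt_one_iff.2
    (neg_lt_zero.2 (mul_pos (add_pos p.α_pos p.β_pos) hu))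
  have h2 := p.stat_pos y
  have h3 := Real.exp_nonneg (-((p.α + p.β) * u))
  split_ifs <;> nlinarith

theorem Params.transition_sum (u : ℝ) (x : Fin 2) : ∑ y, p.transition u x y = 1 := by
  have := p.stat_sum
  simp only [Fin.sum_univ_two, p.transition_apply]
  fin_cases x <;> simp <;> linear_combination (1 - Real.exp (-((p.α + p.β) * u))) * this

@[fun_prop]
theorem Params.measurable_transition (x y : Fin 2) : Measurable fun u => p.transition u x y := by
  simp only [p.transition_apply]
  fun_prop

/-- A point of the merged internal and service streams leaves the machine busy or free with
probabilities proportional to `α` and `β`. This is the stationary distribution, so nothing on the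
right depends on `u`. -/
theorem Params.transition_balance (u : ℝ) (y : Fin 2) :
    p.α * p.transition u 1 y + p.β * p.transition u 0 y = (p.α + p.β) * p.stat y := by
  have := add_pos p.α_pos p.β_pos
  simp only [p.transition_apply, Params.stat]
  fin_cases y <;> simp <;> field_simp <;> ring

end Transition

/-! ### The resolvent of the free/busy chain killed at rate `lam + μ` -/

section Resolvent

variable (p : Params)

theorem lintegral_exp {c r : ℝ} (hr : 0 < r) (hc : 0 ≤ c) :
    ∫⁻ t in Set.Ici 0, ENNReal.ofReal (c * Real.exp (-(r * t))) = ENNReal.ofReal (c / r) := by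
  have h := lintegral_expMeasure r (f := fun _ => 1) measurable_const
  have := isProbabilityMeasure_expMeasure hr
  simp only [lintegral_one, measure_univ, mul_one] at h
  calc _ = ∫⁻ t in Set.Ici 0, ENNReal.ofReal (c / r) * ENNReal.ofReal (r * Real.exp (-(r * t))) := by
        refine setLIntegral_congr_fun measurableSet_Ici fun t _ => ?_
        rw [← ENNReal.ofReal_mul (by positivity)]
        congr 1
        field_simp
    _ = _ := by
        rw [lintegral_const_mul' _ _ ENNReal.ofReal_ne_top, ← h, mul_one]

/-- Discounted occupation of the free/busy chain until the next job or query. -/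
noncomputable def Params.resolvent (x : Fin 2) (φ : Fin 2 → ℝ → ℝ≥0∞) : ℝ≥0∞ :=
  ∑ y, ∫⁻ t in Set.Ici 0,
    ENNReal.ofReal (Real.exp (-((p.lam + p.μ) * t)) * p.transition t x y) * φ y t

theorem Params.resolvent_const (x : Fin 2) (c : ℝ≥0∞) :
    p.resolvent x (fun _ _ => c) = ENNReal.ofReal (1 / (p.lam + p.μ)) * c := by
  have hδ := add_pos p.lam_pos p.μ_pos
  have hm : ∀ y, Measurable fun t =>
    ENNReal.ofReal (Real.exp (-((p.lam + p.μ) * t)) * p.transition t x y) := fun y => by fun_prop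
  unfold Params.resolvent
  simp only [fun y => lintegral_mul_const (μ := volume.restrict (Set.Ici 0)) c (hm y)]
  rw [← Finset.sum_mul, ← lintegral_finsetSum _ fun y _ => hm y, ← lintegral_exp hδ zero_le_one]
  congr 1
  refine setLIntegral_congr_fun measurableSet_Ici fun t ht => ?_
  rw [← ENNReal.ofReal_sum_of_nonneg fun y _ =>
    mul_nonneg (Real.exp_nonneg _) (p.transition_nonneg ht x y), ← Finset.mul_sum,
    p.transition_sum, mul_one, one_mul]

theorem Params.resolvent_mono {x : Fin 2} {φ ψ : Fin 2 → ℝ → ℝ≥0∞} (h : ∀ y t, φ y t ≤ ψ y t) :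
    p.resolvent x φ ≤ p.resolvent x ψ :=
  Finset.sum_le_sum fun y _ => lintegral_mono fun t => mul_le_mul_right (h y t) _

theorem Params.resolvent_add {x : Fin 2} {φ ψ : Fin 2 → ℝ → ℝ≥0∞} (hφ : ∀ y, Measurable (φ y)) :
    p.resolvent x (fun y t => φ y t + ψ y t) = p.resolvent x φ + p.resolvent x ψ := by
  unfold Params.resolvent
  rw [← Finset.sum_add_distrib]
  refine Finset.sum_congr rfl fun y _ => ?_
  rw [← lintegral_add_left (by fun_prop)]
  simp only [mul_add]

theorem Params.resolvent_const_mul {x : Fin 2} {φ : Fin 2 → ℝ → ℝ≥0∞}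
    (hφ : ∀ y, Measurable (φ y)) (c : ℝ≥0∞) :
    p.resolvent x (fun y t => c * φ y t) = c * p.resolvent x φ := by
  unfold Params.resolvent
  rw [Finset.mul_sum]
  refine Finset.sum_congr rfl fun y _ => ?_
  rw [← lintegral_const_mul _ (by fun_prop)]
  simp only [mul_left_comm]

/-- Both states are reached with positive probability at every time `t > 0`, so no state escapes the
weight; the single time `0` is negligible. -/
theorem Params.resolvent_eq_zero_iff {x : Fin 2} {φ : Fin 2 → ℝ → ℝ≥0∞}
    (hφ : ∀ y, Measurable (φ y)) :
    p.resolvent x φ = 0 ↔ ∀ y, ∀ᵐ t ∂volume.restrict (Set.Ici 0), φ y t = 0 := by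
  unfold Params.resolvent
  rw [Finset.sum_eq_zero_iff]
  simp only [Finset.mem_univ, true_imp_iff]
  refine forall_congr' fun y => ?_
  rw [lintegral_eq_zero_iff (by fun_prop)]
  have h0 : ∀ᵐ t ∂volume.restrict (Set.Ici (0 : ℝ)), 0 < t := by
    rw [← restrict_Ioi_eq_restrict_Ici]
    exact ae_restrict_mem measurableSet_Ioi
  constructor
  · intro h
    filter_upwards [h, h0] with t ht ht0
    rcases mul_eq_zero.1 ht with h' | h'
    · exact absurd (ENNReal.ofReal_eq_zero.1 h')
        (not_le.2 (mul_pos (Real.exp_pos _) (p.transition_pos ht0 x y)))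
    · exact h'
  · intro h
    filter_upwards [h] with t ht
    simp [ht]

/-- The substitution `r = s + t` and Tonelli reduce the double integral to the convolution of two
exponential kernels with distinct rates. -/
theorem lintegral_convolution {a b : ℝ} {φ : ℝ → ℝ≥0∞} (hφ : Measurable φ) {c : ℝ} (hc : 0 ≤ c)
    (hab : b < a) :
    ∫⁻ s in Set.Ici 0, ENNReal.ofReal (Real.exp (-(a * s))) *
      ∫⁻ t in Set.Ici 0, ENNReal.ofReal (c * Real.exp (-(b * t))) * φ (s + t) =
    ∫⁻ r in Set.Ici 0, ENNReal.ofReal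
      (c / (a - b) * (Real.exp (-(b * r)) - Real.exp (-(a * r)))) * φ r := by
  have h1 : ∀ s ∈ Set.Ici (0 : ℝ), ENNReal.ofReal (Real.exp (-(a * s))) *
      ∫⁻ t in Set.Ici 0, ENNReal.ofReal (c * Real.exp (-(b * t))) * φ (s + t) =
      ∫⁻ r in Set.Ici 0, (Set.Iic r).indicator
        (fun s => ENNReal.ofReal (c * Real.exp (-(b * r)) * Real.exp (-((a - b) * s)))) s * φ r := by
    intro s hs
    rw [← lintegral_const_mul' _ _ ENNReal.ofReal_ne_top, ← lintegral_indicator measurableSet_Ici,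
      ← lintegral_indicator measurableSet_Ici, eq_comm, ← lintegral_add_left_eq_self _ s]
    refine lintegral_congr fun t => ?_
    by_cases ht : 0 ≤ t
    · have h : 0 ≤ s + t := add_nonneg hs ht
      simp only [Set.indicator, Set.mem_Ici, h, ht, if_true, Set.mem_Iic, le_add_iff_nonneg_right]
      rw [← mul_assoc, ← ENNReal.ofReal_mul (Real.exp_nonneg _), mul_assoc, ← Real.exp_add,
        mul_left_comm, ← Real.exp_add]
      ring_nf
    · simp [Set.indicator, ht]
  rw [setLIntegral_congr_fun measurableSet_Ici h1, lintegral_lintegral_swap]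
  · refine setLIntegral_congr_fun measurableSet_Ici fun r hr => ?_
    rw [lintegral_mul_const _ (Measurable.indicator (by fun_prop) measurableSet_Iic)]
    congr 1
    rw [← lintegral_indicator measurableSet_Ici]
    have : ∀ s, (Set.Ici (0 : ℝ)).indicator ((Set.Iic r).indicator
        (fun s => ENNReal.ofReal (c * Real.exp (-(b * r)) * Real.exp (-((a - b) * s))))) s =
        (Set.Icc 0 r).indicator
        (fun s => ENNReal.ofReal (c * Real.exp (-(b * r)) * Real.exp (-((a - b) * s)))) s := by
      intro s
      rw [Set.indicator_indicator]; rfl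
    rw [lintegral_congr this, lintegral_indicator measurableSet_Icc,
      ← ofReal_integral_eq_lintegral_ofReal, integral_Icc_eq_integral_Ioc,
      ← intervalIntegral.integral_of_le hr]
    · congr 1
      have hd : a - b ≠ 0 := (sub_pos.2 hab).ne'
      have : ∀ x ∈ Set.uIcc 0 r, HasDerivAt
          (fun s => -(c * Real.exp (-(b * r)) / (a - b)) * Real.exp (-((a - b) * s)))
          (c * Real.exp (-(b * r)) * Real.exp (-((a - b) * x))) x := by
        intro x _
        have h : HasDerivAt (fun s : ℝ => -((a - b) * s)) (-((a - b) * 1)) x :=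
          ((hasDerivAt_id' x).const_mul (a - b)).fun_neg
        refine (h.exp.const_mul _).congr_deriv ?_
        field_simp
      rw [intervalIntegral.integral_eq_sub_of_hasDerivAt this
        (Continuous.intervalIntegrable (by fun_prop) _ _)]
      have e : Real.exp (-(a * r)) = Real.exp (-(b * r)) * Real.exp (-((a - b) * r)) := by
        rw [← Real.exp_add]; ring_nf
      rw [e]
      simp
      ring
    · exact (Continuous.integrableOn_Icc (by fun_prop))
    · exact ae_of_all _ fun s => by positivity
  · refine Measurable.aemeasurable ?_
    refine Measurable.mul ?_ (by fun_prop)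
    have : Measurable fun c' : ℝ × ℝ => {c' : ℝ × ℝ | c'.1 ≤ c'.2}.indicator (fun c' =>
        ENNReal.ofReal (c * Real.exp (-(b * c'.2)) * Real.exp (-((a - b) * c'.1)))) c' :=
      Measurable.indicator (by fun_prop) (measurableSet_le measurable_fst measurable_snd)
    exact this

/-- First-step decomposition of the resolvent of the free/busy chain. -/
theorem Params.resolvent_eq (x : Fin 2) {φ : Fin 2 → ℝ → ℝ≥0∞} (hφ : ∀ y, Measurable (φ y)) :
    p.resolvent x φ =
      (∫⁻ s in Set.Ici 0, ENNReal.ofReal (Real.exp (-((∑ j, p.rate j) * s))) * φ x s) +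
      ∫⁻ s in Set.Ici 0, ENNReal.ofReal (Real.exp (-((∑ j, p.rate j) * s))) *
        (ENNReal.ofReal p.α * p.resolvent 1 (fun y t => φ y (s + t)) +
          ENNReal.ofReal p.β * p.resolvent 0 (fun y t => φ y (s + t))) := by
  have hγ := add_pos p.α_pos p.β_pos
  have hΛ : ∑ j, p.rate j = (p.α + p.β) + (p.lam + p.μ) := by
    rw [sum_source]; simp only [Params.rate]; ring
  have h1 : ∀ s, ENNReal.ofReal p.α * p.resolvent 1 (fun y t => φ y (s + t)) +
      ENNReal.ofReal p.β * p.resolvent 0 (fun y t => φ y (s + t)) =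
      ∑ y, ∫⁻ t in Set.Ici 0, ENNReal.ofReal ((p.α + p.β) * p.stat y *
        Real.exp (-((p.lam + p.μ) * t))) * φ y (s + t) := by
    intro s
    unfold Params.resolvent
    rw [Finset.mul_sum, Finset.mul_sum, ← Finset.sum_add_distrib]
    refine Finset.sum_congr rfl fun y _ => ?_
    rw [← lintegral_const_mul' _ _ ENNReal.ofReal_ne_top,
      ← lintegral_const_mul' _ _ ENNReal.ofReal_ne_top, ← lintegral_add_left (by fun_prop)]
    refine setLIntegral_congr_fun measurableSet_Ici fun t ht => ?_
    have ha := p.transition_nonneg ht 1 y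
    have hb := p.transition_nonneg ht 0 y
    have hα := p.α_pos.le
    have hβ := p.β_pos.le
    rw [← mul_assoc, ← mul_assoc, ← add_mul, ← ENNReal.ofReal_mul hα, ← ENNReal.ofReal_mul hβ,
      ← ENNReal.ofReal_add (by positivity) (by positivity), ← p.transition_balance t y]
    ring_nf
  have hm : ∀ y, Measurable fun s => ∫⁻ t in Set.Ici 0, ENNReal.ofReal ((p.α + p.β) * p.stat y *
      Real.exp (-((p.lam + p.μ) * t))) * φ y (s + t) := fun y =>
    Measurable.lintegral_prod_right' (f := fun c : ℝ × ℝ => ENNReal.ofReal ((p.α + p.β) *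
      p.stat y * Real.exp (-((p.lam + p.μ) * c.2))) * φ y (c.1 + c.2)) (by fun_prop)
  have hm' : ∀ y, Measurable fun s => ENNReal.ofReal (Real.exp (-((∑ j, p.rate j) * s))) *
      ∫⁻ t in Set.Ici 0, ENNReal.ofReal ((p.α + p.β) * p.stat y *
        Real.exp (-((p.lam + p.μ) * t))) * φ y (s + t) := fun y =>
    Measurable.mul (by fun_prop) (hm y)
  simp only [h1, Finset.mul_sum]
  rw [lintegral_finsetSum _ fun y _ => hm' y]
  -- By `transition_balance` the continuation has constant weight, so the double integral is a pure
  -- convolution; the difference of rates is `α + β`, which cancels. The remaining terms reassemble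
  -- into `transition_apply`.
  have h2 : ∀ y, ∫⁻ s in Set.Ici 0, ENNReal.ofReal (Real.exp (-((∑ j, p.rate j) * s))) *
      ∫⁻ t in Set.Ici 0, ENNReal.ofReal ((p.α + p.β) * p.stat y *
        Real.exp (-((p.lam + p.μ) * t))) * φ y (s + t) =
      ∫⁻ r in Set.Ici 0, ENNReal.ofReal (p.stat y * (Real.exp (-((p.lam + p.μ) * r)) -
        Real.exp (-((∑ j, p.rate j) * r)))) * φ y r := by
    intro y
    rw [lintegral_convolution (hφ y) (mul_pos hγ (p.stat_pos y)).le (by rw [hΛ]; linarith)]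
    have : (p.α + p.β) * p.stat y / (∑ j, p.rate j - (p.lam + p.μ)) = p.stat y := by
      rw [hΛ, add_sub_cancel_right, mul_div_cancel_left₀ _ hγ.ne']
    rw [this]
  simp only [h2]
  unfold Params.resolvent
  have h3 : ∫⁻ s in Set.Ici 0, ENNReal.ofReal (Real.exp (-((∑ j, p.rate j) * s))) * φ x s =
      ∑ y, ∫⁻ s in Set.Ici 0, ENNReal.ofReal (if x = y then
        Real.exp (-((∑ j, p.rate j) * s)) else 0) * φ y s := by
    rw [Finset.sum_eq_single x]
    · simp
    · intro y _ hy
      simp [hy.symm]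
    · simp
  rw [h3, ← Finset.sum_add_distrib]
  refine Finset.sum_congr rfl fun y _ => ?_
  rw [← lintegral_add_left (by split_ifs <;> fun_prop)]
  refine setLIntegral_congr_fun measurableSet_Ici fun t ht => ?_
  simp only [Set.mem_Ici] at ht
  have hexp : Real.exp (-((∑ j, p.rate j) * t)) ≤ Real.exp (-((p.lam + p.μ) * t)) := by
    rw [Real.exp_le_exp, hΛ]; nlinarith
  have hs := (p.stat_pos y).le
  rw [← add_mul, ← ENNReal.ofReal_add (by split_ifs <;> positivity)
    (mul_nonneg hs (sub_nonneg.2 hexp)), p.transition_apply]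
  have e : Real.exp (-((∑ j, p.rate j) * t)) =
      Real.exp (-((p.lam + p.μ) * t)) * Real.exp (-((p.α + p.β) * t)) := by
    rw [← Real.exp_add, hΛ]; ring_nf
  rw [e]
  congr 2
  split_ifs <;> ring

end Resolvent

/-! ### Restarting the path after some events -/

section Shift

variable (τ : Policy) (s : SysState) (ω : Noise)

theorem config_add (n m : ℕ) : config τ s ω (n + m) =
    config τ (config τ s ω n).1 (config τ s ω n).2 m := by
  rw [add_comm]
  exact Function.iterate_add_apply _ _ _ _

theorem event_add (n m : ℕ) : event τ s ω (n + m) =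
    event τ (config τ s ω n).1 (config τ s ω n).2 m := by
  rw [event, config_add]; rfl

theorem delay_add (n m : ℕ) : delay τ s ω (n + m) =
    delay τ (config τ s ω n).1 (config τ s ω n).2 m := by
  rw [delay, config_add]; rfl

theorem stateBefore_add (n m : ℕ) : stateBefore τ s ω (n + m) =
    stateBefore τ (config τ s ω n).1 (config τ s ω n).2 m := by
  rw [stateBefore, delay_add, config_add]; rfl

variable {τ s ω} {K : Event}

theorem occurs_succ (h : event τ s ω 0 ≠ K) :
    (∃ n, event τ s ω n = K) ↔
      ∃ n, event τ (config τ s ω 1).1 (config τ s ω 1).2 n = K := by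
  constructor
  · rintro ⟨n, hn⟩
    cases n with
    | zero => exact absurd hn h
    | succ n => exact ⟨n, by rw [← event_add, add_comm]; exact hn⟩
  · rintro ⟨n, hn⟩
    exact ⟨1 + n, by rw [event_add]; exact hn⟩

theorem firstIndex_succ (h : event τ s ω 0 ≠ K) (h' : ∃ n, event τ s ω n = K) :
    firstIndex τ K s ω = 1 + firstIndex τ K (config τ s ω 1).1 (config τ s ω 1).2 := by
  refine firstIndex_eq ?_ ?_
  · rw [event_add]
    exact event_firstIndex ((occurs_succ h).1 h')
  · intro m hm
    cases m with
    | zero => exact h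
    | succ m =>
      rw [add_comm m, event_add]
      exact event_ne_of_lt_firstIndex (by omega)

end Shift

/-! ### The law of machine, estimate and age when a job is accepted -/

section Accept

/-- Machine, estimate and age just before the first job arrival. -/
noncomputable def acceptData (τ : Policy) (s : SysState) (ω : Noise) : Fin 2 × Fin 2 × ℝ :=
  ((stateBefore τ s ω (firstIndex τ (.point .job) s ω)).x,
    (stateBefore τ s ω (firstIndex τ (.point .job) s ω)).est,
    (stateBefore τ s ω (firstIndex τ (.point .job) s ω)).age)

/-- Mean value of a function of the data at the first job arrival. -/
noncomputable def Params.acceptMean (p : Params) (τ : Policy) (f : Fin 2 × Fin 2 × ℝ → ℝ≥0∞)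
    (s : SysState) : ℝ≥0∞ :=
  ∫⁻ ω in {ω | ∃ n, event τ s ω n = .point .job}, f (acceptData τ s ω) ∂p.law

/-- The state after a query that finds the buffer empty and the machine in state `y`. -/
noncomputable def queryState (τ : Policy) (y : Fin 2) : SysState :=
  { x := y, est := y, age := 0, holding := false, wait := τ y 0 }

variable {p : Params} {τ : Policy}

theorem measurable_acceptData (hτ : ∀ i, Measurable (τ i)) :
    Measurable fun c : SysState × Noise => acceptData τ c.1 c.2 := by
  have := measurable_stateBefore_first τ (.point .job) hτ
  exact (measurable_x.comp this).prodMk ((measurable_est.comp this).prodMk (measurable_age.comp this))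

theorem measurable_acceptData_right (hτ : ∀ i, Measurable (τ i)) (s : SysState) :
    Measurable (acceptData τ s) := by
  have h : Measurable fun ω : Noise => (s, ω) := measurable_prodMk_left
  have h' := (measurable_acceptData hτ).comp h
  simp only [Function.comp_def] at h'
  exact h'

/-- First-step analysis: a job stops the process and reveals the data, a query restarts it with age
zero, and the two remaining streams only change the machine. These last terms are kept apart because
they will be the contractive part. -/
theorem acceptMean_step (hτ : ∀ i, Measurable (τ i)) {f : Fin 2 × Fin 2 × ℝ → ℝ≥0∞}
    (hf : Measurable f) {s : SysState} (hs : s.holding = false) :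
    p.acceptMean τ f s =
      (∫⁻ t in Set.Ici 0, ENNReal.ofReal (Real.exp (-((∑ j, p.rate j) * t))) *
        (ENNReal.ofReal p.lam * f (s.x, s.est, s.age + t) +
          ENNReal.ofReal p.μ * p.acceptMean τ f (queryState τ s.x))) +
      ∫⁻ t in Set.Ici 0, ENNReal.ofReal (Real.exp (-((∑ j, p.rate j) * t))) *
        (ENNReal.ofReal p.α *
            p.acceptMean τ f ((s.advance t).apply τ (.point .internal)) +
          ENNReal.ofReal p.β *
            p.acceptMean τ f ((s.advance t).apply τ (.point .service))) := by
  classical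
  -- Being zero when no job ever arrives, `V` obeys the one-step identity `hpath` for every
  -- realisation, not only almost surely.
  set V : SysState × Noise → ℝ≥0∞ :=
    {c : SysState × Noise | ∃ n, event τ c.1 c.2 n = .point .job}.indicator
      fun c => f (acceptData τ c.1 c.2) with hV
  have hVm : Measurable V := (hf.comp (measurable_acceptData hτ)).indicator
    (measurableSet_occurs τ _ hτ)
  have hVint : ∀ s, p.acceptMean τ f s = ∫⁻ ω, V (s, ω) ∂p.law := by
    intro s
    have hm : MeasurableSet {ω | ∃ n, event τ s ω n = .point .job} :=
      measurable_prodMk_left (measurableSet_occurs τ _ hτ)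
    rw [Params.acceptMean, ← lintegral_indicator hm]
    rfl
  set g : Event × ℝ → Noise → ℝ≥0∞ := fun c ω =>
    if c.1 = .point .job then f (s.x, s.est, s.age + c.2)
    else V ((s.advance c.2).apply τ c.1, ω) with hg
  have hgm : Measurable (Function.uncurry g) := by
    refine Measurable.ite (measurable_fst.fst (measurableSet_singleton _)) (by fun_prop) ?_
    refine hVm.comp (((measurable_apply hτ).comp
      (measurable_fst.fst.prodMk (measurable_advance.comp
        (measurable_const.prodMk measurable_fst.snd)))).prodMk measurable_snd)
  have hpath : ∀ ω, V (s, ω) = g (nextEvent s ω, nextDelay s ω)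
      (shiftNoise (nextEvent s ω) (nextDelay s ω) ω) := by
    intro ω
    have e1 : config τ s ω 1 = ((s.advance (nextDelay s ω)).apply τ (nextEvent s ω),
      shiftNoise (nextEvent s ω) (nextDelay s ω) ω) := rfl
    by_cases h : event τ s ω 0 = .point .job
    · have h0 : firstIndex τ (.point .job) s ω = 0 := firstIndex_eq h (by simp)
      have h' : nextEvent s ω = .point .job := h
      have hm : (s, ω) ∈ {c : SysState × Noise | ∃ n, event τ c.1 c.2 n = .point .job} := ⟨0, h⟩
      rw [hV, Set.indicator_of_mem hm, hg]
      simp only [h', if_true, acceptData, h0]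
      rfl
    · have h' : nextEvent s ω ≠ .point .job := h
      rw [hg]
      simp only [h', if_false]
      rw [← e1, hV]
      by_cases hm : (s, ω) ∈ {c : SysState × Noise | ∃ n, event τ c.1 c.2 n = .point .job}
      · have hm' : config τ s ω 1 ∈
            {c : SysState × Noise | ∃ n, event τ c.1 c.2 n = .point .job} := (occurs_succ h).1 hm
        rw [Set.indicator_of_mem hm, Set.indicator_of_mem hm']
        simp only [acceptData, firstIndex_succ h hm, stateBefore_add]
      · have hm' : config τ s ω 1 ∉
            {c : SysState × Noise | ∃ n, event τ c.1 c.2 n = .point .job} :=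
          fun h'' => hm ((occurs_succ h).2 h'')
        rw [Set.indicator_of_notMem hm, Set.indicator_of_notMem hm']
  have hgint : ∀ (k : Source) (t : ℝ), ∫⁻ ω, g (.point k, t) ω ∂p.law =
      if k = .job then f (s.x, s.est, s.age + t)
      else p.acceptMean τ f ((s.advance t).apply τ (.point k)) := by
    intro k t
    rw [hg]
    by_cases hk : k = .job
    · simp [hk]
    · simp [hk, hVint]
  have hr : ∀ (k : Source) (t : ℝ), ENNReal.ofReal (p.rate k * Real.exp (-((∑ j, p.rate j) * t))) =
      ENNReal.ofReal (Real.exp (-((∑ j, p.rate j) * t))) * ENNReal.ofReal (p.rate k) := by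
    intro k t
    rw [mul_comm, ENNReal.ofReal_mul (Real.exp_nonneg _)]
  have hq : ∀ t, (s.advance t).apply τ (.point .query) = queryState τ s.x := by
    intro t
    simp only [SysState.apply, SysState.advance, queryState, hs]
  have hVm' : Measurable (p.acceptMean τ f) := by
    have : p.acceptMean τ f = fun s => ∫⁻ ω, V (s, ω) ∂p.law := funext hVint
    rw [this]
    exact hVm.lintegral_prod_right'
  have hap : ∀ k, Measurable fun t => p.acceptMean τ f ((s.advance t).apply τ (.point k)) := fun k =>
    hVm'.comp ((measurable_apply hτ).comp (measurable_const.prodMk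
      (measurable_advance.comp measurable_prodMk_left)))
  have hint := hap .internal
  have hser := hap .service
  rw [hVint, lintegral_congr hpath, lintegral_step_of_not_holding p hs hgm, sum_source]
  simp only [hgint, hr, mul_assoc, hq]
  simp only [Params.rate, reduceCtorEq, if_true, if_false, mul_add]
  rw [lintegral_add_left (by fun_prop), lintegral_add_left (by fun_prop)]
  ring

theorem acceptMean_le_one {f : Fin 2 × Fin 2 × ℝ → ℝ≥0∞} (hf1 : ∀ c, f c ≤ 1) (s : SysState) :
    p.acceptMean τ f s ≤ 1 := by
  calc p.acceptMean τ f s ≤ ∫⁻ _ω in {ω | ∃ n, event τ s ω n = .point .job}, 1 ∂p.law :=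
        lintegral_mono fun ω => hf1 _
    _ ≤ 1 := by simp [prob_le_one]

/-- Law of the data at the first job arrival in terms of its values right after a query. -/
theorem acceptMean_eq_resolvent (hτ : ∀ i, Measurable (τ i)) {f : Fin 2 × Fin 2 × ℝ → ℝ≥0∞}
    (hf : Measurable f) (hf1 : ∀ c, f c ≤ 1) {s : SysState} (hs : s.holding = false) :
    p.acceptMean τ f s = p.resolvent s.x fun y t =>
      ENNReal.ofReal p.lam * f (y, s.est, s.age + t) +
        ENNReal.ofReal p.μ * p.acceptMean τ f (queryState τ y) := by
  have hα := p.α_pos; have hβ := p.β_pos; have hl := p.lam_pos; have hμ := p.μ_pos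
  have hΛ : ∑ j, p.rate j = (p.α + p.β) + (p.lam + p.μ) := by
    rw [sum_source]; simp only [Params.rate]; ring
  have hΛ0 : 0 < ∑ j, p.rate j := by rw [hΛ]; positivity
  set φ : Fin 2 → ℝ → Fin 2 → ℝ → ℝ≥0∞ := fun i u y t =>
    ENNReal.ofReal p.lam * f (y, i, u + t) + ENNReal.ofReal p.μ * p.acceptMean τ f (queryState τ y)
    with hφ
  have hφm : ∀ i u y, Measurable (φ i u y) := fun i u y => by rw [hφ]; fun_prop
  -- The probability that the next point is internal or a service completion. Resolvent and mean
  -- value solve the same first-step equation, in which only these points continue the recursion.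
  set ρ : ℝ≥0∞ := ENNReal.ofReal ((p.α + p.β) / ∑ j, p.rate j) with hρ
  have hρ1 : ρ < 1 := by
    rw [hρ, ENNReal.ofReal_lt_one, div_lt_one hΛ0, hΛ]
    linarith
  have hR : ∀ s : {s : SysState // s.holding = false}, p.resolvent s.1.x (φ s.1.est s.1.age) =
      (∫⁻ t in Set.Ici 0, ENNReal.ofReal (Real.exp (-((∑ j, p.rate j) * t))) *
        (ENNReal.ofReal p.lam * f (s.1.x, s.1.est, s.1.age + t) +
          ENNReal.ofReal p.μ * p.acceptMean τ f (queryState τ s.1.x))) +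
      ∫⁻ t in Set.Ici 0, ENNReal.ofReal (Real.exp (-((∑ j, p.rate j) * t))) *
        (ENNReal.ofReal p.α * p.resolvent 1 (φ s.1.est (s.1.age + t)) +
          ENNReal.ofReal p.β * p.resolvent 0 (φ s.1.est (s.1.age + t))) := by
    intro s
    rw [p.resolvent_eq _ (hφm _ _)]
    simp only [hφ, add_assoc]
  have hRb : ∀ x i u, p.resolvent x (φ i u) ≤ 1 := by
    intro x i u
    refine (p.resolvent_mono (ψ := fun _ _ => ENNReal.ofReal (p.lam + p.μ)) fun y t => ?_).trans ?_
    · rw [ENNReal.ofReal_add hl.le hμ.le]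
      exact add_le_add (mul_le_of_le_one_right' (hf1 _))
        (mul_le_of_le_one_right' (acceptMean_le_one hf1 _))
    · rw [p.resolvent_const, ← ENNReal.ofReal_mul (by positivity)]
      rw [one_div_mul_cancel (by positivity), ENNReal.ofReal_one]
  have hext : ∀ (W W' : ℝ → ℝ≥0∞) (Z Z' : ℝ → ℝ≥0∞) (c : ℝ≥0∞), c ≠ ⊤ →
      (∀ t, W t ≤ W' t + c) → (∀ t, Z t ≤ Z' t + c) →
      ∫⁻ t in Set.Ici 0, ENNReal.ofReal (Real.exp (-((∑ j, p.rate j) * t))) *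
        (ENNReal.ofReal p.α * W t + ENNReal.ofReal p.β * Z t) ≤
      (∫⁻ t in Set.Ici 0, ENNReal.ofReal (Real.exp (-((∑ j, p.rate j) * t))) *
        (ENNReal.ofReal p.α * W' t + ENNReal.ofReal p.β * Z' t)) + ρ * c := by
    intro W W' Z Z' c hc hW hZ
    have e : ρ * c = ∫⁻ t in Set.Ici 0, ENNReal.ofReal (Real.exp (-((∑ j, p.rate j) * t))) *
        (ENNReal.ofReal (p.α + p.β) * c) := by
      rw [lintegral_mul_const _ (by fun_prop)]
      have := lintegral_exp hΛ0 zero_le_one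
      simp only [one_mul] at this
      rw [this, hρ, ← mul_assoc, ← ENNReal.ofReal_mul (by positivity), one_div_mul_eq_div]
    rw [e, ← lintegral_add_right _ (by fun_prop)]
    refine lintegral_mono fun t => ?_
    rw [← mul_add]
    refine mul_le_mul_right ?_ _
    rw [ENNReal.ofReal_add hα.le hβ.le, add_mul]
    calc _ ≤ ENNReal.ofReal p.α * (W' t + c) + ENNReal.ofReal p.β * (Z' t + c) :=
          add_le_add (mul_le_mul_right (hW t) _) (mul_le_mul_right (hZ t) _)
      _ = _ := by ring
  refine le_antisymm ?_ ?_
  · refine le_of_contraction (S := {s : SysState // s.holding = false})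
      (V := fun s => p.acceptMean τ f s.1) (V' := fun s => p.resolvent s.1.x (φ s.1.est s.1.age))
      hρ1 ENNReal.one_ne_top (fun s => (acceptMean_le_one hf1 _).trans le_add_self) ?_ ⟨s, hs⟩
    intro c hc h s
    rw [hR s, acceptMean_step hτ hf s.2, add_assoc]
    refine add_le_add_right (hext _ _ _ _ c hc (fun t => ?_) fun t => ?_) _
    · exact h ⟨(s.1.advance t).apply τ (.point .internal), s.2⟩
    · exact h ⟨(s.1.advance t).apply τ (.point .service), s.2⟩
  · refine le_of_contraction (S := {s : SysState // s.holding = false})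
      (V' := fun s => p.acceptMean τ f s.1) (V := fun s => p.resolvent s.1.x (φ s.1.est s.1.age))
      hρ1 ENNReal.one_ne_top (fun s => (hRb _ _ _).trans le_add_self) ?_ ⟨s, hs⟩
    intro c hc h s
    rw [hR s, acceptMean_step hτ hf s.2, add_assoc]
    refine add_le_add_right (hext _ _ _ _ c hc (fun t => ?_) fun t => ?_) _
    · exact h ⟨(s.1.advance t).apply τ (.point .internal), s.2⟩
    · exact h ⟨(s.1.advance t).apply τ (.point .service), s.2⟩

theorem firstAccepted_iff {s : SysState} {ω : Noise} {i : Fin 2} {u : ℝ} :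
    FirstAccepted τ s ω i u ↔ (∃ n, event τ s ω n = .point .job) ∧
      (acceptData τ s ω).2.1 = i ∧ (acceptData τ s ω).2.2 = u := by
  constructor
  · rintro ⟨n, h1, h2, h3, h4⟩
    have := firstIndex_eq h1 h2
    exact ⟨⟨n, h1⟩, by simp [acceptData, this, h3], by simp [acceptData, this, h4]⟩
  · rintro ⟨h, h1, h2⟩
    exact ⟨_, event_firstIndex h, fun m hm => event_ne_of_lt_firstIndex hm, h1, h2⟩

theorem acceptMean_indicator (hτ : ∀ i, Measurable (τ i)) {A : Set (Fin 2 × Fin 2 × ℝ)}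
    (hA : MeasurableSet A) (s : SysState) : p.acceptMean τ (A.indicator 1) s =
      p.law {ω | (∃ n, event τ s ω n = .point .job) ∧ acceptData τ s ω ∈ A} := by
  have h1 := measurable_acceptData_right hτ s
  have : ∀ ω, A.indicator (1 : Fin 2 × Fin 2 × ℝ → ℝ≥0∞) (acceptData τ s ω) =
      (acceptData τ s ⁻¹' A).indicator 1 ω := fun ω => rfl
  rw [Params.acceptMean, lintegral_congr this, lintegral_indicator_one (h1 hA),
    Measure.restrict_apply (h1 hA), Set.inter_comm]
  rfl

theorem acceptProb_eq (hτ : ∀ i, Measurable (τ i)) (i : Fin 2) :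
    acceptProb p τ i = p.acceptMean τ ({c | c.2.1 = i}.indicator 1) (emptyState 1 1 0) := by
  have hm : MeasurableSet {c : Fin 2 × Fin 2 × ℝ | c.2.1 = i} :=
    measurable_snd.fst (measurableSet_singleton i)
  rw [acceptMean_indicator hτ hm, acceptProb]
  congr 1
  ext ω
  simp [firstAccepted_iff]

/-- The states after a submission and after a query answered `1` differ only in `wait`, which plays
no role while the buffer is empty. -/
theorem acceptMean_emptyState_one (hτ : ∀ i, Measurable (τ i)) {f : Fin 2 × Fin 2 × ℝ → ℝ≥0∞}
    (hf : Measurable f) (hf1 : ∀ c, f c ≤ 1) :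
    p.acceptMean τ f (emptyState 1 1 0) = p.acceptMean τ f (queryState τ 1) := by
  rw [acceptMean_eq_resolvent hτ hf hf1 rfl,
    acceptMean_eq_resolvent hτ hf hf1 (s := queryState τ 1) rfl]
  rfl

theorem resolvent_eq_lintegral_ageLaw {i : Fin 2} {g : Fin 2 → ℝ → ℝ≥0∞}
    (hg : ∀ y, Measurable (g y)) :
    ENNReal.ofReal ((p.lam + p.μ) / p.lam) *
      p.resolvent i (fun y t => ENNReal.ofReal p.lam * g y t) =
    ∑ x, ∫⁻ u, ENNReal.ofReal (p.transition u i x) * g x u ∂p.ageLaw := by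
  have hl := p.lam_pos; have hμ := p.μ_pos
  rw [p.resolvent_const_mul hg, ← mul_assoc, ← ENNReal.ofReal_mul (by positivity),
    div_mul_cancel₀ _ hl.ne', Params.resolvent, Finset.mul_sum]
  refine Finset.sum_congr rfl fun y _ => ?_
  have hgy := hg y
  rw [Params.ageLaw, lintegral_expMeasure _ (by fun_prop),
    ← lintegral_const_mul' _ _ ENNReal.ofReal_ne_top]
  refine setLIntegral_congr_fun measurableSet_Ici fun t _ => ?_
  rw [← mul_assoc, ← mul_assoc, ← ENNReal.ofReal_mul (by positivity),
    ← ENNReal.ofReal_mul (by positivity), mul_assoc]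

/-- The values of `f` after a query solve a linear system over the two estimates, with a source at
`j` from the event that a job precedes the next query. The probabilities of the final estimate solve
the same system with source at a single `i`. By linearity their combination with weights `a i`
solves the system for `f`, and uniqueness makes the two agree. -/
theorem acceptMean_of_le_one (hτ : ∀ i, Measurable (τ i)) {f : Fin 2 × Fin 2 × ℝ → ℝ≥0∞}
    (hf : Measurable f) (hf1 : ∀ c, f c ≤ 1) :
    p.acceptMean τ f (emptyState 1 1 0) = ∑ i, acceptProb p τ i *
      ∑ x, ∫⁻ u, ENNReal.ofReal (p.transition u i x) * f (x, i, u) ∂p.ageLaw := by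
  have hl := p.lam_pos; have hμ := p.μ_pos
  have hI : ∀ i : Fin 2, Measurable
      ({c : Fin 2 × Fin 2 × ℝ | c.2.1 = i}.indicator (1 : Fin 2 × Fin 2 × ℝ → ℝ≥0∞)) := fun i =>
    measurable_one.indicator (measurable_snd.fst (measurableSet_singleton i))
  have hI1 : ∀ (i : Fin 2) c,
      {c : Fin 2 × Fin 2 × ℝ | c.2.1 = i}.indicator (1 : Fin 2 × Fin 2 × ℝ → ℝ≥0∞) c ≤ 1 :=
    fun i c => Set.indicator_le_self' (fun _ _ => zero_le) c
  -- The mean of `f` given that a job comes before the next query: the source at `i` divided by the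
  -- probability `lam / (lam + μ)` of that event.
  set a : Fin 2 → ℝ≥0∞ := fun i => ENNReal.ofReal ((p.lam + p.μ) / p.lam) *
      p.resolvent i (fun y t => ENNReal.ofReal p.lam * f (y, i, t)) with ha
  set W : Fin 2 → Fin 2 → ℝ≥0∞ := fun i j =>
    p.acceptMean τ ({c | c.2.1 = i}.indicator 1) (queryState τ j) with hW
  have hW1 : ∀ i j, W i j ≤ 1 := fun i j => acceptMean_le_one (hI1 i) _
  have hsplit : ∀ (w w' : Fin 2 → ℝ≥0∞) (j : Fin 2),
      p.resolvent j (fun y _ => ENNReal.ofReal p.μ * (w y + w' y)) =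
        p.resolvent j (fun y _ => ENNReal.ofReal p.μ * w y) +
          p.resolvent j (fun y _ => ENNReal.ofReal p.μ * w' y) := by
    intro w w' j
    rw [← p.resolvent_add fun y => measurable_const]
    simp only [mul_add]
  have hsmul : ∀ (c : ℝ≥0∞) (w : Fin 2 → ℝ≥0∞) (j : Fin 2),
      p.resolvent j (fun y _ => ENNReal.ofReal p.μ * (c * w y)) =
        c * p.resolvent j (fun y _ => ENNReal.ofReal p.μ * w y) := by
    intro c w j
    rw [← p.resolvent_const_mul fun y => measurable_const]
    simp only [mul_left_comm]
  have hWf : ∀ j, p.acceptMean τ f (queryState τ j) =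
      p.resolvent j (fun y t => ENNReal.ofReal p.lam * f (y, j, t)) +
      p.resolvent j fun y _ => ENNReal.ofReal p.μ * p.acceptMean τ f (queryState τ y) := by
    intro j
    rw [acceptMean_eq_resolvent hτ hf hf1 (s := queryState τ j) rfl,
      ← p.resolvent_add fun y => by fun_prop]
    simp [queryState]
  have hWi : ∀ i j, W i j = (if j = i then ENNReal.ofReal (p.lam / (p.lam + p.μ)) else 0) +
      p.resolvent j fun y _ => ENNReal.ofReal p.μ * W i y := by
    intro i j
    rw [hW]
    simp only
    rw [acceptMean_eq_resolvent hτ (hI i) (hI1 i) (s := queryState τ j) rfl,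
      p.resolvent_add fun y => by
        have := hI i
        fun_prop]
    congr 1
    by_cases h : j = i
    · have := p.resolvent_const j (ENNReal.ofReal p.lam)
      rw [← ENNReal.ofReal_mul (by positivity), one_div_mul_eq_div] at this
      rw [if_pos h, ← this]
      simp [queryState, Set.indicator, h]
    · have := p.resolvent_const j 0
      rw [mul_zero] at this
      rw [if_neg h, ← this]
      simp [queryState, Set.indicator, h]
  have ha_ne : ∀ i, a i ≠ ⊤ := by
    intro i
    refine ENNReal.mul_ne_top ENNReal.ofReal_ne_top (ne_top_of_le_ne_top ?_
      (p.resolvent_mono (ψ := fun _ _ => ENNReal.ofReal p.lam) fun y t => ?_))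
    · rw [p.resolvent_const]
      exact ENNReal.mul_ne_top ENNReal.ofReal_ne_top ENNReal.ofReal_ne_top
    · exact mul_le_of_le_one_right' (hf1 _)
  have hW' : ∀ j, a 0 * W 0 j + a 1 * W 1 j =
      p.resolvent j (fun y t => ENNReal.ofReal p.lam * f (y, j, t)) +
      p.resolvent j fun y _ => ENNReal.ofReal p.μ * (a 0 * W 0 y + a 1 * W 1 y) := by
    intro j
    have haj : a j * ENNReal.ofReal (p.lam / (p.lam + p.μ)) =
        p.resolvent j (fun y t => ENNReal.ofReal p.lam * f (y, j, t)) := by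
      rw [ha]
      simp only
      rw [mul_right_comm, ← ENNReal.ofReal_mul (by positivity)]
      have : (p.lam + p.μ) / p.lam * (p.lam / (p.lam + p.μ)) = 1 := by field_simp
      rw [this, ENNReal.ofReal_one, one_mul]
    rw [hsplit, hsmul, hsmul, hWi 0 j, hWi 1 j, ← haj]
    fin_cases j <;> simp <;> ring
  -- The probability that a query precedes the next job: only then does the recursion continue.
  set ρ : ℝ≥0∞ := ENNReal.ofReal (p.μ / (p.lam + p.μ)) with hρ
  have hρ1 : ρ < 1 := by
    rw [hρ, ENNReal.ofReal_lt_one, div_lt_one (by positivity)]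
    linarith
  have hcontr : ∀ (G : Fin 2 → ℝ≥0∞) (w w' : Fin 2 → ℝ≥0∞) (c : ℝ≥0∞), (∀ j, w j ≤ w' j + c) →
      ∀ j, G j + p.resolvent j (fun y _ => ENNReal.ofReal p.μ * w y) ≤
        G j + p.resolvent j (fun y _ => ENNReal.ofReal p.μ * w' y) + ρ * c := by
    intro G w w' c h j
    rw [add_assoc]
    refine add_le_add_right ?_ _
    have hc : ρ * c = p.resolvent j (fun y _ => ENNReal.ofReal p.μ * c) := by
      rw [p.resolvent_const, ← mul_assoc, ← ENNReal.ofReal_mul (by positivity), one_div_mul_eq_div]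
    rw [hc, ← hsplit w' (fun _ => c)]
    exact p.resolvent_mono fun y _ => mul_le_mul_right (h y) _
  have hmain : ∀ j, p.acceptMean τ f (queryState τ j) = a 0 * W 0 j + a 1 * W 1 j := by
    intro j
    refine le_antisymm ?_ ?_
    · refine le_of_contraction (V := fun j => p.acceptMean τ f (queryState τ j))
        (V' := fun j => a 0 * W 0 j + a 1 * W 1 j) hρ1 ENNReal.one_ne_top
        (fun j => (acceptMean_le_one hf1 _).trans le_add_self) ?_ j
      intro c _ h j
      rw [hWf, hW']
      exact hcontr (fun j => p.resolvent j (fun y t => ENNReal.ofReal p.lam * f (y, j, t))) _ _ c h j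
    · refine le_of_contraction (V' := fun j => p.acceptMean τ f (queryState τ j))
        (V := fun j => a 0 * W 0 j + a 1 * W 1 j) (C := a 0 + a 1) hρ1
        (ENNReal.add_ne_top.2 ⟨ha_ne 0, ha_ne 1⟩) (fun j => ?_) ?_ j
      · refine le_trans ?_ le_add_self
        exact add_le_add (mul_le_of_le_one_right' (hW1 _ _)) (mul_le_of_le_one_right' (hW1 _ _))
      intro c _ h j
      rw [hWf, hW']
      exact hcontr (fun j => p.resolvent j (fun y t => ENNReal.ofReal p.lam * f (y, j, t))) _ _ c h j
  rw [acceptMean_emptyState_one hτ hf hf1, hmain, Fin.sum_univ_two, acceptProb_eq hτ,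
    acceptProb_eq hτ, acceptMean_emptyState_one hτ (hI 0) (hI1 0),
    acceptMean_emptyState_one hτ (hI 1) (hI1 1),
    ← resolvent_eq_lintegral_ageLaw (g := fun y t => f (y, 0, t)) (fun y => by fun_prop),
    ← resolvent_eq_lintegral_ageLaw (g := fun y t => f (y, 1, t)) (fun y => by fun_prop)]
  simp only [ha, hW, mul_comm]

/-- The joint law of machine, estimate and age when the first job after a submission arrives. -/
theorem acceptMean_emptyState (hτ : ∀ i, Measurable (τ i)) {f : Fin 2 × Fin 2 × ℝ → ℝ≥0∞}
    (hf : Measurable f) :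
    p.acceptMean τ f (emptyState 1 1 0) = ∑ i, acceptProb p τ i *
      ∑ x, ∫⁻ u, ENNReal.ofReal (p.transition u i x) * f (x, i, u) ∂p.ageLaw := by
  have hd := measurable_acceptData_right hτ (emptyState 1 1 0)
  set ν : Measure (Fin 2 × Fin 2 × ℝ) := (p.law.restrict
    {ω | ∃ n, event τ (emptyState 1 1 0) ω n = .point .job}).map
      (acceptData τ (emptyState 1 1 0)) with hν
  have h1 : ∀ g : Fin 2 × Fin 2 × ℝ → ℝ≥0∞, Measurable g →
      p.acceptMean τ g (emptyState 1 1 0) = ∫⁻ c, g c ∂ν := fun g hg => by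
    rw [hν, lintegral_map hg hd]; rfl
  set ν' : Measure (Fin 2 × Fin 2 × ℝ) := ∑ i, acceptProb p τ i • ∑ x,
    (p.ageLaw.withDensity fun u => ENNReal.ofReal (p.transition u i x)).map fun u => (x, i, u)
    with hν'
  have h2 : ∀ g : Fin 2 × Fin 2 × ℝ → ℝ≥0∞, Measurable g → ∫⁻ c, g c ∂ν' =
      ∑ i, acceptProb p τ i *
        ∑ x, ∫⁻ u, ENNReal.ofReal (p.transition u i x) * g (x, i, u) ∂p.ageLaw := fun g hg => by
    simp only [hν', lintegral_finsetSum_measure, lintegral_smul_measure, smul_eq_mul]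
    refine Finset.sum_congr rfl fun i _ => ?_
    congr 1
    refine Finset.sum_congr rfl fun x _ => ?_
    rw [lintegral_map hg (by fun_prop),
      lintegral_withDensity_eq_lintegral_mul _ (by fun_prop) (by fun_prop)]
    rfl
  -- Both sides are integrals against measures, so agreement on indicators, where the bound by `1`
  -- holds, extends to unbounded `f`.
  have : ν = ν' := by
    ext A hA
    rw [← lintegral_indicator_one hA, ← lintegral_indicator_one hA,
      h2 _ (measurable_one.indicator hA), ← h1 _ (measurable_one.indicator hA)]
    exact acceptMean_of_le_one hτ (measurable_one.indicator hA)
      fun c => Set.indicator_le_self' (fun _ _ => zero_le) c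
  rw [h1 f hf, this, h2 f hf]

/-- What almost surely does not hold at the first job after a submission does not hold at the first
job from any other start. -/
theorem acceptMean_eq_zero (hτ : ∀ i, Measurable (τ i)) {f : Fin 2 × Fin 2 × ℝ → ℝ≥0∞}
    (hf : Measurable f) (hf1 : ∀ c, f c ≤ 1) (h : p.acceptMean τ f (emptyState 1 1 0) = 0)
    {s : SysState} (hs : s.holding = false) (hage : 0 ≤ s.age) : p.acceptMean τ f s = 0 := by
  have hl := ENNReal.ofReal_ne_zero_iff.2 p.lam_pos
  have hμ := ENNReal.ofReal_ne_zero_iff.2 p.μ_pos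
  have key : ∀ j, p.acceptMean τ f (queryState τ j) = 0 → ∀ y,
      (∀ᵐ t ∂volume.restrict (Set.Ici 0), f (y, j, t) = 0) ∧
        p.acceptMean τ f (queryState τ y) = 0 := by
    intro j hj y
    rw [acceptMean_eq_resolvent hτ hf hf1 (s := queryState τ j) rfl,
      p.resolvent_eq_zero_iff fun y => by fun_prop] at hj
    have hy := hj y
    simp only [add_eq_zero, mul_eq_zero, hl, hμ, false_or, queryState, zero_add] at hy
    refine ⟨hy.mono fun t ht => ht.1, ?_⟩
    have : (ae (volume.restrict (Set.Ici (0 : ℝ)))).NeBot := by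
      rw [ae_neBot, Ne, Measure.restrict_eq_zero, Real.volume_Ici]
      exact ENNReal.top_ne_zero
    obtain ⟨t, ht⟩ := hy.exists
    exact ht.2
  rw [acceptMean_emptyState_one hτ hf hf1] at h
  have h0 := (key 1 h 0).2
  have hall : ∀ i y, (∀ᵐ t ∂volume.restrict (Set.Ici 0), f (y, i, t) = 0) ∧
      p.acceptMean τ f (queryState τ y) = 0 := by
    intro i
    fin_cases i
    exacts [key 0 h0, key 1 h]
  rw [acceptMean_eq_resolvent hτ hf hf1 hs, p.resolvent_eq_zero_iff fun y => by fun_prop]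
  intro y
  have h1 := (hall s.est y).1
  rw [ae_restrict_iff' measurableSet_Ici] at h1 ⊢
  -- A start with age `s.age` sees ages `s.age + t`; null sets survive the translation, and
  -- nonnegativity of the initial age keeps it in the half-line where `f` is known to vanish.
  have h2 := (measurePreserving_add_left volume s.age).quasiMeasurePreserving.ae h1
  filter_upwards [h2] with t ht ht0
  rw [ht (add_nonneg hage ht0), (hall s.est y).2, mul_zero, mul_zero, add_zero]

end Accept

/-! ### Local finiteness of the streams -/

theorem tendsto_sum_atTop_of_average {a : ℕ → ℝ} {m : ℝ} (hm : 0 < m)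
    (h : Tendsto (fun n : ℕ => (∑ i ∈ Finset.range n, a i) / n) atTop (𝓝 m)) :
    Tendsto (fun n => ∑ i ∈ Finset.range n, a i) atTop atTop := by
  have h1 := h.pos_mul_atTop hm (tendsto_natCast_atTop_atTop (R := ℝ))
  refine h1.congr' ?_
  filter_upwards [eventually_gt_atTop 0] with n hn
  have : (n : ℝ) ≠ 0 := by positivity
  field_simp

/-- Realisations of the inter-arrival times for which the points of all streams are locally
finite. -/
structure Regular (ω : Noise) : Prop where
  nonneg : ∀ i, 0 ≤ ω i
  diverges : ∀ k, Tendsto (fun n => ∑ j ∈ Finset.range n, ω (k, j)) atTop atTop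

theorem Params.ae_regular (p : Params) : ∀ᵐ ω ∂p.law, Regular ω := by
  have hdiv : ∀ k, ∀ᵐ ω ∂p.law, Tendsto (fun n => ∑ j ∈ Finset.range n, ω (k, j)) atTop atTop := by
    intro k
    -- Truncating the gaps at `1` makes integrability trivial, and a divergent sum of truncated gaps
    -- forces the full sum to diverge.
    have hmin : ∀ i : Source × ℕ, Measurable fun ω : Noise => min (ω i) 1 := fun i => by fun_prop
    have hbound : ∀ i, ∀ᵐ ω ∂p.law, ‖min (ω i) 1‖ ≤ 1 := by
      intro i
      filter_upwards [p.ae_pos] with ω hω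
      rw [Real.norm_of_nonneg (le_min (hω i).le zero_le_one)]
      exact min_le_right _ _
    have hint : ∀ i, Integrable (fun ω : Noise => min (ω i) 1) p.law := fun i =>
      Integrable.of_bound (hmin i).aestronglyMeasurable 1 (hbound i)
    have hind : iIndepFun (fun (i : Source × ℕ) (ω : Noise) => min (ω i) 1) p.law :=
      iIndepFun_infinitePi (P := fun k : Source × ℕ => expMeasure (p.rate k.1))
        (X := fun _ a => min a 1) fun _ => by fun_prop
    have hid : ∀ j, IdentDistrib (fun ω : Noise => min (ω (k, j)) 1)
        (fun ω : Noise => min (ω (k, 0)) 1) p.law p.law := by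
      intro j
      have e : ∀ j, p.law.map (fun ω : Noise => min (ω (k, j)) 1) =
          (expMeasure (p.rate k)).map fun a => min a 1 := by
        intro j
        have := (measurePreserving_eval_infinitePi
          (fun k : Source × ℕ => expMeasure (p.rate k.1)) (k, j)).map_eq
        rw [← this, Measure.map_map (by fun_prop) (by fun_prop)]
        rfl
      exact ⟨(hmin _).aemeasurable, (hmin _).aemeasurable, by rw [e, e]⟩
    have hlaw := strong_law_ae_real (μ := p.law) (fun j (ω : Noise) => min (ω (k, j)) 1) (hint _)
      (fun i j hij => hind.indepFun fun h => hij (by simpa using h)) hid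
    have hmean : 0 < ∫ ω : Noise, min (ω (k, 0)) 1 ∂p.law := by
      refine (integral_pos_iff_support_of_nonneg_ae ?_ (hint _)).2 ?_
      · filter_upwards [p.ae_pos] with ω hω
        exact le_min (hω _).le zero_le_one
      · have : p.law (Function.support fun ω : Noise => min (ω (k, 0)) 1) = 1 := by
          refine (prob_compl_eq_zero_iff (hmin _ (measurableSet_singleton 0).compl)).1 ?_
          refine measure_mono_null ?_ (ae_iff.1 p.ae_pos)
          intro ω hω h
          exact (lt_min (h (k, 0)) zero_lt_one).ne' (not_not.1 hω)
        rw [this]; exact one_pos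
    filter_upwards [hlaw] with ω hω
    refine tendsto_atTop_mono (fun n => Finset.sum_le_sum fun j _ => min_le_left (ω (k, j)) 1)
      (tendsto_sum_atTop_of_average hmean hω)
  filter_upwards [p.ae_pos, ae_all_iff.2 hdiv] with ω h1 h2
  exact ⟨fun i => (h1 i).le, h2⟩

/-! ### Counting events along a path, and non-explosion -/

section Paths

open Classical in
/-- The number of events `K` among the first `n` events. -/
noncomputable def eventCount (τ : Policy) (s : SysState) (ω : Noise) (K : Event) (n : ℕ) : ℕ :=
  Nat.count (fun m => event τ s ω m = K) n

/-- The time of the last of the first `n` events. -/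
noncomputable def elapsed (τ : Policy) (s : SysState) (ω : Noise) (n : ℕ) : ℝ :=
  ∑ m ∈ Finset.range n, delay τ s ω m

variable {τ : Policy} {s : SysState} {ω : Noise}

theorem eventCount_zero (K : Event) : eventCount τ s ω K 0 = 0 := by
  classical exact Nat.count_zero _

open Classical in
theorem eventCount_succ (K : Event) (n : ℕ) : eventCount τ s ω K (n + 1) =
    eventCount τ s ω K n + if event τ s ω n = K then 1 else 0 := Nat.count_succ _ _

theorem eventCount_mono (K : Event) : Monotone (eventCount τ s ω K) := by
  classical exact Nat.count_monotone _

theorem elapsed_succ (n : ℕ) : elapsed τ s ω (n + 1) = elapsed τ s ω n + delay τ s ω n :=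
  Finset.sum_range_succ _ _

theorem nextDelay_nonneg (h : ∀ k, 0 ≤ ω (k, 0)) : 0 ≤ nextDelay s ω := by
  rw [nextDelay_eq]
  split_ifs
  · exact ENNReal.toReal_nonneg
  · rw [← nextSource_spec]; exact h _

theorem nextDelay_le (h : ∀ k, 0 ≤ ω (k, 0)) (k : Source) : nextDelay s ω ≤ ω (k, 0) := by
  refine le_trans ?_ (nextTime_le ω k)
  rw [nextDelay_eq]
  split_ifs with h'
  · exact ENNReal.toReal_le_of_le_ofReal (by rw [← nextSource_spec]; exact h _) h'.2
  · exact le_rfl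

theorem nextDelay_of_point {k : Source} (h : nextEvent s ω = .point k) :
    nextDelay s ω = ω (k, 0) := by
  unfold nextDelay
  rw [h, ← nextSource_spec]
  unfold nextEvent at h
  split_ifs at h
  injection h with h
  rw [h]

/-- The remaining inter-arrival times in terms of the original ones. -/
theorem config_snd (hω : ∀ i, 0 ≤ ω i) (n : ℕ) (k : Source) :
    (config τ s ω n).2 (k, 0) =
        ∑ j ∈ Finset.range (eventCount τ s ω (.point k) n + 1), ω (k, j) - elapsed τ s ω n ∧
      (∀ j, (config τ s ω n).2 (k, j + 1) = ω (k, eventCount τ s ω (.point k) n + j + 1)) ∧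
      0 ≤ (config τ s ω n).2 (k, 0) ∧
      ∑ j ∈ Finset.range (eventCount τ s ω (.point k) n), ω (k, j) ≤ elapsed τ s ω n := by
  induction n generalizing k with
  | zero => simp [eventCount_zero, elapsed, config, hω]
  | succ n ih =>
    have hpos : ∀ k, 0 ≤ (config τ s ω n).2 (k, 0) := fun k => (ih k).2.2.1
    obtain ⟨h1, h2, h3, h4⟩ := ih k
    have hd : delay τ s ω n ≤ (config τ s ω n).2 (k, 0) := nextDelay_le hpos k
    have hd0 : 0 ≤ delay τ s ω n := nextDelay_nonneg hpos
    rw [config_succ_snd, eventCount_succ, elapsed_succ]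
    by_cases he : event τ s ω n = .point k
    · have hdk : delay τ s ω n = (config τ s ω n).2 (k, 0) := nextDelay_of_point he
      simp only [shiftNoise, he, if_true]
      refine ⟨?_, fun j => ?_, ?_, ?_⟩
      · rw [h2 0, Finset.sum_range_succ, hdk, h1]
        simp
      · rw [h2 (j + 1)]
        congr 2
        ring
      · rw [h2 0]; exact hω _
      · rw [hdk, h1]; simp
    · simp only [shiftNoise, he, if_false, if_true, add_zero, Nat.add_eq_zero_iff, one_ne_zero,
        and_false]
      exact ⟨by rw [h1]; ring, h2, sub_nonneg.2 hd, by linarith⟩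

theorem delay_nonneg (hω : ∀ i, 0 ≤ ω i) (n : ℕ) : 0 ≤ delay τ s ω n :=
  nextDelay_nonneg fun k => (config_snd hω n k).2.2.1

theorem elapsed_mono (hω : ∀ i, 0 ≤ ω i) : Monotone (elapsed τ s ω) :=
  monotone_nat_of_le_succ fun n => by
    rw [elapsed_succ]
    linarith [delay_nonneg (τ := τ) (s := s) hω n]

open Classical in
-- Each submission empties the buffer and each filling needs an arrival. The extra `1` allows for a
-- job already held at the start.
theorem eventCount_submit_le (n : ℕ) : eventCount τ s ω .submit n +
    (if (config τ s ω n).1.holding = true then 1 else 0) ≤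
      eventCount τ s ω (.point .job) n + 1 := by
  induction n with
  | zero => simp only [eventCount_zero]; split_ifs <;> simp
  | succ n ih =>
    rw [eventCount_succ, eventCount_succ, config_succ_fst]
    have hh : (stateBefore τ s ω n).holding = (config τ s ω n).1.holding := rfl
    match he : event τ s ω n with
    | .submit =>
      have : (config τ s ω n).1.holding = true := by
        unfold event nextEvent at he
        split_ifs at he with h
        exact h.1
      rw [if_pos this] at ih
      simpa [SysState.apply] using ih
    | .point .job =>
      by_cases h : (config τ s ω n).1.holding = true
      · rw [if_pos h] at ih
        simp [SysState.apply, hh, h]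
        omega
      · rw [if_neg h] at ih
        simp [SysState.apply, hh, h]
        omega
    | .point .internal => simpa [SysState.apply, hh] using ih
    | .point .service => simpa [SysState.apply, hh] using ih
    | .point .query => simpa [SysState.apply, hh] using ih

theorem sum_eventCount (n : ℕ) :
    ∑ k, eventCount τ s ω (.point k) n + eventCount τ s ω .submit n = n := by
  classical
  induction n with
  | zero => simp [eventCount_zero]
  | succ n ih =>
    simp only [eventCount_succ, Finset.sum_add_distrib]
    have : (∑ k, if event τ s ω n = .point k then 1 else 0) +
        (if event τ s ω n = .submit then 1 else 0) = 1 := by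
      cases event τ s ω n with
      | submit => simp
      | point k => simp
    omega

/-- Jobs keep arriving. -/
theorem Regular.tendsto_eventCount (hω : Regular ω) :
    Tendsto (eventCount τ s ω (.point .job)) atTop atTop := by
  refine tendsto_atTop_atTop_of_monotone (eventCount_mono _) fun C => ?_
  by_contra! hC
  -- If fewer than `C` jobs ever arrive, the clock never passes `D`. Local finiteness then bounds
  -- every stream, hence also the submissions, and so the total number of events.
  set D := ∑ j ∈ Finset.range (C + 1), ω (.job, j) with hD
  have hT : ∀ n, elapsed τ s ω n ≤ D := by
    intro n
    obtain ⟨h1, -, h3, -⟩ := config_snd (τ := τ) (s := s) hω.nonneg n .job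
    have : ∑ j ∈ Finset.range (eventCount τ s ω (.point .job) n + 1), ω (.job, j) ≤ D :=
      Finset.sum_le_sum_of_subset_of_nonneg
        (Finset.range_subset_range.2 (by have := hC n; omega)) fun _ _ _ => hω.nonneg _
    linarith
  have hb : ∀ k, ∃ M, ∀ n, eventCount τ s ω (.point k) n ≤ M := by
    intro k
    obtain ⟨M, hM⟩ := (hω.diverges k).eventually_gt_atTop D |>.exists_forall_of_atTop
    refine ⟨M, fun n => ?_⟩
    by_contra! h
    have := hM _ h.le
    linarith [hT n, (config_snd (τ := τ) (s := s) hω.nonneg n k).2.2.2]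
  choose M hM using hb
  classical
  have h1 := sum_eventCount (τ := τ) (s := s) (ω := ω) (∑ k, M k + C + 2)
  have h2 := eventCount_submit_le (τ := τ) (s := s) (ω := ω) (∑ k, M k + C + 2)
  have h3 := hC (∑ k, M k + C + 2)
  have h4 : ∑ k, eventCount τ s ω (.point k) (∑ k, M k + C + 2) ≤ ∑ k, M k :=
    Finset.sum_le_sum fun k _ => hM k _
  omega

/-- There are finitely many events in finite time. -/
theorem Regular.tendsto_elapsed (hω : Regular ω) : Tendsto (elapsed τ s ω) atTop atTop :=
  tendsto_atTop_mono (fun n => (config_snd hω.nonneg n .job).2.2.2)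
    ((hω.diverges .job).comp hω.tendsto_eventCount)

theorem exists_event_of_tendsto {K : Event} (h : Tendsto (eventCount τ s ω K) atTop atTop) :
    ∃ n, event τ s ω n = K := by
  classical
  by_contra! hK
  obtain ⟨n, hn⟩ := (h.eventually_gt_atTop 0).exists
  have : eventCount τ s ω K n = 0 := by
    rw [eventCount, Nat.count_eq_card_filter_range]
    simp [hK]
  omega

end Paths

/-! ### Strong laws along iterates of a measure preserving map -/

section Ergodic

variable {Ω : Type*} {mΩ : MeasurableSpace Ω} {P : Measure Ω} {θ : Ω → Ω}

/-- Strong law for the iterates of a measure preserving map whose value is independent of the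
averaged function. -/
theorem strong_law_iterate (hθ : MeasurePreserving θ P P) {f : Ω → ℝ} (hf : Measurable f)
    (hint : Integrable f P) (hind : IndepFun f θ P) :
    ∀ᵐ ω ∂P, Tendsto (fun n : ℕ => (∑ j ∈ Finset.range n, f (θ^[j] ω)) / n) atTop
      (𝓝 (∫ ω, f ω ∂P)) := by
  -- Pairwise independence suffices for the strong law. Pulling back along `θ^[j]` reduces a pair to
  -- `f` and a function of `θ`.
  have hlt : ∀ j k, j < k → IndepFun (fun ω => f (θ^[j] ω)) (fun ω => f (θ^[k] ω)) P := by
    intro j k hjk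
    obtain ⟨d, rfl⟩ := Nat.exists_eq_add_of_lt hjk
    rw [indepFun_iff_measure_inter_preimage_eq_mul]
    intro A B hA hB
    have hg : Measurable (f ∘ θ^[d]) := hf.comp (hθ.measurable.iterate d)
    have h0 := hind.measure_inter_preimage_eq_mul A ((f ∘ θ^[d]) ⁻¹' B) hA (hg hB)
    have hj := hθ.iterate j
    have e : (fun ω => f (θ^[j + d + 1] ω)) ⁻¹' B = θ^[j] ⁻¹' (θ ⁻¹' ((f ∘ θ^[d]) ⁻¹' B)) := by
      ext ω
      have : θ^[j + d + 1] ω = θ^[d] (θ (θ^[j] ω)) := by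
        rw [show j + d + 1 = d + (1 + j) by ring, Function.iterate_add_apply,
          Function.iterate_add_apply]
        rfl
      simp only [Set.mem_preimage, this, Function.comp_apply]
    have e' : (fun ω => f (θ^[j] ω)) ⁻¹' A = θ^[j] ⁻¹' (f ⁻¹' A) := rfl
    rw [e, e', ← Set.preimage_inter,
      hj.measure_preimage ((hf hA).inter (hθ.measurable (hg hB))).nullMeasurableSet,
      hj.measure_preimage (hf hA).nullMeasurableSet,
      hj.measure_preimage (hθ.measurable (hg hB)).nullMeasurableSet, h0]
  refine strong_law_ae_real (fun j ω => f (θ^[j] ω)) hint ?_ fun j => ?_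
  · intro j k hjk
    rcases lt_or_gt_of_ne hjk with h | h
    · exact hlt j k h
    · exact (hlt k j h).symm
  · have hj := hθ.iterate j
    refine ⟨(hf.comp hj.measurable).aemeasurable, hf.aemeasurable, ?_⟩
    have : (fun ω => f (θ^[j] ω)) = f ∘ θ^[j] := rfl
    rw [this, ← Measure.map_map hf hj.measurable, hj.map_eq]
    rfl

/-- The averages of a nonnegative function with infinite mean diverge. -/
theorem strong_law_iterate_top [IsProbabilityMeasure P] (hθ : MeasurePreserving θ P P)
    {g : Ω → ℝ≥0∞} (hg : Measurable g)
    (hfin : ∀ᵐ ω ∂P, g ω ≠ ⊤) (htop : ∫⁻ ω, g ω ∂P = ⊤) (hind : IndepFun g θ P) :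
    ∀ᵐ ω ∂P, Tendsto (fun n : ℕ => (∑ j ∈ Finset.range n, (g (θ^[j] ω)).toReal) / n) atTop
      atTop := by
  -- Truncation at `M` gives averages with finite limits that bound the original averages from
  -- below; by monotone convergence these limits exceed every level.
  set f : ℕ → Ω → ℝ := fun M ω => (min (g ω) M).toReal with hfdef
  have hf : ∀ M, Measurable (f M) := fun M => by fun_prop
  have hne : ∀ (M : ℕ) ω, min (g ω) (M : ℝ≥0∞) ≠ ⊤ := fun M ω =>
    ne_top_of_le_ne_top (ENNReal.natCast_ne_top M) (min_le_right _ _)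
  have hint : ∀ M, Integrable (f M) P := fun M =>
    Integrable.of_bound (hf M).aestronglyMeasurable M <| ae_of_all _ fun ω => by
      rw [Real.norm_of_nonneg ENNReal.toReal_nonneg]
      exact ENNReal.toReal_le_of_le_ofReal (Nat.cast_nonneg _) (by simp)
  have hlaw : ∀ M, ∀ᵐ ω ∂P, Tendsto (fun n : ℕ => (∑ j ∈ Finset.range n, f M (θ^[j] ω)) / n) atTop
      (𝓝 (∫ ω, f M ω ∂P)) := fun M => by
    refine strong_law_iterate hθ (hf M) (hint M) ?_
    exact hind.comp (φ := fun a => (min a (M : ℝ≥0∞)).toReal) (ψ := id) (by fun_prop) measurable_id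
  have hmean : Tendsto (fun M : ℕ => ENNReal.ofReal (∫ ω, f M ω ∂P)) atTop (𝓝 ⊤) := by
    have e : ∀ M, ENNReal.ofReal (∫ ω, f M ω ∂P) = ∫⁻ ω, min (g ω) M ∂P := by
      intro M
      rw [ofReal_integral_eq_lintegral_ofReal (hint M) (ae_of_all _ fun _ => ENNReal.toReal_nonneg)]
      exact lintegral_congr fun ω => ENNReal.ofReal_toReal (hne M ω)
    simp only [e]
    rw [← htop]
    refine lintegral_tendsto_of_tendsto_of_monotone (fun M => by fun_prop)
      (ae_of_all _ fun ω M M' h => min_le_min_left _ (by exact_mod_cast h)) (ae_of_all _ fun ω => ?_)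
    have := (tendsto_const_nhds (x := g ω)).min ENNReal.tendsto_nat_nhds_top
    simpa using this
  have hfin' : ∀ᵐ ω ∂P, ∀ j, g (θ^[j] ω) ≠ ⊤ := by
    rw [ae_all_iff]
    exact fun j => (hθ.iterate j).quasiMeasurePreserving.ae hfin
  filter_upwards [ae_all_iff.2 hlaw, hfin'] with ω h1 h2
  rw [tendsto_atTop]
  intro b
  obtain ⟨M, hM⟩ := (hmean.eventually (lt_mem_nhds (ENNReal.ofReal_lt_top (r := b)))).exists
  have hM' : b < ∫ ω, f M ω ∂P := (ENNReal.ofReal_lt_ofReal_iff').1 hM |>.1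
  filter_upwards [(h1 M).eventually (lt_mem_nhds hM')] with n hn
  refine hn.le.trans (div_le_div_of_nonneg_right (Finset.sum_le_sum fun j _ => ?_)
    (Nat.cast_nonneg _))
  exact ENNReal.toReal_mono (h2 j) (min_le_left _ _)

end Ergodic

/-! ### Deterministic renewal-reward limits -/

section Limits

variable {y J : ℕ → ℝ} {κ : ℕ → ℕ} {num den : ℕ → ℝ}

/-- Dividing by the number `κ n` of completed cycles turns the numerator into an average and
squeezes the denominator between two averages with the same limit. -/
theorem tendsto_renewal_reward (hκ : Tendsto κ atTop atTop)
    (hnum : ∀ n, num n = ∑ j ∈ Finset.range (κ n), y j)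
    (hden₁ : ∀ n, ∑ j ∈ Finset.range (κ n), J j ≤ den n)
    (hden₂ : ∀ n, den n ≤ ∑ j ∈ Finset.range (κ n + 1), J j) {a b : ℝ} (hb : 0 < b)
    (hy : Tendsto (fun n : ℕ => (∑ j ∈ Finset.range n, y j) / n) atTop (𝓝 a))
    (hJ : Tendsto (fun n : ℕ => (∑ j ∈ Finset.range n, J j) / n) atTop (𝓝 b)) :
    Tendsto (fun n => num n / den n) atTop (𝓝 (a / b)) := by
  have h1 : Tendsto (fun n : ℕ => (∑ j ∈ Finset.range (n + 1), J j) / n) atTop (𝓝 b) := by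
    have h := (hJ.comp (tendsto_add_atTop_nat 1)).mul
      ((tendsto_natCast_div_add_atTop (1 : ℝ)).inv₀ one_ne_zero)
    rw [inv_one, mul_one] at h
    refine h.congr' ?_
    filter_upwards [eventually_gt_atTop 0] with n hn
    have : (n : ℝ) ≠ 0 := by positivity
    simp only [Function.comp]
    push_cast
    field_simp
  have hd : Tendsto (fun n => den n / κ n) atTop (𝓝 b) :=
    tendsto_of_tendsto_of_tendsto_of_le_of_le (hJ.comp hκ) (h1.comp hκ)
      (fun n => div_le_div_of_nonneg_right (hden₁ n) (Nat.cast_nonneg _))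
      (fun n => div_le_div_of_nonneg_right (hden₂ n) (Nat.cast_nonneg _))
  refine ((hy.comp hκ).div hd hb.ne').congr' ?_
  filter_upwards [hκ.eventually_gt_atTop 0] with n hn
  have : (κ n : ℝ) ≠ 0 := by positivity
  simp only [Function.comp, Pi.div_apply, hnum]
  rw [div_div_div_cancel_right₀ this]

/-- With infinite mean cycle size the lower bound on the denominator alone suffices. -/
theorem tendsto_renewal_reward_zero (hκ : Tendsto κ atTop atTop)
    (hnum : ∀ n, num n = ∑ j ∈ Finset.range (κ n), y j)
    (hden₁ : ∀ n, ∑ j ∈ Finset.range (κ n), J j ≤ den n) {a : ℝ}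
    (hy : Tendsto (fun n : ℕ => (∑ j ∈ Finset.range n, y j) / n) atTop (𝓝 a))
    (hJ : Tendsto (fun n : ℕ => (∑ j ∈ Finset.range n, J j) / n) atTop atTop) :
    Tendsto (fun n => num n / den n) atTop (𝓝 0) := by
  have hd : Tendsto (fun n => den n / κ n) atTop atTop :=
    tendsto_atTop_mono (fun n => div_le_div_of_nonneg_right (hden₁ n) (Nat.cast_nonneg _))
      (hJ.comp hκ)
  refine ((hy.comp hκ).div_atTop hd).congr' ?_
  filter_upwards [hκ.eventually_gt_atTop 0] with n hn
  have : (κ n : ℝ) ≠ 0 := by positivity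
  simp only [Function.comp, hnum]
  rw [div_div_div_cancel_right₀ this]

/-- A change of finitely many terms does not affect the limit of the quotient. -/
theorem tendsto_div_of_shift {num' den' : ℕ → ℝ} {a b R : ℝ} (N : ℕ)
    (hnum : ∀ m, num (N + m) = a + num' m) (hden : ∀ m, den (N + m) = b + den' m)
    (hd : Tendsto den' atTop atTop) (h : Tendsto (fun m => num' m / den' m) atTop (𝓝 R)) :
    Tendsto (fun n => num n / den n) atTop (𝓝 R) := by
  rw [← tendsto_add_atTop_iff_nat N]
  have h1 : Tendsto (fun m => (a / den' m + num' m / den' m) / (b / den' m + 1)) atTop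
      (𝓝 ((0 + R) / (0 + 1))) :=
    ((hd.const_div_atTop a).add h).div ((hd.const_div_atTop b).add tendsto_const_nhds) (by simp)
  simp only [zero_add, div_one] at h1
  refine h1.congr' ?_
  filter_upwards [hd.eventually_gt_atTop 0] with m hm
  rw [add_comm m N, hnum, hden, ← add_div]
  have : b / den' m + 1 = (b + den' m) / den' m := by rw [add_div, div_self hm.ne']
  rw [this, div_div_div_cancel_right₀ hm.ne']

end Limits

/-! ### Revenue and arrivals along the events -/

section Revenue

variable {p : Params} {τ : Policy} {s : SysState} {ω : Noise}

/-- The revenue or penalty of a submission from the state `s`. -/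
noncomputable def Params.payoff (p : Params) (s : SysState) : ℝ := if s.x = 0 then p.rs else -p.cd

open Classical in
/-- The total revenue of the first `n` events. -/
noncomputable def revenue (p : Params) (τ : Policy) (s : SysState) (ω : Noise) (n : ℕ) : ℝ :=
  ∑ m ∈ Finset.range n, if event τ s ω m = .submit then p.payoff (stateBefore τ s ω m) else 0

/-- The quotient of revenue and number of arrivals among the first `n` events. -/
noncomputable def revenueRatio (p : Params) (τ : Policy) (s : SysState) (ω : Noise) (n : ℕ) : ℝ :=
  revenue p τ s ω n / eventCount τ s ω (.point .job) n

theorem eventTime_eq (n : ℕ) : eventTime τ s ω n = elapsed τ s ω (n + 1) := rfl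

open Classical in
theorem revenue_eq (n : ℕ) : revenue p τ s ω n =
    p.rs * Nat.count (fun m => event τ s ω m = .submit ∧ (stateBefore τ s ω m).x = 0) n -
      p.cd * Nat.count (fun m => event τ s ω m = .submit ∧ (stateBefore τ s ω m).x = 1) n := by
  induction n with
  | zero => simp [revenue]
  | succ n ih =>
    rw [revenue, Finset.sum_range_succ, ← revenue, ih, Nat.count_succ, Nat.count_succ]
    have hx : (stateBefore τ s ω n).x = 0 ∨ (stateBefore τ s ω n).x = 1 := by
      generalize (stateBefore τ s ω n).x = x
      fin_cases x <;> simp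
    by_cases h : event τ s ω n = .submit
    · rcases hx with hx | hx <;> simp [h, hx, Params.payoff] <;> ring
    · simp [h]

/-- Convergence along events implies convergence in time. -/
theorem Regular.tendsto_revenueRate (hω : Regular ω) {R : ℝ}
    (h : Tendsto (revenueRatio p τ s ω) atTop (𝓝 R)) :
    Tendsto (fun t => revenueRate p τ s ω t) atTop (𝓝 R) := by
  classical
  have hex : ∀ t : ℝ, ∃ n, t < elapsed τ s ω (n + 1) := fun t =>
    ((hω.tendsto_elapsed.comp (tendsto_add_atTop_nat 1)).eventually_gt_atTop t).exists
  -- The number of events up to time `t`; by monotonicity of event times they are exactly those with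
  -- index below `N t`.
  set N : ℝ → ℕ := fun t => Nat.find (hex t) with hN
  have hmono := elapsed_mono (τ := τ) (s := s) hω.nonneg
  have hlt : ∀ t n, eventTime τ s ω n ≤ t ↔ n < N t := by
    intro t n
    rw [eventTime_eq]
    constructor
    · intro h'
      by_contra! hn
      exact absurd (Nat.find_spec (hex t)) (not_lt.2 ((hmono (by
        change Nat.find (hex t) + 1 ≤ n + 1
        exact Nat.succ_le_succ hn)).trans h'))
    · intro h'
      exact not_lt.1 (Nat.find_min (hex t) h')
  have hNt : Tendsto N atTop atTop := by
    refine tendsto_atTop.2 fun M => ?_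
    filter_upwards [eventually_ge_atTop (elapsed τ s ω M)] with t ht
    by_contra! hM
    have h1 := Nat.find_spec (hex t)
    have h2 : elapsed τ s ω (Nat.find (hex t) + 1) ≤ elapsed τ s ω M := hmono hM
    linarith
  have hcount : ∀ (t : ℝ) (P : ℕ → Prop),
      {n | eventTime τ s ω n ≤ t ∧ P n}.ncard = Nat.count P (N t) := by
    intro t P
    rw [Nat.count_eq_card_filter_range, ← Set.ncard_coe_finset]
    congr 1
    ext n
    simp [hlt]
  refine (h.comp hNt).congr fun t => ?_
  simp only [Function.comp, revenueRatio, revenueRate, numSuccess, numDiscard, numJobs, hcount,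
    revenue_eq, eventCount]
  congr!

theorem eventCount_add (K : Event) (n m : ℕ) : eventCount τ s ω K (n + m) =
    eventCount τ s ω K n + eventCount τ (config τ s ω n).1 (config τ s ω n).2 K m := by
  classical
  rw [eventCount, Nat.count_add]
  congr 1
  simp only [event_add]
  rfl

theorem revenue_add (n m : ℕ) : revenue p τ s ω (n + m) =
    revenue p τ s ω n + revenue p τ (config τ s ω n).1 (config τ s ω n).2 m := by
  rw [revenue, Finset.sum_range_add]
  refine congrArg₂ (· + ·) rfl (Finset.sum_congr rfl fun k _ => ?_)
  by_cases h : event τ s ω (n + k) = .submit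
  · rw [if_pos h, if_pos (event_add τ s ω n k ▸ h), stateBefore_add]
  · rw [if_neg h, if_neg (event_add τ s ω n k ▸ h)]

theorem revenue_of_no_submit {n : ℕ} (h : ∀ m < n, event τ s ω m ≠ .submit) :
    revenue p τ s ω n = 0 :=
  Finset.sum_eq_zero fun m hm => if_neg (h m (Finset.mem_range.1 hm))

theorem config_after_submit (h : ∃ n, event τ s ω n = .submit) :
    config τ s ω (firstIndex τ .submit s ω + 1) = (emptyState 1 1 0, noiseAfter τ .submit s ω) := by
  refine Prod.ext ?_ rfl
  rw [config_succ_fst, event_firstIndex h]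
  rfl

theorem reward_eq (h : ∃ n, event τ s ω n = .submit) :
    reward p τ s ω = p.payoff (stateBefore τ s ω (firstIndex τ .submit s ω)) := by
  classical
  have hf : Nat.find h = firstIndex τ .submit s ω :=
    le_antisymm (Nat.find_min' h (event_firstIndex h)) (Nat.sInf_le (Nat.find_spec h))
  unfold reward
  rw [dif_pos h]
  unfold Params.payoff
  congr!

theorem reward_of_no_submit (h : ¬ ∃ n, event τ s ω n = .submit) : reward p τ s ω = 0 :=
  dif_neg h

theorem revenue_first (h : ∃ n, event τ s ω n = .submit) :
    revenue p τ s ω (firstIndex τ .submit s ω + 1) = reward p τ s ω := by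
  rw [revenue, Finset.sum_range_succ, ← revenue,
    revenue_of_no_submit fun m hm => event_ne_of_lt_firstIndex hm, zero_add,
    if_pos (event_firstIndex h), reward_eq h]

theorem lost_eq (h : ∃ n, event τ s ω n = .submit) :
    lost τ s ω = eventCount τ s ω (.point .job) (firstIndex τ .submit s ω + 1) := by
  classical
  have : {n : ℕ | event τ s ω n = .point .job ∧ ∀ m ≤ n, event τ s ω m ≠ .submit} =
      ((Finset.range (firstIndex τ .submit s ω + 1)).filter
        fun n => event τ s ω n = .point .job : Finset ℕ) := by
    ext n
    simp only [Set.mem_ofPred_eq, Finset.coe_filter, Finset.mem_range]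
    constructor
    · rintro ⟨h1, h2⟩
      refine ⟨?_, h1⟩
      by_contra! hn
      exact h2 _ (by omega) (event_firstIndex h)
    · rintro ⟨h1, h2⟩
      refine ⟨h2, fun m hm => ?_⟩
      rcases hm.lt_or_eq with hm | rfl
      · exact event_ne_of_lt_firstIndex (by omega)
      · rw [h2]; simp
  rw [lost, this, Set.encard_coe_eq_coe_finsetCard, eventCount, Nat.count_eq_card_filter_range]

/-- This is what ties a cycle that may not end to an infinite denominator. -/
theorem lost_of_no_submit (h : ¬ ∃ n, event τ s ω n = .submit)
    (hN : Tendsto (eventCount τ s ω (.point .job)) atTop atTop) : lost τ s ω = ⊤ := by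
  classical
  rw [lost, Set.encard_eq_top_iff]
  intro hfin
  obtain ⟨n, hn⟩ := (hN.eventually_gt_atTop hfin.toFinset.card).exists
  refine absurd hn (not_lt.2 ?_)
  rw [eventCount, Nat.count_eq_card_filter_range]
  refine Finset.card_le_card fun m hm => ?_
  rw [Set.Finite.mem_toFinset]
  exact ⟨(Finset.mem_filter.1 hm).2, fun k _ hk => h ⟨k, hk⟩⟩

theorem tendsto_eventCount_after (hN : Tendsto (eventCount τ s ω (.point .job)) atTop atTop)
    (n : ℕ) : Tendsto (eventCount τ (config τ s ω n).1 (config τ s ω n).2 (.point .job))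
      atTop atTop := by
  have h1 : Tendsto (fun m => eventCount τ s ω (.point .job) (n + m)) atTop atTop :=
    hN.comp (tendsto_add_atTop_iff_nat (f := fun m => m) n |>.2 tendsto_id |>.congr
      fun m => add_comm _ _)
  simp only [eventCount_add] at h1
  refine tendsto_atTop.2 fun M => ?_
  filter_upwards [h1.eventually_ge_atTop (eventCount τ s ω (.point .job) n + M)] with m hm
  omega

/-- Without a submission the revenue per arrival vanishes. -/
theorem tendsto_ratio_of_no_submit (h : ¬ ∃ n, event τ s ω n = .submit) :
    Tendsto (revenueRatio p τ s ω) atTop (𝓝 0) := by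
  refine tendsto_const_nhds.congr fun n => ?_
  rw [revenueRatio, revenue_of_no_submit fun m _ hm => h ⟨m, hm⟩, zero_div]

/-- The limit is not affected by what happens until the first submission. -/
theorem tendsto_ratio_of_submit (h : ∃ n, event τ s ω n = .submit)
    (hN : Tendsto (eventCount τ s ω (.point .job)) atTop atTop) {R : ℝ}
    (hR : Tendsto (revenueRatio p τ (emptyState 1 1 0) (noiseAfter τ .submit s ω)) atTop (𝓝 R)) :
    Tendsto (revenueRatio p τ s ω) atTop (𝓝 R) := by
  have hc := config_after_submit h
  have hN' := tendsto_eventCount_after hN (firstIndex τ .submit s ω + 1)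
  rw [hc] at hN'
  refine tendsto_div_of_shift (a := revenue p τ s ω (firstIndex τ .submit s ω + 1))
    (b := eventCount τ s ω (.point .job) (firstIndex τ .submit s ω + 1))
    (firstIndex τ .submit s ω + 1) (fun m => ?_) (fun m => ?_)
    (tendsto_natCast_atTop_atTop.comp hN') hR
  · rw [revenue_add, hc]
  · rw [eventCount_add, hc]
    push_cast
    rfl

end Revenue

/-! ### Decomposition into cycles -/

section Cycles

variable (τ : Policy)

/-- The remaining inter-arrival times after the first submission, started right after a
submission. -/
noncomputable def nextCycle (ω : Noise) : Noise := noiseAfter τ .submit (emptyState 1 1 0) ω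

/-- The number of events up to the `k`-th submission, started right after a submission. -/
noncomputable def cycleStart (ω : Noise) (k : ℕ) : ℕ :=
  ∑ j ∈ Finset.range k, (firstIndex τ .submit (emptyState 1 1 0) ((nextCycle τ)^[j] ω) + 1)

variable {τ} {p : Params} {ω : Noise}

theorem config_cycleStart
    (h : ∀ j, ∃ n, event τ (emptyState 1 1 0) ((nextCycle τ)^[j] ω) n = .submit) (k : ℕ) :
    config τ (emptyState 1 1 0) ω (cycleStart τ ω k) =
      (emptyState 1 1 0, (nextCycle τ)^[k] ω) := by
  induction k with
  | zero => rfl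
  | succ k ih =>
    rw [cycleStart, Finset.sum_range_succ, ← cycleStart, config_add, ih, config_after_submit (h k),
      Function.iterate_succ_apply']
    rfl

theorem eventCount_cycleStart
    (h : ∀ j, ∃ n, event τ (emptyState 1 1 0) ((nextCycle τ)^[j] ω) n = .submit) (k : ℕ) :
    (eventCount τ (emptyState 1 1 0) ω (.point .job) (cycleStart τ ω k) : ℝ) =
      ∑ j ∈ Finset.range k,
        ((lost τ (emptyState 1 1 0) ((nextCycle τ)^[j] ω) : ℕ∞) : ℝ≥0∞).toReal := by
  induction k with
  | zero => simp [cycleStart, eventCount_zero]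
  | succ k ih =>
    rw [cycleStart, Finset.sum_range_succ, ← cycleStart, eventCount_add, config_cycleStart h,
      Finset.sum_range_succ, ← ih, lost_eq (h k)]
    simp

theorem revenue_cycleStart
    (h : ∀ j, ∃ n, event τ (emptyState 1 1 0) ((nextCycle τ)^[j] ω) n = .submit) (k : ℕ) :
    revenue p τ (emptyState 1 1 0) ω (cycleStart τ ω k) =
      ∑ j ∈ Finset.range k, reward p τ (emptyState 1 1 0) ((nextCycle τ)^[j] ω) := by
  induction k with
  | zero => simp [cycleStart, revenue]
  | succ k ih =>
    rw [cycleStart, Finset.sum_range_succ, ← cycleStart, revenue_add, config_cycleStart h,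
      Finset.sum_range_succ, ← ih, revenue_first (h k)]

/-- There is an index `κ n` of the cycle that the `n`-th event belongs to. -/
theorem exists_cycle_index
    (h : ∀ j, ∃ n, event τ (emptyState 1 1 0) ((nextCycle τ)^[j] ω) n = .submit) :
    ∃ κ : ℕ → ℕ, Tendsto κ atTop atTop ∧
      (∀ n, revenue p τ (emptyState 1 1 0) ω n =
        ∑ j ∈ Finset.range (κ n), reward p τ (emptyState 1 1 0) ((nextCycle τ)^[j] ω)) ∧
      (∀ n, ∑ j ∈ Finset.range (κ n),
        ((lost τ (emptyState 1 1 0) ((nextCycle τ)^[j] ω) : ℕ∞) : ℝ≥0∞).toReal ≤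
          (eventCount τ (emptyState 1 1 0) ω (.point .job) n : ℝ)) ∧
      ∀ n, (eventCount τ (emptyState 1 1 0) ω (.point .job) n : ℝ) ≤
        ∑ j ∈ Finset.range (κ n + 1),
          ((lost τ (emptyState 1 1 0) ((nextCycle τ)^[j] ω) : ℕ∞) : ℝ≥0∞).toReal := by
  have hG : StrictMono (cycleStart τ ω) := strictMono_nat_of_lt_succ fun k => by
    rw [cycleStart, cycleStart, Finset.sum_range_succ]; omega
  have hG0 : cycleStart τ ω 0 = 0 := rfl
  have hex : ∀ n, ∃ k, cycleStart τ ω k ≤ n ∧ n < cycleStart τ ω (k + 1) := by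
    intro n
    induction n with
    | zero => exact ⟨0, hG0.le, hG0 ▸ hG Nat.zero_lt_one⟩
    | succ n ih =>
      obtain ⟨k, h1, h2⟩ := ih
      rcases (Nat.succ_le_of_lt h2).lt_or_eq with h3 | h3
      · exact ⟨k, by omega, h3⟩
      · exact ⟨k + 1, h3.ge, h3.trans_lt (hG (Nat.lt_succ_self _))⟩
  choose κ h1 h2 using hex
  refine ⟨κ, ?_, fun n => ?_, fun n => ?_, fun n => ?_⟩
  · refine tendsto_atTop.2 fun M => ?_
    filter_upwards [eventually_ge_atTop (cycleStart τ ω M)] with n hn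
    exact Nat.lt_succ_iff.1 (hG.lt_iff_lt.1 (hn.trans_lt (h2 n)))
  · obtain ⟨d, hd⟩ := Nat.exists_eq_add_of_le (h1 n)
    have hlt := h2 n
    rw [cycleStart, Finset.sum_range_succ, ← cycleStart] at hlt
    rw [← revenue_cycleStart h]
    conv_lhs => rw [hd]
    -- The unfinished cycle contains no submission, so it earns nothing: the numerator is exactly a
    -- sum over completed cycles.
    have h0 : revenue p τ (emptyState 1 1 0) ((nextCycle τ)^[κ n] ω) d = 0 :=
      revenue_of_no_submit fun m hm => event_ne_of_lt_firstIndex (by omega)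
    rw [revenue_add, config_cycleStart h, h0, add_zero]
  · rw [← eventCount_cycleStart h]
    exact_mod_cast eventCount_mono _ (h1 n)
  · rw [← eventCount_cycleStart h]
    exact_mod_cast eventCount_mono _ (h2 n).le

end Cycles

/-! ### Measurability of the reward and of the number of lost jobs -/

section Measurability

variable {p : Params} {τ : Policy}

theorem measurable_payoff (p : Params) : Measurable p.payoff :=
  Measurable.ite (measurable_x (measurableSet_singleton 0)) measurable_const measurable_const

theorem measurable_reward (p : Params) (hτ : ∀ i, Measurable (τ i)) :
    Measurable fun c : SysState × Noise => reward p τ c.1 c.2 := by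
  classical
  have : (fun c : SysState × Noise => reward p τ c.1 c.2) = fun c =>
      if ∃ n, event τ c.1 c.2 n = .submit then
        p.payoff (stateBefore τ c.1 c.2 (firstIndex τ .submit c.1 c.2)) else 0 := by
    funext c
    split_ifs with h
    · exact reward_eq h
    · exact reward_of_no_submit h
  rw [this]
  exact Measurable.ite (measurableSet_occurs τ .submit hτ)
    ((measurable_payoff p).comp (measurable_stateBefore_first τ .submit hτ)) measurable_const

theorem lost_eq_tsum (s : SysState) (ω : Noise) : ((lost τ s ω : ℕ∞) : ℝ≥0∞) =
    ∑' n, {n : ℕ | event τ s ω n = .point .job ∧ ∀ m ≤ n, event τ s ω m ≠ .submit}.indicator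
      1 n := by
  rw [lost, ← ENNReal.tsum_set_one, ← tsum_subtype]
  rfl

theorem measurable_lost (hτ : ∀ i, Measurable (τ i)) :
    Measurable fun c : SysState × Noise => ((lost τ c.1 c.2 : ℕ∞) : ℝ≥0∞) := by
  simp only [lost_eq_tsum]
  refine Measurable.tsum fun n => ?_
  have hm : MeasurableSet {c : SysState × Noise | event τ c.1 c.2 n = .point .job ∧
      ∀ m ≤ n, event τ c.1 c.2 m ≠ .submit} := by
    have : {c : SysState × Noise | event τ c.1 c.2 n = .point .job ∧
        ∀ m ≤ n, event τ c.1 c.2 m ≠ .submit} =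
        {c : SysState × Noise | event τ c.1 c.2 n = .point .job} ∩
          ⋂ m, ⋂ _ : m ≤ n, {c : SysState × Noise | event τ c.1 c.2 m = .submit}ᶜ := by
      ext c; simp
    rw [this]
    exact (measurableSet_event τ _ hτ n).inter
      (.iInter fun m => .iInter fun _ => (measurableSet_event τ _ hτ m).compl)
  have h1 : Measurable fun c : SysState × Noise => {c : SysState × Noise |
      event τ c.1 c.2 n = .point .job ∧
        ∀ m ≤ n, event τ c.1 c.2 m ≠ .submit}.indicator (1 : SysState × Noise → ℝ≥0∞) c :=
    measurable_one.indicator hm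
  exact h1

theorem abs_reward_le (p : Params) (s : SysState) (ω : Noise) :
    |reward p τ s ω| ≤ max |p.rs| |p.cd| := by
  by_cases h : ∃ n, event τ s ω n = .submit
  · rw [reward_eq h, Params.payoff]
    split_ifs
    · exact le_max_left _ _
    · rw [abs_neg]; exact le_max_right _ _
  · rw [reward_of_no_submit h, abs_zero]
    positivity

/-- The state right after a job is accepted in terms of machine, estimate and age. -/
noncomputable def acceptedAt (τ : Policy) (c : Fin 2 × Fin 2 × ℝ) : SysState :=
  acceptState τ c.1 c.2.1 c.2.2

theorem measurable_acceptedAt (hτ : ∀ i, Measurable (τ i)) : Measurable (acceptedAt τ) :=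
  measurable_sysState (by simp only [acceptedAt, acceptState]; fun_prop)
    (by simp only [acceptedAt, acceptState]; fun_prop)
    (by simp only [acceptedAt, acceptState]; fun_prop)
    (by simp only [acceptedAt, acceptState]; fun_prop)
    ((Policy.measurable hτ).comp measurable_snd)

end Measurability

/-! ### Splitting a cycle at its first arrival -/

section FirstJob

variable {p : Params} {τ : Policy} {s : SysState} {ω : Noise}

theorem not_holding_before_job (hs : s.holding = false) {n : ℕ}
    (h : ∀ m < n, event τ s ω m ≠ .point .job) : (config τ s ω n).1.holding = false := by
  induction n with
  | zero => exact hs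
  | succ n ih =>
    have h1 := ih fun m hm => h m (by omega)
    have h2 := h n (by omega)
    rw [config_succ_fst]
    have hh : (stateBefore τ s ω n).holding = false := h1
    match he : event τ s ω n with
    | .submit => rfl
    | .point .job => exact absurd he h2
    | .point .internal => exact hh
    | .point .service => exact hh
    | .point .query => exact hh

theorem no_submit_before_job (hs : s.holding = false) {m : ℕ}
    (hm : m < firstIndex τ (.point .job) s ω + 1) : event τ s ω m ≠ .submit := by
  have := not_holding_before_job (τ := τ) (ω := ω) hs (n := m) fun k hk =>
    event_ne_of_lt_firstIndex (by omega)
  rw [event, nextEvent_of_not_holding this]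
  simp

theorem config_after_job (hs : s.holding = false) (h : ∃ n, event τ s ω n = .point .job) :
    config τ s ω (firstIndex τ (.point .job) s ω + 1) =
      (acceptedAt τ (acceptData τ s ω), noiseAfter τ (.point .job) s ω) := by
  refine Prod.ext ?_ rfl
  have h1 : (stateBefore τ s ω (firstIndex τ (.point .job) s ω)).holding = false :=
    not_holding_before_job (τ := τ) (ω := ω) hs fun k hk => event_ne_of_lt_firstIndex hk
  rw [config_succ_fst, event_firstIndex h, SysState.apply, if_neg (by simp [h1])]
  rfl

theorem submit_iff_of_job (hs : s.holding = false) (h : ∃ n, event τ s ω n = .point .job) :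
    (∃ n, event τ s ω n = .submit) ↔ ∃ n, event τ (acceptedAt τ (acceptData τ s ω))
      (noiseAfter τ (.point .job) s ω) n = .submit := by
  have hc := config_after_job hs h
  constructor
  · rintro ⟨n, hn⟩
    have : firstIndex τ (.point .job) s ω + 1 ≤ n := by
      by_contra! h'
      exact no_submit_before_job hs h' hn
    obtain ⟨d, rfl⟩ := Nat.exists_eq_add_of_le this
    rw [event_add, hc] at hn
    exact ⟨d, hn⟩
  · rintro ⟨n, hn⟩
    refine ⟨firstIndex τ (.point .job) s ω + 1 + n, ?_⟩
    rw [event_add, hc]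
    exact hn

theorem reward_of_job (hs : s.holding = false) (h : ∃ n, event τ s ω n = .point .job) :
    reward p τ s ω = reward p τ (acceptedAt τ (acceptData τ s ω))
      (noiseAfter τ (.point .job) s ω) := by
  have hc := config_after_job hs h
  by_cases h' : ∃ n, event τ s ω n = .submit
  · have h'' := (submit_iff_of_job hs h).1 h'
    have hf : firstIndex τ .submit s ω = firstIndex τ (.point .job) s ω + 1 +
        firstIndex τ .submit (acceptedAt τ (acceptData τ s ω))
          (noiseAfter τ (.point .job) s ω) := by
      refine firstIndex_eq ?_ fun m hm => ?_
      · rw [event_add, hc]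
        exact event_firstIndex h''
      · rcases lt_or_ge m (firstIndex τ (.point .job) s ω + 1) with hlt | hge
        · exact no_submit_before_job hs hlt
        · obtain ⟨d, rfl⟩ := Nat.exists_eq_add_of_le hge
          have hd : d < firstIndex τ .submit (acceptedAt τ (acceptData τ s ω))
            (noiseAfter τ (.point .job) s ω) := by omega
          rw [event_add, hc]
          exact event_ne_of_lt_firstIndex hd
    rw [reward_eq h', reward_eq h'', hf, stateBefore_add, hc]
  · rw [reward_of_no_submit h', reward_of_no_submit fun h'' => h' ((submit_iff_of_job hs h).2 h'')]

/-- From an empty buffer `lost` counts all arrivals up to the first submission, including the job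
that gets accepted. That job is the summand `1`. -/
theorem lost_of_job (hs : s.holding = false) (h : ∃ n, event τ s ω n = .point .job) :
    lost τ s ω = 1 + lost τ (acceptedAt τ (acceptData τ s ω))
      (noiseAfter τ (.point .job) s ω) := by
  have hc := config_after_job hs h
  set f := firstIndex τ (.point .job) s ω with hf
  have hset : {n : ℕ | event τ s ω n = .point .job ∧ ∀ m ≤ n, event τ s ω m ≠ .submit} =
      {f} ∪ (fun n => f + 1 + n) '' {n : ℕ | event τ (acceptedAt τ (acceptData τ s ω))
        (noiseAfter τ (.point .job) s ω) n = .point .job ∧ ∀ m ≤ n,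
          event τ (acceptedAt τ (acceptData τ s ω)) (noiseAfter τ (.point .job) s ω) m ≠
            .submit} := by
    ext n
    simp only [Set.mem_ofPred_eq, Set.mem_union, Set.mem_singleton_iff, Set.mem_image]
    constructor
    · rintro ⟨h1, h2⟩
      have h3 : f ≤ n := Nat.sInf_le h1
      rcases h3.eq_or_lt with rfl | h3
      · exact Or.inl rfl
      · obtain ⟨d, rfl⟩ := Nat.exists_eq_add_of_le (Nat.succ_le_of_lt h3)
        refine Or.inr ⟨d, ⟨?_, fun m hm => ?_⟩, rfl⟩
        · rw [Nat.succ_eq_add_one, event_add, hc] at h1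
          exact h1
        · have := h2 (f + 1 + m) (by omega)
          rw [event_add, hc] at this
          exact this
    · rintro (rfl | ⟨d, ⟨h1, h2⟩, rfl⟩)
      · exact ⟨event_firstIndex h, fun m hm => no_submit_before_job hs (by omega)⟩
      · refine ⟨by rw [event_add, hc]; exact h1, fun m hm => ?_⟩
        rcases lt_or_ge m (f + 1) with hlt | hge
        · exact no_submit_before_job hs hlt
        · obtain ⟨e, rfl⟩ := Nat.exists_eq_add_of_le hge
          rw [event_add, hc]
          exact h2 e (by omega)
  rw [lost, hset, Set.encard_union_eq, Set.encard_singleton,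
    (add_right_injective (f + 1)).encard_image]
  · rfl
  · refine Set.disjoint_left.2 ?_
    rintro _ rfl ⟨d, -, hd⟩
    simp only at hd
    omega

/-- The strong Markov property at the first arrival: the data there are a function of the history,
and the later noise may be averaged out independently. -/
theorem lintegral_first_job (hτ : ∀ i, Measurable (τ i)) (s : SysState)
    {F : SysState × Noise → ℝ≥0∞} (hF : Measurable F) :
    ∫⁻ ω in {ω | ∃ n, event τ s ω n = .point .job},
        F (acceptedAt τ (acceptData τ s ω), noiseAfter τ (.point .job) s ω) ∂p.law =
      p.acceptMean τ (fun c => ∫⁻ ω, F (acceptedAt τ c, ω) ∂p.law) s := by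
  have hacc := measurable_acceptedAt hτ
  have hz : ∀ n, Measurable fun h : ℕ → SysState × Event =>
      ((h n).1.x, (h n).1.est, (h n).1.age) := fun n =>
    (measurable_x.comp (measurable_pi_apply n).fst).prodMk
      ((measurable_est.comp (measurable_pi_apply n).fst).prodMk
        (measurable_age.comp (measurable_pi_apply n).fst))
  have hF' : Measurable fun c : (Fin 2 × Fin 2 × ℝ) × Noise => F (acceptedAt τ c.1, c.2) :=
    hF.comp ((hacc.comp measurable_fst).prodMk measurable_snd)
  have hZ : ∀ ω n, event τ s ω n = .point .job → (∀ m < n, event τ s ω m ≠ .point .job) →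
      acceptData τ s ω = (fun h : ℕ → SysState × Event =>
        ((h n).1.x, (h n).1.est, (h n).1.age)) (history τ s ω (n + 1)) := by
    intro ω n h h'
    simp [acceptData, firstIndex_eq h h', history]
  have key := lintegral_noiseAfter τ (.point .job) p hτ s hz hZ hF'
  rw [Params.acceptMean]
  exact key

theorem ae_exists_job (p : Params) (τ : Policy) (s : SysState) :
    ∀ᵐ ω ∂p.law, ∃ n, event τ s ω n = .point .job := by
  filter_upwards [p.ae_regular] with ω hω
  exact exists_event_of_tendsto hω.tendsto_eventCount

theorem restrict_exists_job (p : Params) (τ : Policy) (s : SysState) :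
    p.law.restrict {ω | ∃ n, event τ s ω n = .point .job} = p.law :=
  Measure.restrict_eq_self_of_ae_mem (ae_exists_job p τ s)

theorem measurable_lintegral_acceptedAt (p : Params) (hτ : ∀ i, Measurable (τ i))
    {F : SysState × Noise → ℝ≥0∞} (hF : Measurable F) :
    Measurable fun c => ∫⁻ ω, F (acceptedAt τ c, ω) ∂p.law :=
  Measurable.lintegral_prod_right' (f := fun c : (Fin 2 × Fin 2 × ℝ) × Noise =>
    F (acceptedAt τ c.1, c.2))
    (hF.comp (((measurable_acceptedAt hτ).comp measurable_fst).prodMk measurable_snd))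

theorem lintegral_first_job_emptyState (p : Params) (hτ : ∀ i, Measurable (τ i))
    {F : SysState × Noise → ℝ≥0∞} (hF : Measurable F) :
    ∫⁻ ω, F (acceptedAt τ (acceptData τ (emptyState 1 1 0) ω),
        noiseAfter τ (.point .job) (emptyState 1 1 0) ω) ∂p.law =
      ∑ i, acceptProb p τ i * ∫⁻ u, ∑ x, ENNReal.ofReal (p.transition u i x) *
        ∫⁻ ω, F (acceptState τ x i u, ω) ∂p.law ∂p.ageLaw := by
  have hm := measurable_lintegral_acceptedAt p hτ hF
  rw [← restrict_exists_job p τ (emptyState 1 1 0), lintegral_first_job hτ _ hF,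
    restrict_exists_job, acceptMean_emptyState hτ hm]
  refine Finset.sum_congr rfl fun i _ => ?_
  congr 1
  refine (lintegral_finsetSum _ fun x _ => ?_).symm
  have : Measurable fun u : ℝ => ∫⁻ ω, F (acceptState τ x i u, ω) ∂p.law :=
    hm.comp (measurable_prodMk_left.comp measurable_prodMk_left)
  fun_prop

theorem lintegral_lost (p : Params) (hτ : ∀ i, Measurable (τ i)) :
    ∫⁻ ω, (lost τ (emptyState 1 1 0) ω : ℝ≥0∞) ∂p.law = 1 + meanLost p τ := by
  have h1 : ∫⁻ ω, (lost τ (emptyState 1 1 0) ω : ℝ≥0∞) ∂p.law =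
      ∫⁻ ω, (1 + (lost τ (acceptedAt τ (acceptData τ (emptyState 1 1 0) ω))
        (noiseAfter τ (.point .job) (emptyState 1 1 0) ω) : ℝ≥0∞)) ∂p.law := by
    refine lintegral_congr_ae ?_
    filter_upwards [ae_exists_job p τ (emptyState 1 1 0)] with ω hω
    rw [lost_of_job rfl hω]
    push_cast
    rfl
  have h2 := lintegral_first_job_emptyState p hτ (measurable_lost hτ)
  rw [h1, lintegral_add_left measurable_const, lintegral_const, measure_univ, mul_one, h2]
  rfl

end FirstJob

/-! ### Mean revenue and mean number of arrivals of a cycle -/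

section Means

variable {p : Params} {τ : Policy}

instance (p : Params) : IsProbabilityMeasure p.ageLaw :=
  isProbabilityMeasure_expMeasure (add_pos p.lam_pos p.μ_pos)

theorem ae_ageLaw_nonneg (p : Params) : ∀ᵐ u ∂p.ageLaw, 0 ≤ u :=
  (ae_expMeasure_pos (p.lam + p.μ)).mono fun _ h => h.le

theorem sum_ofReal_transition {u : ℝ} (hu : 0 ≤ u) (i : Fin 2) :
    ∑ x, ENNReal.ofReal (p.transition u i x) = 1 := by
  rw [← ENNReal.ofReal_sum_of_nonneg fun x _ => p.transition_nonneg hu i x, p.transition_sum,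
    ENNReal.ofReal_one]

theorem acceptProb_sum (p : Params) (hτ : ∀ i, Measurable (τ i)) : ∑ i, acceptProb p τ i = 1 := by
  have h := lintegral_first_job_emptyState p hτ (F := fun _ => 1) measurable_const
  have h1 : ∀ i, ∫⁻ u, ∑ x, ENNReal.ofReal (p.transition u i x) * ∫⁻ _, 1 ∂p.law ∂p.ageLaw = 1 := by
    intro i
    rw [lintegral_congr_ae (g := fun _ => 1)]
    · simp
    · filter_upwards [ae_ageLaw_nonneg p] with u hu
      simp [sum_ofReal_transition hu]
  simp only [h1, mul_one] at h
  rw [← h, lintegral_const, measure_univ, one_mul]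

theorem acceptProb_ne_top (p : Params) (i : Fin 2) : acceptProb p τ i ≠ ⊤ :=
  measure_ne_top _ _

/-- Summing over the state of the machine removes the transition probabilities, which leaves the law
of the age alone. -/
theorem law_firstAccepted (p : Params) (hτ : ∀ i, Measurable (τ i)) (i : Fin 2) {B : Set ℝ}
    (hB : MeasurableSet B) :
    p.law {ω | ∃ u ∈ B, FirstAccepted τ (emptyState 1 1 0) ω i u} =
      acceptProb p τ i * p.ageLaw B := by
  set A : Set (Fin 2 × Fin 2 × ℝ) := {c | c.2.1 = i ∧ c.2.2 ∈ B} with hA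
  have hAm : MeasurableSet A :=
    (measurable_snd.fst (measurableSet_singleton i)).inter (measurable_snd.snd hB)
  have hset : {ω | ∃ u ∈ B, FirstAccepted τ (emptyState 1 1 0) ω i u} =
      {ω | (∃ n, event τ (emptyState 1 1 0) ω n = .point .job) ∧
        acceptData τ (emptyState 1 1 0) ω ∈ A} := by
    ext ω
    simp only [firstAccepted_iff, Set.mem_ofPred_eq, hA]
    constructor
    · rintro ⟨u, hu, h, h1, rfl⟩
      exact ⟨h, h1, hu⟩
    · rintro ⟨h, h1, h2⟩
      exact ⟨_, h2, h, h1, rfl⟩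
  rw [hset, ← acceptMean_indicator hτ hAm, acceptMean_emptyState hτ (measurable_one.indicator hAm),
    Finset.sum_eq_single i _ (by simp)]
  · congr 1
    rw [← lintegral_indicator_one hB, ← lintegral_finsetSum]
    · refine lintegral_congr_ae ?_
      filter_upwards [ae_ageLaw_nonneg p] with u hu
      by_cases h : u ∈ B
      · simp [A, h, sum_ofReal_transition hu]
      · simp [A, h]
    · intro x _
      have : Measurable fun u : ℝ => A.indicator (1 : Fin 2 × Fin 2 × ℝ → ℝ≥0∞) (x, i, u) :=
        (measurable_one.indicator hAm).comp (measurable_prodMk_left.comp measurable_prodMk_left)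
      fun_prop
  · intro j _ hj
    simp [A, hj]

/-- A bound on revenues. -/
noncomputable def Params.bound (p : Params) : ℝ := max |p.rs| |p.cd|

theorem measurable_reward_right (p : Params) (hτ : ∀ i, Measurable (τ i)) (s : SysState) :
    Measurable (reward p τ s) := by
  have h : Measurable fun ω : Noise => (s, ω) := measurable_prodMk_left
  have h' := (measurable_reward p hτ).comp h
  simp only [Function.comp_def] at h'
  exact h'

theorem integrable_reward (p : Params) (hτ : ∀ i, Measurable (τ i)) (s : SysState) :
    Integrable (reward p τ s) p.law :=
  Integrable.of_bound (measurable_reward_right p hτ s).aestronglyMeasurable p.bound <|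
    ae_of_all _ fun ω => abs_reward_le p s ω

theorem reward_add_bound_nonneg (p : Params) (s : SysState) (ω : Noise) :
    0 ≤ reward p τ s ω + p.bound := by
  have := neg_le_of_abs_le (abs_reward_le (τ := τ) p s ω)
  rw [Params.bound]; linarith

theorem lintegral_reward_add (p : Params) (hτ : ∀ i, Measurable (τ i)) (s : SysState) :
    ∫⁻ ω, ENNReal.ofReal (reward p τ s ω + p.bound) ∂p.law =
      ENNReal.ofReal (∫ ω, reward p τ s ω ∂p.law + p.bound) := by
  have hi : Integrable (fun ω => reward p τ s ω + p.bound) p.law :=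
    (integrable_reward p hτ s).add (integrable_const _)
  rw [← ofReal_integral_eq_lintegral_ofReal hi
    (ae_of_all _ fun ω => reward_add_bound_nonneg p s ω),
    integral_add (integrable_reward p hτ s) (integrable_const _)]
  simp

theorem integral_reward_add_nonneg (p : Params) (hτ : ∀ i, Measurable (τ i)) (s : SysState) :
    0 ≤ ∫ ω, reward p τ s ω ∂p.law + p.bound := by
  have h : 0 ≤ ∫ ω, (reward p τ s ω + p.bound) ∂p.law :=
    integral_nonneg fun ω => reward_add_bound_nonneg p s ω
  rw [integral_add (integrable_reward p hτ s) (integrable_const _)] at h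
  simpa using h

theorem integral_reward_le (p : Params) (s : SysState) :
    ∫ ω, reward p τ s ω ∂p.law ≤ p.bound := by
  refine (le_abs_self _).trans ?_
  have := norm_integral_le_of_norm_le_const (μ := p.law) (f := reward p τ s)
    (ae_of_all _ fun ω => abs_reward_le p s ω)
  simpa [Params.bound] using this

theorem measurable_integral_reward (p : Params) (hτ : ∀ i, Measurable (τ i)) (x i : Fin 2) :
    Measurable fun u => ∫ ω, reward p τ (acceptState τ x i u) ω ∂p.law := by
  have h := measurable_lintegral_acceptedAt p hτ
    (((measurable_reward p hτ).add_const p.bound).ennreal_ofReal)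
  simp only [lintegral_reward_add p hτ] at h
  have h1 : Measurable fun u : ℝ => (ENNReal.ofReal
      (∫ ω, reward p τ (acceptState τ x i u) ω ∂p.law + p.bound)).toReal - p.bound :=
    ((h.comp (measurable_prodMk_left.comp measurable_prodMk_left)).ennreal_toReal).sub_const _
  simpa only [ENNReal.toReal_ofReal (integral_reward_add_nonneg p hτ _), add_sub_cancel_right]
    using h1

theorem expectedReward_add (p : Params) (i : Fin 2) (u : ℝ) :
    expectedReward p τ i u + p.bound =
      ∑ x, p.transition u i x * (∫ ω, reward p τ (acceptState τ x i u) ω ∂p.law + p.bound) := by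
  simp only [mul_add, Finset.sum_add_distrib, ← Finset.sum_mul, p.transition_sum, one_mul]
  rfl

theorem expectedReward_add_nonneg (p : Params) (hτ : ∀ i, Measurable (τ i)) (i : Fin 2) {u : ℝ}
    (hu : 0 ≤ u) : 0 ≤ expectedReward p τ i u + p.bound := by
  rw [expectedReward_add]
  exact Finset.sum_nonneg fun x _ =>
    mul_nonneg (p.transition_nonneg hu i x) (integral_reward_add_nonneg p hτ _)

theorem integrable_expectedReward (p : Params) (hτ : ∀ i, Measurable (τ i)) (i : Fin 2) :
    Integrable (expectedReward p τ i) p.ageLaw := by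
  have hm : Measurable (expectedReward p τ i) :=
    Finset.measurable_sum _ fun x _ =>
      (p.measurable_transition i x).mul (measurable_integral_reward p hτ x i)
  refine Integrable.of_bound hm.aestronglyMeasurable p.bound ?_
  filter_upwards [ae_ageLaw_nonneg p] with u hu
  rw [Real.norm_eq_abs, abs_le]
  constructor
  · linarith [expectedReward_add_nonneg (τ := τ) p hτ i hu]
  · calc expectedReward p τ i u ≤ ∑ x, p.transition u i x * p.bound :=
        Finset.sum_le_sum fun x _ =>
          mul_le_mul_of_nonneg_left (integral_reward_le p _) (p.transition_nonneg hu i x)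
      _ = p.bound := by rw [← Finset.sum_mul, p.transition_sum, one_mul]

/-- Adding `p.bound` makes the reward nonnegative, so the Lebesgue integral formula at the first
arrival applies. The shift cancels because transition rows and acceptance probabilities sum to one.
-/
theorem integral_reward (p : Params) (hτ : ∀ i, Measurable (τ i)) :
    ∫ ω, reward p τ (emptyState 1 1 0) ω ∂p.law = meanReward p τ := by
  have h1 := lintegral_first_job_emptyState p hτ
    (((measurable_reward p hτ).add_const p.bound).ennreal_ofReal)
  have h2 : ∫⁻ ω, ENNReal.ofReal (reward p τ (emptyState 1 1 0) ω + p.bound) ∂p.law =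
      ∫⁻ ω, ENNReal.ofReal (reward p τ (acceptedAt τ (acceptData τ (emptyState 1 1 0) ω))
        (noiseAfter τ (.point .job) (emptyState 1 1 0) ω) + p.bound) ∂p.law := by
    refine lintegral_congr_ae ?_
    filter_upwards [ae_exists_job p τ (emptyState 1 1 0)] with ω hω
    rw [reward_of_job rfl hω]
  rw [← h2] at h1
  simp only [lintegral_reward_add p hτ] at h1
  have h3 : ∀ i, ∫⁻ u, ∑ x, ENNReal.ofReal (p.transition u i x) * ENNReal.ofReal
      (∫ ω, reward p τ (acceptState τ x i u) ω ∂p.law + p.bound) ∂p.ageLaw =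
      ENNReal.ofReal (∫ u, expectedReward p τ i u ∂p.ageLaw + p.bound) := by
    intro i
    have hi := integrable_expectedReward (τ := τ) p hτ i
    have : ∫ u, expectedReward p τ i u ∂p.ageLaw + p.bound =
        ∫ u, (expectedReward p τ i u + p.bound) ∂p.ageLaw := by
      rw [integral_add hi (integrable_const _)]; simp
    have hi' : Integrable (fun u => expectedReward p τ i u + p.bound) p.ageLaw :=
      hi.add (integrable_const _)
    rw [this, ofReal_integral_eq_lintegral_ofReal hi' <|
      (ae_ageLaw_nonneg p).mono fun u hu => expectedReward_add_nonneg p hτ i hu]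
    refine lintegral_congr_ae ?_
    filter_upwards [ae_ageLaw_nonneg p] with u hu
    rw [expectedReward_add, ENNReal.ofReal_sum_of_nonneg fun x _ =>
      mul_nonneg (p.transition_nonneg hu i x) (integral_reward_add_nonneg p hτ _)]
    exact Finset.sum_congr rfl fun x _ => (ENNReal.ofReal_mul (p.transition_nonneg hu i x)).symm
  have h4 : ∀ i, 0 ≤ ∫ u, expectedReward p τ i u ∂p.ageLaw + p.bound := by
    intro i
    have : 0 ≤ ∫ u, (expectedReward p τ i u + p.bound) ∂p.ageLaw := integral_nonneg_of_ae <|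
      (ae_ageLaw_nonneg p).mono fun u hu => expectedReward_add_nonneg p hτ i hu
    rw [integral_add (integrable_expectedReward p hτ i) (integrable_const _)] at this
    simpa using this
  have h5 : ∑ i, (acceptProb p τ i).toReal = 1 := by
    rw [← ENNReal.toReal_sum fun i _ => acceptProb_ne_top p i, acceptProb_sum p hτ,
      ENNReal.toReal_one]
  have h6 : meanReward p τ + p.bound = ∑ i, (acceptProb p τ i).toReal *
      (∫ u, expectedReward p τ i u ∂p.ageLaw + p.bound) := by
    simp only [mul_add, Finset.sum_add_distrib, ← Finset.sum_mul, h5, one_mul]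
    rfl
  have h7 : ENNReal.ofReal (meanReward p τ + p.bound) = ∑ i, acceptProb p τ i *
      ENNReal.ofReal (∫ u, expectedReward p τ i u ∂p.ageLaw + p.bound) := by
    rw [h6, ENNReal.ofReal_sum_of_nonneg fun i _ => mul_nonneg ENNReal.toReal_nonneg (h4 i)]
    refine Finset.sum_congr rfl fun i _ => ?_
    rw [ENNReal.ofReal_mul ENNReal.toReal_nonneg, ENNReal.ofReal_toReal (acceptProb_ne_top p i)]
  simp only [h3] at h1
  rw [← h7, ENNReal.ofReal_eq_ofReal_iff (integral_reward_add_nonneg p hτ _)] at h1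
  · exact add_right_cancel h1
  · rw [h6]
    exact Finset.sum_nonneg fun i _ => mul_nonneg ENNReal.toReal_nonneg (h4 i)

/-- If a submission is almost sure after a submission, it is almost sure from any start with an
empty buffer. -/
theorem ae_exists_submit (hτ : ∀ i, Measurable (τ i))
    (h : ∀ᵐ ω ∂p.law, ∃ n, event τ (emptyState 1 1 0) ω n = .submit) {s : SysState}
    (hs : s.holding = false) (hage : 0 ≤ s.age) : ∀ᵐ ω ∂p.law, ∃ n, event τ s ω n = .submit := by
  -- The probability of no submission is the mean, over the data at the first arrival, of the
  -- probability of none afterwards. Its vanishing is thus a null property of those data, which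
  -- `acceptMean_eq_zero` transfers to other starts.
  set N : Set (SysState × Noise) := {c | ∃ n, event τ c.1 c.2 n = .submit}ᶜ with hN
  have hNm : MeasurableSet N := (measurableSet_occurs τ .submit hτ).compl
  have hF : Measurable (N.indicator (1 : SysState × Noise → ℝ≥0∞)) := measurable_one.indicator hNm
  have hsec : ∀ s, p.law {ω | ¬ ∃ n, event τ s ω n = .submit} =
      ∫⁻ ω, N.indicator 1 (s, ω) ∂p.law := by
    intro s
    have hm : MeasurableSet {ω | ¬ ∃ n, event τ s ω n = .submit} := measurable_prodMk_left hNm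
    rw [← lintegral_indicator_one hm]
    rfl
  have key : ∀ s : SysState, s.holding = false → p.law {ω | ¬ ∃ n, event τ s ω n = .submit} =
      p.acceptMean τ (fun c => ∫⁻ ω, N.indicator 1 (acceptedAt τ c, ω) ∂p.law) s := by
    intro s hs
    rw [hsec, ← lintegral_first_job hτ s hF, restrict_exists_job]
    refine lintegral_congr_ae ?_
    filter_upwards [ae_exists_job p τ s] with ω hω
    by_cases h' : ∃ n, event τ s ω n = .submit
    · have h1 : (s, ω) ∉ N := fun h => h h'
      have h2 : (acceptedAt τ (acceptData τ s ω), noiseAfter τ (.point .job) s ω) ∉ N :=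
        fun h => h ((submit_iff_of_job hs hω).1 h')
      rw [Set.indicator_of_notMem h1, Set.indicator_of_notMem h2]
    · have h1 : (s, ω) ∈ N := h'
      have h2 : (acceptedAt τ (acceptData τ s ω), noiseAfter τ (.point .job) s ω) ∈ N :=
        fun h => h' ((submit_iff_of_job hs hω).2 h)
      rw [Set.indicator_of_mem h1, Set.indicator_of_mem h2]
      rfl
  rw [ae_iff, key _ rfl] at h
  rw [ae_iff, key _ hs]
  refine acceptMean_eq_zero hτ (measurable_lintegral_acceptedAt p hτ hF) (fun c => ?_) h hs hage
  refine (lintegral_mono fun ω => Set.indicator_le_self' (fun _ _ => zero_le) _).trans ?_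
  simp

end Means

/-! ### Independence of cycles and the limit -/

section Renewal

variable {p : Params} {τ : Policy}

theorem measurableSet_submits_right (hτ : ∀ i, Measurable (τ i)) (s : SysState) :
    MeasurableSet {ω | ∃ n, event τ s ω n = .submit} :=
  measurable_prodMk_left (measurableSet_occurs τ .submit hτ)

theorem measurable_noiseAfter_right (hτ : ∀ i, Measurable (τ i)) (K : Event) (s : SysState) :
    Measurable (noiseAfter τ K s) := by
  have h : Measurable fun ω : Noise => (s, ω) := measurable_prodMk_left
  have h' := (measurable_noiseAfter τ K hτ).comp h
  simp only [Function.comp_def] at h'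
  exact h'

/-- What happens up to the first submission is independent of what follows. -/
theorem law_inter_noiseAfter (p : Params) (hτ : ∀ i, Measurable (τ i)) (s : SysState)
    {A : Type*} [MeasurableSpace A] {Z : Noise → A} (hZm : Measurable Z)
    {z : ℕ → (ℕ → SysState × Event) → A} (hz : ∀ n, Measurable (z n))
    (hZ : ∀ ω n, event τ s ω n = .submit → (∀ m < n, event τ s ω m ≠ .submit) →
      Z ω = z n (history τ s ω (n + 1))) {a : Set A} (ha : MeasurableSet a) {B : Set Noise}
    (hB : MeasurableSet B) :
    p.law ((Z ⁻¹' a ∩ noiseAfter τ .submit s ⁻¹' B) ∩ {ω | ∃ n, event τ s ω n = .submit}) =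
      p.law (Z ⁻¹' a ∩ {ω | ∃ n, event τ s ω n = .submit}) * p.law B := by
  have hF : Measurable ((a ×ˢ B).indicator (1 : A × Noise → ℝ≥0∞)) :=
    measurable_one.indicator (ha.prod hB)
  have key := lintegral_noiseAfter τ .submit p hτ s hz hZ hF
  have h1 : ∀ ω, (a ×ˢ B).indicator (1 : A × Noise → ℝ≥0∞) (Z ω, noiseAfter τ .submit s ω) =
      (Z ⁻¹' a ∩ noiseAfter τ .submit s ⁻¹' B).indicator 1 ω := fun ω => rfl
  have h2 : ∀ ω, ∫⁻ ω', (a ×ˢ B).indicator (1 : A × Noise → ℝ≥0∞) (Z ω, ω') ∂p.law =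
      (Z ⁻¹' a).indicator 1 ω * p.law B := by
    intro ω
    by_cases h : ω ∈ Z ⁻¹' a
    · rw [Set.indicator_of_mem h, Pi.one_apply, one_mul, ← lintegral_indicator_one hB]
      refine lintegral_congr fun ω' => ?_
      by_cases h' : ω' ∈ B
      · rw [Set.indicator_of_mem h', Set.indicator_of_mem (show (Z ω, ω') ∈ a ×ˢ B from ⟨h, h'⟩)]
        rfl
      · rw [Set.indicator_of_notMem h',
          Set.indicator_of_notMem fun hh : (Z ω, ω') ∈ a ×ˢ B => h' hh.2]
    · rw [Set.indicator_of_notMem h, zero_mul]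
      simp_rw [Set.indicator_of_notMem (fun hh : (Z ω, _) ∈ a ×ˢ B => h hh.1)]
      simp
  simp only [h1, h2] at key
  rw [lintegral_indicator_one ((hZm ha).inter (measurable_noiseAfter_right hτ _ s hB)),
    lintegral_mul_const _ (measurable_one.indicator (hZm ha)),
    lintegral_indicator_one (hZm ha),
    Measure.restrict_apply ((hZm ha).inter (measurable_noiseAfter_right hτ _ s hB)),
    Measure.restrict_apply (hZm ha)] at key
  exact key

theorem law_noiseAfter (p : Params) (hτ : ∀ i, Measurable (τ i)) (s : SysState) {B : Set Noise}
    (hB : MeasurableSet B) :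
    p.law (noiseAfter τ .submit s ⁻¹' B ∩ {ω | ∃ n, event τ s ω n = .submit}) =
      p.law {ω | ∃ n, event τ s ω n = .submit} * p.law B := by
  have := law_inter_noiseAfter p hτ s (Z := fun _ => ()) measurable_const
    (z := fun _ _ => ()) (fun _ => measurable_const) (fun _ _ _ _ => rfl) MeasurableSet.univ hB
  simpa using this

theorem ae_noiseAfter (p : Params) (hτ : ∀ i, Measurable (τ i)) (s : SysState) {P : Noise → Prop}
    (hP : ∀ᵐ ω ∂p.law, P ω) :
    ∀ᵐ ω ∂p.law, (∃ n, event τ s ω n = .submit) → P (noiseAfter τ .submit s ω) := by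
  obtain ⟨B, hsub, hB, h0⟩ := exists_measurable_superset_of_null (ae_iff.1 hP)
  have h := law_noiseAfter p hτ s hB
  rw [h0, mul_zero] at h
  refine measure_mono_null (fun ω hω => ?_) h
  rw [Set.mem_compl_iff, Set.mem_ofPred_eq, Classical.not_imp] at hω
  exact ⟨hsub hω.2, hω.1⟩

/-- The revenue of the first cycle and the number of jobs that arrive in it. -/
noncomputable def cycleData (p : Params) (τ : Policy) (ω : Noise) : ℝ × ℝ≥0∞ :=
  (reward p τ (emptyState 1 1 0) ω, ((lost τ (emptyState 1 1 0) ω : ℕ∞) : ℝ≥0∞))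

theorem measurable_cycleData (p : Params) (hτ : ∀ i, Measurable (τ i)) :
    Measurable (cycleData p τ) := by
  have h : Measurable fun ω : Noise => (emptyState 1 1 0, ω) := measurable_prodMk_left
  have h' := (measurable_lost hτ).comp h
  simp only [Function.comp_def] at h'
  exact (measurable_reward_right p hτ _).prodMk h'

open Classical in
/-- The data of the first cycle in terms of the history. -/
noncomputable def cycleOfHistory (p : Params) (n : ℕ) (h : ℕ → SysState × Event) : ℝ × ℝ≥0∞ :=
  (p.payoff (h n).1, ∑ m ∈ Finset.range (n + 1), if (h m).2 = .point .job then 1 else 0)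

theorem measurable_cycleOfHistory (p : Params) (n : ℕ) : Measurable (cycleOfHistory p n) := by
  classical
  refine Measurable.prodMk (f := fun h : ℕ → SysState × Event => p.payoff (h n).1)
    (g := fun h => ∑ m ∈ Finset.range (n + 1), if (h m).2 = .point .job then (1 : ℝ≥0∞) else 0)
    ((measurable_payoff p).comp (measurable_pi_apply n).fst) ?_
  refine Finset.measurable_sum (f := fun m (h : ℕ → SysState × Event) =>
    if (h m).2 = .point .job then (1 : ℝ≥0∞) else 0) _ fun m _ => ?_
  have hs : MeasurableSet {h : ℕ → SysState × Event | (h m).2 = .point .job} :=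
    (measurable_pi_apply m).snd (measurableSet_singleton (Event.point .job))
  exact Measurable.ite hs measurable_const measurable_const

theorem cycleData_eq {ω : Noise} {n : ℕ} (h : event τ (emptyState 1 1 0) ω n = .submit)
    (h' : ∀ m < n, event τ (emptyState 1 1 0) ω m ≠ .submit) :
    cycleData p τ ω = cycleOfHistory p n (history τ (emptyState 1 1 0) ω (n + 1)) := by
  classical
  have hn := firstIndex_eq h h'
  rw [cycleData, cycleOfHistory, reward_eq ⟨n, h⟩, lost_eq ⟨n, h⟩, hn]
  refine Prod.ext ?_ ?_
  · simp [history]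
  · refine (ENat.toENNReal_coe _).trans ?_
    simp only [eventCount, Nat.count_eq_card_filter_range, Finset.card_filter, Nat.cast_sum]
    refine Finset.sum_congr rfl fun m hm => ?_
    simp [history, Finset.mem_range.1 hm]

theorem law_submits_inter
    (h : ∀ᵐ ω ∂p.law, ∃ n, event τ (emptyState 1 1 0) ω n = .submit) (B : Set Noise) :
    p.law ({ω | ∃ n, event τ (emptyState 1 1 0) ω n = .submit} ∩ B) = p.law B :=
  Measure.measure_inter_eq_of_ae h

theorem law_submits (h : ∀ᵐ ω ∂p.law, ∃ n, event τ (emptyState 1 1 0) ω n = .submit) :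
    p.law {ω | ∃ n, event τ (emptyState 1 1 0) ω n = .submit} = 1 := by
  rw [← Set.inter_univ {ω | ∃ n, event τ (emptyState 1 1 0) ω n = .submit},
    law_submits_inter h, measure_univ]

/-- The later noise is fresh on the event of a submission; that event being almost sure, the
restriction can be dropped. -/
theorem measurePreserving_nextCycle (hτ : ∀ i, Measurable (τ i))
    (h : ∀ᵐ ω ∂p.law, ∃ n, event τ (emptyState 1 1 0) ω n = .submit) :
    MeasurePreserving (nextCycle τ) p.law p.law := by
  have hm : Measurable (nextCycle τ) := measurable_noiseAfter_right hτ _ _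
  refine ⟨hm, Measure.ext fun B hB => ?_⟩
  have key := law_noiseAfter p hτ (emptyState 1 1 0) hB
  rw [Set.inter_comm, law_submits_inter h, law_submits h, one_mul] at key
  rw [Measure.map_apply hm hB]
  exact key

theorem indepFun_cycleData (hτ : ∀ i, Measurable (τ i))
    (h : ∀ᵐ ω ∂p.law, ∃ n, event τ (emptyState 1 1 0) ω n = .submit) :
    IndepFun (cycleData p τ) (nextCycle τ) p.law := by
  rw [indepFun_iff_measure_inter_preimage_eq_mul]
  intro a B ha hB
  have key := law_inter_noiseAfter p hτ (emptyState 1 1 0) (measurable_cycleData p hτ)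
    (measurable_cycleOfHistory p) (fun ω n h1 h2 => cycleData_eq h1 h2) ha hB
  rw [(measurePreserving_nextCycle hτ h).measure_preimage hB.nullMeasurableSet]
  rw [Set.inter_comm, law_submits_inter h, Set.inter_comm (cycleData p τ ⁻¹' a) {ω | _},
    law_submits_inter h] at key
  exact key

theorem ae_ne_top_lost (h : ∀ᵐ ω ∂p.law, ∃ n, event τ (emptyState 1 1 0) ω n = .submit) :
    ∀ᵐ ω ∂p.law, (cycleData p τ ω).2 ≠ ⊤ := by
  filter_upwards [h] with ω hω
  rw [cycleData, lost_eq hω]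
  simp

/-- A finite mean forces finitely many arrivals before the first submission almost surely, whereas
jobs keep arriving if there is no submission. -/
theorem meanLost_eq_top (hτ : ∀ i, Measurable (τ i))
    (h : ¬ ∀ᵐ ω ∂p.law, ∃ n, event τ (emptyState 1 1 0) ω n = .submit) : meanLost p τ = ⊤ := by
  by_contra hne
  have h1 := lintegral_lost p hτ
  refine h ?_
  filter_upwards [p.ae_regular, ae_lt_top (measurable_cycleData p hτ).snd
    (h1.trans_ne (ENNReal.add_ne_top.2 ⟨ENNReal.one_ne_top, hne⟩))] with ω hω hlt
  by_contra hs
  rw [cycleData, lost_of_no_submit hs hω.tendsto_eventCount] at hlt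
  simp at hlt

/-- The limit of the revenue per arrival. -/
noncomputable def limitRate (p : Params) (τ : Policy) : ℝ :=
  meanReward p τ / (1 + meanLost p τ).toReal

/-- Strong laws for revenue and arrivals per cycle, followed by the deterministic renewal-reward
limit. Revenue is bounded, so only the arrivals can have an infinite mean, and then the limit is
`0`. -/
theorem tendsto_ratio_of_ae_submit (hτ : ∀ i, Measurable (τ i))
    (h : ∀ᵐ ω ∂p.law, ∃ n, event τ (emptyState 1 1 0) ω n = .submit) :
    ∀ᵐ ω ∂p.law, Tendsto (revenueRatio p τ (emptyState 1 1 0) ω) atTop (𝓝 (limitRate p τ)) := by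
  have hθ := measurePreserving_nextCycle hτ h
  have hind := indepFun_cycleData hτ h
  have hm := measurable_cycleData p hτ
  have hall : ∀ᵐ ω ∂p.law, ∀ j, ∃ n,
      event τ (emptyState 1 1 0) ((nextCycle τ)^[j] ω) n = .submit :=
    ae_all_iff.2 fun j => (hθ.iterate j).quasiMeasurePreserving.ae h
  have hy : ∀ᵐ ω ∂p.law, Tendsto (fun n : ℕ => (∑ j ∈ Finset.range n,
      (cycleData p τ ((nextCycle τ)^[j] ω)).1) / n) atTop (𝓝 (meanReward p τ)) := by
    rw [← integral_reward p hτ]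
    exact strong_law_iterate hθ (f := fun ω => (cycleData p τ ω).1) hm.fst
      (integrable_reward p hτ _) (hind.comp measurable_fst measurable_id)
  have hmean : ∫⁻ ω, (cycleData p τ ω).2 ∂p.law = 1 + meanLost p τ := lintegral_lost p hτ
  by_cases htop : meanLost p τ = ⊤
  · have hJ := strong_law_iterate_top hθ (g := fun ω => (cycleData p τ ω).2) hm.snd
      (ae_ne_top_lost h) (by rw [hmean, htop, add_top]) (hind.comp measurable_snd measurable_id)
    have h0 : limitRate p τ = 0 := by simp [limitRate, htop]
    filter_upwards [hall, hy, hJ] with ω h1 h2 h3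
    obtain ⟨κ, hκ, hnum, hden, -⟩ := exists_cycle_index (p := p) h1
    rw [h0]
    exact tendsto_renewal_reward_zero hκ hnum hden h2 h3
  · have hfin : 1 + meanLost p τ ≠ ⊤ := ENNReal.add_ne_top.2 ⟨ENNReal.one_ne_top, htop⟩
    have hint : Integrable (fun ω => (cycleData p τ ω).2.toReal) p.law :=
      integrable_toReal_of_lintegral_ne_top hm.snd.aemeasurable (hmean.trans_ne hfin)
    have hJ := strong_law_iterate hθ (f := fun ω => (cycleData p τ ω).2.toReal)
      hm.snd.ennreal_toReal hint
      (hind.comp (φ := fun c : ℝ × ℝ≥0∞ => c.2.toReal) measurable_snd.ennreal_toReal measurable_id)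
    rw [integral_toReal hm.snd.aemeasurable
      ((ae_ne_top_lost h).mono fun ω hω => hω.lt_top), hmean] at hJ
    have hpos : 0 < (1 + meanLost p τ).toReal := ENNReal.toReal_pos (by simp) hfin
    filter_upwards [hall, hy, hJ] with ω h1 h2 h3
    obtain ⟨κ, hκ, hnum, hden₁, hden₂⟩ := exists_cycle_index (p := p) h1
    exact tendsto_renewal_reward hκ hnum hden₁ hden₂ hpos h2 h3

/-- If some cycle does not end, the revenue per arrival vanishes. -/
theorem tendsto_ratio_of_exists_no_submit (k : ℕ) {ω : Noise}
    (hN : Tendsto (eventCount τ (emptyState 1 1 0) ω (.point .job)) atTop atTop)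
    (hk : ¬ ∃ n, event τ (emptyState 1 1 0) ((nextCycle τ)^[k] ω) n = .submit) :
    Tendsto (revenueRatio p τ (emptyState 1 1 0) ω) atTop (𝓝 0) := by
  induction k generalizing ω with
  | zero => exact tendsto_ratio_of_no_submit hk
  | succ k ih =>
    by_cases h0 : ∃ n, event τ (emptyState 1 1 0) ω n = .submit
    · have hN' := tendsto_eventCount_after hN (firstIndex τ .submit (emptyState 1 1 0) ω + 1)
      rw [config_after_submit h0] at hN'
      exact tendsto_ratio_of_submit h0 hN (ih hN' hk)
    · exact tendsto_ratio_of_no_submit h0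

/-- The first `k` cycles all end with probability `p.law G ^ k`, by freshness of the noise after
each submission, and this tends to `0`. -/
theorem ae_exists_no_submit (hτ : ∀ i, Measurable (τ i))
    (h : ¬ ∀ᵐ ω ∂p.law, ∃ n, event τ (emptyState 1 1 0) ω n = .submit) :
    ∀ᵐ ω ∂p.law, ∃ k, ¬ ∃ n, event τ (emptyState 1 1 0) ((nextCycle τ)^[k] ω) n = .submit := by
  set G : Set Noise := {ω | ∃ n, event τ (emptyState 1 1 0) ω n = .submit} with hG
  have hGm : MeasurableSet G := measurableSet_submits_right hτ _
  have hq : p.law G < 1 := by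
    refine lt_of_le_of_ne prob_le_one fun h1 => h ?_
    exact (mem_ae_iff_prob_eq_one hGm).2 h1
  have hm : Measurable (nextCycle τ) := measurable_noiseAfter_right hτ _ _
  set E : ℕ → Set Noise := fun k => {ω | ∀ j < k, (nextCycle τ)^[j] ω ∈ G} with hE
  have hEm : ∀ k, MeasurableSet (E k) := fun k => by
    have : E k = ⋂ j, ⋂ _ : j < k, (nextCycle τ)^[j] ⁻¹' G := by ext; simp [hE]
    rw [this]
    exact .iInter fun j => .iInter fun _ => (hm.iterate j) hGm
  have hlaw : ∀ k, p.law (E k) = p.law G ^ k := by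
    intro k
    induction k with
    | zero => simp [hE]
    | succ k ih =>
      have : E (k + 1) = nextCycle τ ⁻¹' E k ∩ G := by
        ext ω
        constructor
        · exact fun hω => ⟨fun j hj => hω (j + 1) (by omega), hω 0 (by omega)⟩
        · rintro ⟨h1, h2⟩ j hj
          cases j with
          | zero => exact h2
          | succ j => exact h1 j (by omega)
      have key := law_noiseAfter p hτ (emptyState 1 1 0) (hEm k)
      rw [this, pow_succ', ← ih]
      exact key
  have hlim : Tendsto (fun k => p.law G ^ k) atTop (𝓝 0) :=
    ENNReal.tendsto_pow_atTop_nhds_zero_of_lt_one hq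
  rw [ae_iff]
  refine le_antisymm (ge_of_tendsto' hlim fun k => ?_) zero_le
  rw [← hlaw]
  refine measure_mono fun ω hω j _ => ?_
  by_contra hc
  exact hω ⟨j, hc⟩

theorem tendsto_ratio_emptyState (p : Params) (hτ : ∀ i, Measurable (τ i)) :
    ∀ᵐ ω ∂p.law, Tendsto (revenueRatio p τ (emptyState 1 1 0) ω) atTop (𝓝 (limitRate p τ)) := by
  by_cases h : ∀ᵐ ω ∂p.law, ∃ n, event τ (emptyState 1 1 0) ω n = .submit
  · exact tendsto_ratio_of_ae_submit hτ h
  · have h0 : limitRate p τ = 0 := by simp [limitRate, meanLost_eq_top hτ h]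
    rw [h0]
    filter_upwards [p.ae_regular, ae_exists_no_submit hτ h] with ω hω ⟨k, hk⟩
    exact tendsto_ratio_of_exists_no_submit k hω.tendsto_eventCount hk

theorem tendsto_ratio (p : Params) (hτ : ∀ i, Measurable (τ i)) {s : SysState}
    (hs : s.holding = false) (hage : 0 ≤ s.age) :
    ∀ᵐ ω ∂p.law, Tendsto (revenueRatio p τ s ω) atTop (𝓝 (limitRate p τ)) := by
  have h1 := ae_noiseAfter p hτ s (tendsto_ratio_emptyState p hτ)
  -- A path from `s` without any submission has limit `0`; either such paths are negligible or the
  -- claimed limit is `0` as well.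
  have h2 : ∀ᵐ ω ∂p.law, (∃ n, event τ s ω n = .submit) ∨ limitRate p τ = 0 := by
    by_cases h : ∀ᵐ ω ∂p.law, ∃ n, event τ (emptyState 1 1 0) ω n = .submit
    · exact (ae_exists_submit hτ h hs hage).mono fun ω hω => Or.inl hω
    · exact ae_of_all _ fun ω => Or.inr (by simp [limitRate, meanLost_eq_top hτ h])
  filter_upwards [p.ae_regular, h1, h2] with ω hω h1 h2
  by_cases h : ∃ n, event τ s ω n = .submit
  · exact tendsto_ratio_of_submit h hω.tendsto_eventCount (h1 h)
  · rw [h2.resolve_left h]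
    exact tendsto_ratio_of_no_submit h

theorem tendsto_revenueRate (p : Params) (hτ : ∀ i, Measurable (τ i)) {s : SysState}
    (hs : s.holding = false) (hage : 0 ≤ s.age) :
    ∀ᵐ ω ∂p.law, Tendsto (fun t : ℝ => revenueRate p τ s ω t) atTop (𝓝 (limitRate p τ)) := by
  filter_upwards [p.ae_regular, tendsto_ratio p hτ hs hage] with ω hω h
  exact hω.tendsto_revenueRate h

theorem averageRevenue_eq (p : Params) (hτ : ∀ i, Measurable (τ i)) {s : SysState}
    (hs : s.holding = false) (hage : 0 ≤ s.age) : averageRevenue p τ s = limitRate p τ := by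
  rw [averageRevenue, integral_congr_ae (g := fun _ => limitRate p τ)]
  · simp
  · filter_upwards [tendsto_revenueRate p hτ hs hage] with ω hω
    exact hω.limUnder_eq

/-- For an infinite denominator `toReal` gives `0` and real division by `0` gives `0`, in agreement
with division by `⊤` in `EReal`. -/
theorem coe_limitRate (p : Params) (τ : Policy) : ((limitRate p τ : ℝ) : EReal) =
    ((meanReward p τ : ℝ) : EReal) / ((1 + meanLost p τ : ℝ≥0∞) : EReal) := by
  by_cases h : 1 + meanLost p τ = ⊤
  · rw [limitRate, h, EReal.coe_ennreal_top, EReal.div_top, ENNReal.toReal_top, div_zero,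
      EReal.coe_zero]
  · rw [limitRate, EReal.coe_div, EReal.coe_ennreal_toReal h]

end Renewal

end MarkovMachine

open MarkovMachine in
theorem theorem1 (p : Params) (τ : Policy) (hτ : ∀ i, Measurable (τ i))
    (x₀ i₀ : Fin 2) (u₀ : ℝ) (hu₀ : 0 ≤ u₀) :
    -- the limit exists almost surely and equals `R`
    (∀ᵐ ω ∂p.law, Tendsto (fun t : ℝ => revenueRate p τ (emptyState x₀ i₀ u₀) ω t) atTop
      (𝓝 (averageRevenue p τ (emptyState x₀ i₀ u₀)))) ∧
    -- the formula for `R`, in the extended reals, where `a / ⊤ = 0` for real `a`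
    ((averageRevenue p τ (emptyState x₀ i₀ u₀) : ℝ) : EReal) =
      ((meanReward p τ : ℝ) : EReal) / ((1 + meanLost p τ : ℝ≥0∞) : EReal) ∧
    -- `p_0 + p_1 = 1`, and `U` is the age of the estimate when a job is accepted
    acceptProb p τ 0 + acceptProb p τ 1 = 1 ∧
    ∀ (i : Fin 2) (B : Set ℝ), MeasurableSet B →
      p.law {ω | ∃ u ∈ B, FirstAccepted τ (emptyState 1 1 0) ω i u} =
        acceptProb p τ i * p.ageLaw B := by
  have h := averageRevenue_eq p hτ (s := emptyState x₀ i₀ u₀) rfl hu₀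
  rw [h]
  refine ⟨tendsto_revenueRate p hτ rfl hu₀, coe_limitRate p τ, ?_,
    fun i B hB => law_firstAccepted p hτ i hB⟩
  rw [← Fin.sum_univ_two, acceptProb_sum p hτ]
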